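/- Let $\eta=\mathrm{diag}(-1,1,1)$, $\mathbb H^2=\{w\in\mathbb R^3: -w_0^2+w_1^2+w_2^2=-1,\ w_0>0\}$ and $\|w\|^2=|\langle w,\eta w\rangle|$. A smooth Schrödinger map is a smooth $u:\mathbb R\times\mathbb R^2\to\mathbb H^2$ with $$\partial_t u=\eta(u\times\Delta u)=\eta\sum_{\ell=1}^2\partial_\ell(u\times\partial_\ell u).$$ Write $\|\nabla u(t)\|_{L^2}^2=\sum_{\ell}\int_{\mathbb R^2}\|\partial_\ell u(t,x)\|^2dx$. **Proposition.** Let $C\ge 0$ and let $(u_k)$ be a sequence of smooth Schrödinger maps with $$\|\nabla u_k\|_{L^2}^2\le C,\qquad \int_{\mathbb R^2}\big((u_k)_0-1\big)\,dx\le C,$$ where, for each $k$, either these bounds hold at every time $t\in\mathbb R$, or they hold at $t=0$ and moreover $\|\nabla u_k\|$ and $\|\partial_t u_k\|$ belong to $L^2([-T,T]\times\mathbb R^2)$ for every $T>0$ (with no uniformity in $k$). Then there are a single subsequence $(u_{k_j})$ and a map $u$ such that: 1. for every $1\le p<2$, $u\in L^\infty(\mathbb R;W^{1,p}_{\rm loc}(\mathbb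 R^2))$ and $u_{k_j}\to u$ weak-* in $L^\infty(\mathbb R;W^{1,p}_{\rm loc}(\mathbb R^2))$, that is, for each compact $K\subset\mathbb R^2$, the functions $u_{k_j}$ and their derivatives $\partial_\ell u_{k_j}$ converge to $u$ and to its weak derivatives $\partial_\ell u$ when tested against $L^1(\mathbb R;L^{p'}(K))$, $\frac1p+\frac1{p'}=1$; 2. $u$ is a weak solution of the Cauchy problem $\partial_t u=\eta\sum_\ell\partial_\ell(u\times\partial_\ell u)$, $\|\nabla u(0)\|\in L^2(\mathbb R^2)$, $u_0(0)-1\in L^1(\mathbb R^2)$ into $\mathbb H^2$: $u\in C(\mathbb R;L^2_{\rm loc}(\mathbb R^2))$, $u(t,x)\in\mathbb H^2$ for every $t$ and almost every $x$, $u(t)$ has a weak gradient for every $t$, $u$ and $u\times\partial_\ell u$ are locally integrable on $\mathbb R\times\mathbb R^2$, the equation holds in the sense of distributions on $\mathbb R\times\mathbb R^2$, and the two conditions at $t=0$ hold; 3. for every $t\in\mathbb R$, $\|\nabla u(t)\|_{L^2}^2\le C$ and $\int_{\mathbb R^2}(u_0(t)-1)\,dx\le C$. -/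

import Mathlib

namespace HypSM

open MeasureTheory Filter Topology
open scoped ENNReal NNReal ContDiff

/-- The space domain `ℝ²`. -/
abbrev Plane : Type := EuclideanSpace ℝ (Fin 2)

/-- The ambient space `ℝ³` of the target, with coordinates `(v 0, v 1, v 2)`. Its norm enters only
through local integrability and finiteness or convergence of `Lᵖ` norms, so that the choice among
the equivalent norms of `ℝ³` is immaterial. -/
abbrev Amb : Type := Fin 3 → ℝ

/-- Space-time `ℝ × ℝ²`, a point being written `(t, x)`. -/
abbrev SpaceTime : Type := ℝ × Plane

/-! ### The hyperbolic plane in Lorentz space -/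

/-- The matrix `η = diag (-1, 1, 1)`. -/
def eta (v : Amb) : Amb := ![-v 0, v 1, v 2]

/-- The Lorentz product `⟨v, η w⟩`. -/
def lor (v w : Amb) : ℝ := v ⬝ᵥ eta w

/-- The hyperbolic plane `{-u₀² + u₁² + u₂² = -1, u₀ > 0}`. -/
def hypPlane : Set Amb := {v | lor v v = -1 ∧ 0 < v 0}

/-- `‖v‖² = |⟨v, η v⟩|`. -/
def lorNormSq (v : Amb) : ℝ := |lor v v|

/-! ### Classical derivatives and smooth solutions -/

/-- The `k`-th partial derivative of a function on `ℝ²`. -/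
noncomputable def partialDeriv {F : Type*} [NormedAddCommGroup F] [NormedSpace ℝ F]
    (k : Fin 2) (f : Plane → F) (x : Plane) : F :=
  fderiv ℝ f x (EuclideanSpace.single k 1)

/-- The time derivative `∂ₜ u` on space-time. -/
noncomputable def dt {F : Type*} [NormedAddCommGroup F] [NormedSpace ℝ F]
    (u : SpaceTime → F) (z : SpaceTime) : F :=
  deriv (fun s => u (s, z.2)) z.1

/-- The space derivative `∂ₖ u` on space-time. -/
noncomputable def dx {F : Type*} [NormedAddCommGroup F] [NormedSpace ℝ F]
    (k : Fin 2) (u : SpaceTime → F) (z : SpaceTime) : F :=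
  partialDeriv k (fun y => u (z.1, y)) z.2

/-- Smooth Schrödinger maps `u : ℝ × ℝ² → ℍ²`, that is, smooth solutions of
`∂ₜ u = η (u × Δ u)`. -/
structure IsSmoothSchrodingerMap (u : SpaceTime → Amb) : Prop where
  smooth : ContDiff ℝ ∞ u
  mem_hypPlane : ∀ z, u z ∈ hypPlane
  equation : ∀ z, dt u z = eta (crossProduct (u z) (∑ k : Fin 2, dx k (dx k u) z))

/-! ### Energy and mass -/

/-- `∫ ‖∇u(t)‖² dx = ∑ₖ ∫ ‖∂ₖ u (t, x)‖² dx`, as a function of the gradient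
`Du = (∂₁ u, ∂₂ u)` (classical or weak) and of the time `t`. -/
noncomputable def energy (Du : Fin 2 → SpaceTime → Amb) (t : ℝ) : ℝ≥0∞ :=
  ∫⁻ x : Plane, ENNReal.ofReal (∑ k : Fin 2, lorNormSq (Du k (t, x)))

/-- `∫ (u₀(t) - 1) dx`; the integrand is nonnegative for maps into the hyperbolic plane. -/
noncomputable def mass (u : SpaceTime → Amb) (t : ℝ) : ℝ≥0∞ :=
  ∫⁻ x : Plane, ENNReal.ofReal (u (t, x) 0 - 1)

/-- `∫ ‖∇u‖² dx ≤ C` and `∫ (u₀ - 1) dx ≤ C` for a smooth map `u`. Either both bounds hold at all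
times, or they are imposed on the initial data only; in the latter case `u` is asked to be
regular at spatial infinity in the (qualitative) sense that `‖∂ₜ u‖` and `‖∇u‖` are square
integrable over every slab `[-T, T] × ℝ²`. -/
def HasBounds (C : ℝ≥0) (u : SpaceTime → Amb) : Prop :=
  (∀ t : ℝ, energy (fun k => dx k u) t ≤ C ∧ mass u t ≤ C) ∨
  (energy (fun k => dx k u) 0 ≤ C ∧ mass u 0 ≤ C ∧
    ∀ T : ℝ, ∫⁻ z in Set.Icc (-T) T ×ˢ (Set.univ : Set Plane),
      ENNReal.ofReal (lorNormSq (dt u z) + ∑ k : Fin 2, lorNormSq (dx k u z)) < ⊤)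

/-! ### Weak derivatives and `L^∞(W^{1,p}_loc)` -/

/-- `g` is the weak `k`-th partial derivative of `f` on `ℝ²`. -/
structure IsWeakPartial (k : Fin 2) (f g : Plane → Amb) : Prop where
  locInt_left : LocallyIntegrable f
  locInt_right : LocallyIntegrable g
  integral_eq : ∀ φ : Plane → ℝ, ContDiff ℝ ∞ φ → HasCompactSupport φ →
    ∫ x, partialDeriv k φ x • f x = - ∫ x, φ x • g x

/-- `Du = (D₁u, D₂u)` is the weak spatial gradient of `u`, at every time. -/
def IsWeakGradient (u : SpaceTime → Amb) (Du : Fin 2 → SpaceTime → Amb) : Prop :=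
  ∀ (k : Fin 2) (t : ℝ), IsWeakPartial k (fun x => u (t, x)) (fun x => Du k (t, x))

/-- `f ∈ L^∞(ℝ; L^p_loc(ℝ²))`: for each compact `K`, the norm of `f(t)` in `L^p(K)` is
essentially bounded in `t`. -/
def MemLinftyLpLoc (p : ℝ≥0∞) (f : SpaceTime → Amb) : Prop :=
  AEStronglyMeasurable f ∧ ∀ K : Set Plane, IsCompact K →
    ∃ B : ℝ≥0, ∀ᵐ t : ℝ, eLpNorm (fun x => f (t, x)) p (volume.restrict K) ≤ B

/-- `u ∈ L^∞(ℝ; W^{1,p}_loc(ℝ²))`, where `Du` is the spatial gradient of `u`. -/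
def MemLinftyW1pLoc (p : ℝ≥0∞) (u : SpaceTime → Amb) (Du : Fin 2 → SpaceTime → Amb) : Prop :=
  MemLinftyLpLoc p u ∧ (∀ k, MemLinftyLpLoc p (Du k)) ∧ IsWeakGradient u Du

/-- Weak-* convergence in `L^∞(ℝ; L^p_loc(ℝ²))`: for each compact `K`, convergence of the pairings
with all `ψ ∈ L¹(ℝ; L^{p'}(K))`, where `1/p + 1/p' = 1`. -/
def TendstoWeakStarLp (p : ℝ≥0∞) (f : ℕ → SpaceTime → Amb) (g : SpaceTime → Amb) : Prop :=
  ∀ K : Set Plane, IsCompact K → ∀ ψ : SpaceTime → Amb, AEStronglyMeasurable ψ →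
    ∫⁻ t : ℝ, eLpNorm (fun x => ψ (t, x)) p.conjExponent (volume.restrict K) < ⊤ →
    Tendsto (fun j => ∫ z in (Set.univ : Set ℝ) ×ˢ K, f j z ⬝ᵥ ψ z) atTop
      (𝓝 (∫ z in (Set.univ : Set ℝ) ×ˢ K, g z ⬝ᵥ ψ z))

/-- Weak-* convergence in `L^∞(ℝ; W^{1,p}_loc(ℝ²))`. The functionals on `W^{1,p}` are those of the
form `v ↦ ∫ (v · ψ₀ + ∂₁ v · ψ₁ + ∂₂ v · ψ₂)` with `ψᵢ ∈ L^{p'}`, so this is weak-* convergence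
of the functions and of both of their spatial derivatives. -/
structure TendstoWeakStarW1p (p : ℝ≥0∞) (u : ℕ → SpaceTime → Amb)
    (Du : ℕ → Fin 2 → SpaceTime → Amb) (v : SpaceTime → Amb) (Dv : Fin 2 → SpaceTime → Amb) :
    Prop where
  mem : ∀ j, MemLinftyW1pLoc p (u j) (Du j)
  mem_limit : MemLinftyW1pLoc p v Dv
  tendsto : TendstoWeakStarLp p u v
  tendsto_grad : ∀ k, TendstoWeakStarLp p (fun j => Du j k) (Dv k)

/-! ### Weak solutions -/

/-- `u ∈ C(ℝ; L²_loc(ℝ²))`. -/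
def ContinuousL2Loc (u : SpaceTime → Amb) : Prop :=
  ∀ K : Set Plane, IsCompact K →
    (∀ t : ℝ, MemLp (fun x => u (t, x)) 2 (volume.restrict K)) ∧
    ∀ t : ℝ, Tendsto (fun s => eLpNorm (fun x => u (s, x) - u (t, x)) 2 (volume.restrict K))
      (𝓝 t) (𝓝 0)

/-- `u`, with weak spatial gradient `Du`, is a weak solution of the Cauchy problem
`∂ₜ u = η ∂ₖ (u × ∂ₖ u)`, `‖∇u(0)‖ ∈ L²(ℝ²)`, `u₀(0) - 1 ∈ L¹(ℝ²)` for maps into the hyperbolic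
plane: the equation holds in the sense of distributions on `ℝ × ℝ²`, and `u` is continuous in time
with values in `L²_loc`, so that `u(t)` makes sense at each time. -/
structure IsWeakSolution (u : SpaceTime → Amb) (Du : Fin 2 → SpaceTime → Amb) : Prop where
  mem_hypPlane : ∀ t : ℝ, ∀ᵐ x : Plane, u (t, x) ∈ hypPlane
  weakGradient : IsWeakGradient u Du
  continuousL2Loc : ContinuousL2Loc u
  locInt : LocallyIntegrable u
  locInt_flux : ∀ k, LocallyIntegrable (fun z => crossProduct (u z) (Du k z))
  equation : ∀ φ : SpaceTime → ℝ, ContDiff ℝ ∞ φ → HasCompactSupport φ →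
    ∫ z, dt φ z • u z = ∫ z, ∑ k : Fin 2, dx k φ z • eta (crossProduct (u z) (Du k z))
  initial_energy : energy Du 0 < ⊤
  initial_mass : mass u 0 < ⊤

end HypSM

namespace HypSM

open MeasureTheory Filter Topology
open scoped ENNReal NNReal ContDiff

/-! ### Lorentz algebra -/

/-! The target is not compact. The energy controls `∂ₗ u` only in the Lorentz length, which falls
short of the ambient norm by a factor of order `u₀`, and nothing bounds `u₀` pointwise. The remedy
is a Moser–Trudinger argument for `log u₀`. A vector `w` tangent at `u` satisfies `w₀² ≤ u₀² ‖w‖²`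
(`sq_zero_le`), so the Dirichlet energy of `log u₀` is at most that of `u`, while the mass bounds
the measure of `{u₀ ≥ e}`. Hence every power of `u₀` is integrable on that set, with constants
depending only on `C` and the power (`exists_lintegral_exp_le`, `exists_lintegral_rpow_le`). So `u`
is bounded in `Lˢ_loc` for all `s < ∞`, `∂ₗ u` in `Lᵖ_loc` for all `p < 2`, and the flux `u × ∂ₗ u`
in `L¹_loc`, uniformly in time and along the sequence.

When the bounds are given at `t = 0` only, they propagate by the local conservation laws of energy
and mass, tested with cutoffs. The slab condition makes the fluxes integrable
(`energy_le_energy_zero`, `mass_le_mass_zero`).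

Compactness holds at every time. At a fixed scale the spatial mollifications are equi-Lipschitz on
space-time, because the equation has divergence form with flux bounded in `L¹_loc`. They approximate
the maps in `L¹_loc` uniformly in time, because the gradients are bounded in `L¹_loc`. One
subsequence therefore converges in `L¹_loc` at all times (`exists_subseq_tendsto`), and by
interpolation in every `Lˢ_loc`.

For the gradients, use the orthonormal tangent frame boosted to `u`: the squared `L²` norm of the
coefficients is the energy. The coefficients converge weakly in `L²`, and the frames converge
strongly because they depend on the base point in a Lipschitz way. So the gradients converge weakly
to tangent fields along the limit, and the Hilbert norm bound for the weak limit is the energy bound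
(`exists_fieldTendsto`). The nonlinear term is a product of a weakly and a strongly convergent
factor. Uniqueness of weak gradients removes any further extraction depending on time
(`exists_isWeakPartial`), and the statements on space-time follow by dominated convergence in `t`
(`tendsto_integral_of_slices`). -/

theorem lor_eq (v w : Amb) : lor v w = -(v 0 * w 0) + v 1 * w 1 + v 2 * w 2 := by
  simp [lor, eta, dotProduct, Fin.sum_univ_three]

theorem eta_apply_zero (v : Amb) : eta v 0 = -v 0 := rfl
theorem eta_apply_one (v : Amb) : eta v 1 = v 1 := rfl
theorem eta_apply_two (v : Amb) : eta v 2 = v 2 := rfl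

/-- The linear map underlying `eta`. -/
noncomputable def etaL : Amb →L[ℝ] Amb :=
  LinearMap.toContinuousLinearMap
    { toFun := eta
      map_add' := fun v w => by
        ext i; fin_cases i <;> simp [eta]
        ring
      map_smul' := fun c v => by
        ext i; fin_cases i <;> simp [eta] }

theorem etaL_apply (v : Amb) : etaL v = eta v := rfl

theorem lor_comm (v w : Amb) : lor v w = lor w v := by
  rw [lor_eq, lor_eq]; ring

theorem norm_eta (v : Amb) : ‖eta v‖ = ‖v‖ := by
  simp only [Pi.norm_def, Fin.univ_succ]
  simp [eta]

/-! ### Points of the hyperbolic plane. -/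

section HypPlane

variable {u : Amb}

theorem sq_of_mem (hu : u ∈ hypPlane) : u 0 ^ 2 = 1 + u 1 ^ 2 + u 2 ^ 2 := by
  have := hu.1
  rw [lor_eq] at this
  linarith

theorem one_le_of_mem (hu : u ∈ hypPlane) : 1 ≤ u 0 := by
  have h := sq_of_mem hu
  have h0 := hu.2
  nlinarith [sq_nonneg (u 1), sq_nonneg (u 2)]

theorem abs_apply_le (hu : u ∈ hypPlane) (i : Fin 3) : |u i| ≤ u 0 := by
  have h := sq_of_mem hu
  have h0 := hu.2
  apply abs_le_of_sq_le_sq _ h0.le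
  fin_cases i <;> simp <;> nlinarith [sq_nonneg (u 1), sq_nonneg (u 2)]

/-- The ambient norm is the sup norm, and the other coordinates are dominated by the height.
Integrability of a map is thus integrability of its component `0`. -/
theorem norm_eq_of_mem (hu : u ∈ hypPlane) : ‖u‖ = u 0 := by
  apply le_antisymm
  · exact (pi_norm_le_iff_of_nonneg hu.2.le).2 fun i => by simpa using abs_apply_le hu i
  · exact (le_abs_self _).trans (norm_le_pi_norm u 0)

theorem isClosed_hypPlane : IsClosed hypPlane := by
  -- The open condition `0 < v 0` can be replaced by the closed one `1 ≤ v 0`.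
  have : hypPlane = {v : Amb | lor v v = -1} ∩ {v | 1 ≤ v 0} := by
    ext v
    exact ⟨fun h => ⟨h.1, one_le_of_mem h⟩, fun h => ⟨h.1, lt_of_lt_of_le one_pos h.2⟩⟩
  rw [this]
  refine IsClosed.inter (isClosed_eq ?_ continuous_const) (isClosed_le continuous_const (by fun_prop))
  simp only [lor_eq]
  fun_prop

end HypPlane

/-- The coefficients of a tangent vector `w` at `u` in the orthonormal frame of the hyperbolic plane
obtained by boosting the standard frame at `(1, 0, 0)` to `u`. -/
noncomputable def frameCoeff (a : Fin 2) (u w : Amb) : ℝ :=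
  w a.succ - u a.succ * w 0 / (1 + u 0)

/-- The tangent vector at `u` with given coefficients in the boosted frame. -/
noncomputable def frameComb (u : Amb) (c : Fin 2 → ℝ) : Amb :=
  ![u 1 * c 0 + u 2 * c 1,
    c 0 + u 1 * (u 1 * c 0 + u 2 * c 1) / (1 + u 0),
    c 1 + u 2 * (u 1 * c 0 + u 2 * c 1) / (1 + u 0)]

section Frame

variable {u : Amb}

/-- Tangency and `u₁² + u₂² = (u₀ - 1)(u₀ + 1)` give `u₁ c₀ + u₂ c₁ = u₀ w₀ - (u₀ - 1) w₀ = w₀` for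
the coefficients `c` of `w`. This is `key`, and the other components follow from it. -/
theorem frameComb_frameCoeff (hu : u ∈ hypPlane) {w : Amb} (hw : lor u w = 0) :
    frameComb u (fun a => frameCoeff a u w) = w := by
  have h := sq_of_mem hu
  have h1 : 1 + u 0 ≠ 0 := by linarith [hu.2]
  rw [lor_eq] at hw
  have key : u 1 * (w 1 - u 1 * w 0 / (1 + u 0)) + u 2 * (w 2 - u 2 * w 0 / (1 + u 0)) = w 0 := by
    field_simp
    linear_combination (1 + u 0) * hw + w 0 * h
  ext i
  fin_cases i
  · simpa [frameComb, frameCoeff] using key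
  · simp [frameComb, frameCoeff, key]
  · simp [frameComb, frameCoeff, key]

theorem frameCoeff_frameComb (c : Fin 2 → ℝ) (a : Fin 2) :
    frameCoeff a u (frameComb u c) = c a := by
  fin_cases a <;> simp [frameComb, frameCoeff]

/-- The boost from `(1, 0, 0)` to `u` is a Lorentz isometry, so the boosted frame is orthonormal. In
particular tangent planes are spacelike. -/
theorem lor_frameComb (hu : u ∈ hypPlane) (c d : Fin 2 → ℝ) :
    lor (frameComb u c) (frameComb u d) = c 0 * d 0 + c 1 * d 1 := by
  have h := sq_of_mem hu
  have h1 : 1 + u 0 ≠ 0 := by linarith [hu.2]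
  rw [lor_eq]
  simp only [frameComb, Matrix.cons_val_zero, Matrix.cons_val_one, Matrix.cons_val]
  field_simp
  have h2 : u 2 ^ 2 = u 0 ^ 2 - 1 - u 1 ^ 2 := by linarith
  linear_combination (-(u 1 * c 0 + u 2 * c 1) * (u 1 * d 0 + u 2 * d 1)) * h

theorem lor_self_frameComb (hu : u ∈ hypPlane) (c : Fin 2 → ℝ) : lor u (frameComb u c) = 0 := by
  have h := sq_of_mem hu
  have h1 : 1 + u 0 ≠ 0 := by linarith [hu.2]
  rw [lor_eq]
  simp only [frameComb, Matrix.cons_val_zero, Matrix.cons_val_one, Matrix.cons_val]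
  field_simp
  linear_combination (-(u 1 * c 0 + u 2 * c 1)) * h

theorem lor_eq_frameCoeff (hu : u ∈ hypPlane) {v w : Amb} (hv : lor u v = 0) (hw : lor u w = 0) :
    lor v w = frameCoeff 0 u v * frameCoeff 0 u w + frameCoeff 1 u v * frameCoeff 1 u w := by
  conv_lhs => rw [← frameComb_frameCoeff hu hv, ← frameComb_frameCoeff hu hw]
  exact lor_frameComb hu _ _

theorem lor_nonneg (hu : u ∈ hypPlane) {w : Amb} (hw : lor u w = 0) : 0 ≤ lor w w := by
  rw [lor_eq_frameCoeff hu hw hw]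
  nlinarith [sq_nonneg (frameCoeff 0 u w), sq_nonneg (frameCoeff 1 u w)]

theorem lorNormSq_eq (hu : u ∈ hypPlane) {w : Amb} (hw : lor u w = 0) :
    lorNormSq w = lor w w := abs_of_nonneg (lor_nonneg hu hw)

theorem lorNormSq_eq_sum (hu : u ∈ hypPlane) {w : Amb} (hw : lor u w = 0) :
    lorNormSq w = ∑ a, frameCoeff a u w ^ 2 := by
  rw [lorNormSq_eq hu hw, lor_eq_frameCoeff hu hw hw, Fin.sum_univ_two]; ring

theorem lorNormSq_frameComb (hu : u ∈ hypPlane) (c : Fin 2 → ℝ) :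
    lorNormSq (frameComb u c) = ∑ a, c a ^ 2 := by
  rw [lorNormSq_eq_sum hu (lor_self_frameComb hu c)]
  simp [frameCoeff_frameComb]

/-- Cauchy–Schwarz in the spacelike tangent plane. It bounds the energy flux `2⟨∂ₜ u, η ∂ₖ u⟩` by
densities integrable over slabs. -/
theorem abs_lor_le (hu : u ∈ hypPlane) {v w : Amb} (hv : lor u v = 0) (hw : lor u w = 0) :
    |lor v w| ≤ lorNormSq v + lorNormSq w := by
  rw [lorNormSq_eq hu hv, lorNormSq_eq hu hw, lor_eq_frameCoeff hu hv hw,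
    lor_eq_frameCoeff hu hv hv, lor_eq_frameCoeff hu hw hw, abs_le]
  set a := frameCoeff 0 u v
  set b := frameCoeff 1 u v
  set c := frameCoeff 0 u w
  set d := frameCoeff 1 u w
  constructor <;> nlinarith [sq_nonneg (a + c), sq_nonneg (b + d), sq_nonneg (a - c),
    sq_nonneg (b - d), sq_nonneg a, sq_nonneg b, sq_nonneg c, sq_nonneg d]

theorem sq_zero_frameComb_le (hu : u ∈ hypPlane) (c : Fin 2 → ℝ) :
    frameComb u c 0 ^ 2 ≤ u 0 ^ 2 * ∑ a, c a ^ 2 := by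
  have h := sq_of_mem hu
  simp only [frameComb, Matrix.cons_val_zero, Fin.sum_univ_two]
  rw [h]
  nlinarith [sq_nonneg (u 1 * c 1 - u 2 * c 0), sq_nonneg (c 0), sq_nonneg (c 1)]

/-- Component `0` of a tangent vector is `u₁ c₀ + u₂ c₁`, and `u₁² + u₂² ≤ u₀²`. Divided by `u₀²`,
this says that `log u₀` is 1-Lipschitz on the hyperbolic plane. -/
theorem sq_zero_le (hu : u ∈ hypPlane) {w : Amb} (hw : lor u w = 0) :
    w 0 ^ 2 ≤ u 0 ^ 2 * lorNormSq w := by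
  have := sq_zero_frameComb_le hu (fun a => frameCoeff a u w)
  rwa [frameComb_frameCoeff hu hw, ← lorNormSq_eq_sum hu hw] at this

/-- The component is a linear form in the two coefficients, and the squares of its entries add up to
exactly `1 + u_a²`. It follows that `arsinh u_a` is 1-Lipschitz. -/
theorem sq_succ_frameComb_le (hu : u ∈ hypPlane) (e : Fin 2 → ℝ) (a : Fin 2) :
    frameComb u e a.succ ^ 2 ≤ (1 + u a.succ ^ 2) * ∑ b, e b ^ 2 := by
  have h := sq_of_mem hu
  have h1 : 1 + u 0 ≠ 0 := by linarith [hu.2]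
  simp only [Fin.sum_univ_two]
  set c := e 0
  set d := e 1
  have cs : ∀ A B : ℝ, (A * c + B * d) ^ 2 ≤ (A ^ 2 + B ^ 2) * (c ^ 2 + d ^ 2) := fun A B => by
    nlinarith [sq_nonneg (A * d - B * c)]
  fin_cases a
  · have h2 := cs (1 + u 1 * u 1 / (1 + u 0)) (u 1 * u 2 / (1 + u 0))
    have h3 : (1 + u 1 * u 1 / (1 + u 0)) ^ 2 + (u 1 * u 2 / (1 + u 0)) ^ 2 = 1 + u 1 ^ 2 := by
      field_simp
      linear_combination (-u 1 ^ 2) * h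
    rw [h3] at h2
    refine le_of_eq_of_le ?_ h2
    simp only [frameComb, Fin.zero_eta, Fin.mk_one, Fin.succ_zero_eq_one, Fin.succ_one_eq_two, Matrix.cons_val_one, Matrix.cons_val_zero, Matrix.cons_val]
    ring
  · have h2 := cs (u 2 * u 1 / (1 + u 0)) (1 + u 2 * u 2 / (1 + u 0))
    have h3 : (u 2 * u 1 / (1 + u 0)) ^ 2 + (1 + u 2 * u 2 / (1 + u 0)) ^ 2 = 1 + u 2 ^ 2 := by
      field_simp
      linear_combination (-u 2 ^ 2) * h
    rw [h3] at h2
    refine le_of_eq_of_le ?_ h2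
    simp only [frameComb, Fin.zero_eta, Fin.mk_one, Fin.succ_zero_eq_one, Fin.succ_one_eq_two, Matrix.cons_val_one, Matrix.cons_val_zero, Matrix.cons_val]
    ring

theorem sq_succ_le (hu : u ∈ hypPlane) {w : Amb} (hw : lor u w = 0) (a : Fin 2) :
    w a.succ ^ 2 ≤ (1 + u a.succ ^ 2) * lorNormSq w := by
  have := sq_succ_frameComb_le hu (fun a => frameCoeff a u w) a
  rwa [frameComb_frameCoeff hu hw, ← lorNormSq_eq_sum hu hw] at this

/-- In terms of frame coefficients the component is `u₁ c₁ - u₂ c₀`, with no factor `u₀`. The mass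
flux is therefore integrable as soon as `‖∇u‖`, `u₁` and `u₂` are square integrable. -/
theorem abs_cross_zero_le (hu : u ∈ hypPlane) {w : Amb} (hw : lor u w = 0) :
    |crossProduct u w 0| ≤ lorNormSq w + (u 1 ^ 2 + u 2 ^ 2) := by
  have h := lorNormSq_eq_sum hu hw
  have h1 : crossProduct u w 0 = u 1 * frameCoeff 1 u w - u 2 * frameCoeff 0 u w := by
    simp [crossProduct, frameCoeff]
    ring
  rw [h, h1, Fin.sum_univ_two, abs_le]
  set c := frameCoeff 0 u w
  set d := frameCoeff 1 u w
  constructor <;> nlinarith [sq_nonneg (u 1 + d), sq_nonneg (u 1 - d), sq_nonneg (u 2 + c),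
    sq_nonneg (u 2 - c), sq_nonneg c, sq_nonneg d, sq_nonneg (u 1), sq_nonneg (u 2)]

theorem abs_div_le_one (hu : u ∈ hypPlane) (i : Fin 3) : |u i / (1 + u 0)| ≤ 1 := by
  rw [abs_div, abs_of_pos (by linarith [hu.2] : 0 < 1 + u 0), div_le_one (by linarith [hu.2])]
  linarith [abs_apply_le hu i, hu.2]

/-- Passing from the Lorentz length to the ambient norm costs one factor `‖u‖`, which is absorbed
later by Hölder's inequality. -/
theorem norm_frameComb_le (hu : u ∈ hypPlane) (c : Fin 2 → ℝ) :
    ‖frameComb u c‖ ≤ 2 * ‖u‖ * √(∑ a, c a ^ 2) := by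
  rw [norm_eq_of_mem hu]
  have h0 := one_le_of_mem hu
  set s := √(∑ a, c a ^ 2) with hs
  have hsq : s ^ 2 = ∑ a, c a ^ 2 := Real.sq_sqrt (by positivity)
  have hs0 : 0 ≤ s := Real.sqrt_nonneg _
  have h1 : |frameComb u c 0| ≤ u 0 * s := by
    apply abs_le_of_sq_le_sq _ (by positivity)
    rw [mul_pow, hsq]
    exact sq_zero_frameComb_le hu c
  have hc : ∀ a, |c a| ≤ s := fun a => by
    apply abs_le_of_sq_le_sq _ hs0
    rw [hsq]
    exact Finset.single_le_sum (f := fun a => c a ^ 2) (fun i _ => sq_nonneg _) (Finset.mem_univ a)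
  have h2 : ∀ a : Fin 2, |frameComb u c a.succ| ≤ s + u 0 * s := fun a => by
    have : frameComb u c a.succ = c a + u a.succ / (1 + u 0) * frameComb u c 0 := by
      fin_cases a <;> simp [frameComb] <;> ring
    rw [this]
    refine (abs_add_le _ _).trans (add_le_add (hc a) ?_)
    rw [abs_mul]
    calc _ ≤ 1 * (u 0 * s) := mul_le_mul (abs_div_le_one hu _) h1 (abs_nonneg _) zero_le_one
      _ = _ := one_mul _
  refine (pi_norm_le_iff_of_nonneg (by positivity)).2 fun i => ?_
  rw [Real.norm_eq_abs]
  refine Fin.cases ?_ (fun a => ?_) i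
  · nlinarith
  · have := h2 a
    nlinarith

/-- The entries `uᵢ uⱼ / (1 + u₀)` of the frame are unbounded, but they are Lipschitz in `u` because
each quotient `uᵢ / (1 + u₀)` is at most `1` in absolute value. Strong convergence of maps thus
becomes strong convergence of frames. -/
theorem norm_frameComb_sub_le {v : Amb} (hu : u ∈ hypPlane) (hv : v ∈ hypPlane) (c : Fin 2 → ℝ) :
    ‖frameComb u c - frameComb v c‖ ≤ 6 * ‖c‖ * ‖u - v‖ := by
  have hu0 : 0 < 1 + u 0 := by linarith [hu.2]
  have hv0 : 0 < 1 + v 0 := by linarith [hv.2]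
  set δ := ‖u - v‖
  have hδ : ∀ i, |u i - v i| ≤ δ := fun i => norm_le_pi_norm (u - v) i
  have hδ0 : 0 ≤ δ := norm_nonneg _
  have key : ∀ i j : Fin 3, |u i * u j / (1 + u 0) - v i * v j / (1 + v 0)| ≤ 3 * δ := by
    intro i j
    have e : u i * u j / (1 + u 0) - v i * v j / (1 + v 0) =
        u i / (1 + u 0) * (u j - v j) + v j / (1 + v 0) * (u i - v i)
        + (u i / (1 + u 0)) * (v j / (1 + v 0)) * (v 0 - u 0) := by
      field_simp
      ring
    rw [e]
    have b1 : |u i / (1 + u 0) * (u j - v j)| ≤ 1 * δ := by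
      rw [abs_mul]
      exact mul_le_mul (abs_div_le_one hu i) (hδ j) (abs_nonneg _) zero_le_one
    have b2 : |v j / (1 + v 0) * (u i - v i)| ≤ 1 * δ := by
      rw [abs_mul]
      exact mul_le_mul (abs_div_le_one hv j) (hδ i) (abs_nonneg _) zero_le_one
    have b3 : |(u i / (1 + u 0)) * (v j / (1 + v 0)) * (v 0 - u 0)| ≤ 1 * 1 * δ := by
      rw [abs_mul, abs_mul, abs_sub_comm (v 0)]
      exact mul_le_mul (mul_le_mul (abs_div_le_one hu i) (abs_div_le_one hv j) (abs_nonneg _)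
        zero_le_one) (hδ 0) (abs_nonneg _) (by norm_num)
    calc _ ≤ _ := abs_add_three _ _ _
      _ ≤ 3 * δ := by linarith
  have hc : ∀ a, |c a| ≤ ‖c‖ := fun a => norm_le_pi_norm c a
  have comb : ∀ A B M : ℝ, |A| ≤ M → |B| ≤ M → |A * c 0 + B * c 1| ≤ 2 * M * ‖c‖ := by
    intro A B M hA hB
    have hM : 0 ≤ M := (abs_nonneg _).trans hA
    calc _ ≤ |A * c 0| + |B * c 1| := abs_add_le _ _
      _ = |A| * |c 0| + |B| * |c 1| := by rw [abs_mul, abs_mul]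
      _ ≤ M * ‖c‖ + M * ‖c‖ := add_le_add (mul_le_mul hA (hc 0) (abs_nonneg _) hM)
          (mul_le_mul hB (hc 1) (abs_nonneg _) hM)
      _ = _ := by ring
  refine (pi_norm_le_iff_of_nonneg (by positivity)).2 fun i => ?_
  rw [Real.norm_eq_abs]
  fin_cases i
  · have := comb (u 1 - v 1) (u 2 - v 2) δ (hδ 1) (hδ 2)
    have e : (frameComb u c - frameComb v c) 0 = (u 1 - v 1) * c 0 + (u 2 - v 2) * c 1 := by
      simp [frameComb]; ring
    simp only [Fin.zero_eta, e]
    nlinarith [norm_nonneg c, mul_nonneg (norm_nonneg c) hδ0]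
  · have := comb _ _ _ (key 1 1) (key 1 2)
    have e : (frameComb u c - frameComb v c) 1 = (u 1 * u 1 / (1 + u 0) - v 1 * v 1 / (1 + v 0)) * c 0
      + (u 1 * u 2 / (1 + u 0) - v 1 * v 2 / (1 + v 0)) * c 1 := by
      simp [frameComb]; ring
    simp only [Fin.mk_one, e]
    linarith
  · have := comb _ _ _ (key 2 1) (key 2 2)
    have e : (frameComb u c - frameComb v c) 2 = (u 2 * u 1 / (1 + u 0) - v 2 * v 1 / (1 + v 0)) * c 0
      + (u 2 * u 2 / (1 + u 0) - v 2 * v 2 / (1 + v 0)) * c 1 := by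
      simp [frameComb]; ring
    simp only [Fin.reduceFinMk, e]
    linarith

end Frame

theorem norm_crossProduct_le (v w : Amb) : ‖crossProduct v w‖ ≤ 2 * ‖v‖ * ‖w‖ := by
  have hv : ∀ i, |v i| ≤ ‖v‖ := fun i => norm_le_pi_norm v i
  have hw : ∀ i, |w i| ≤ ‖w‖ := fun i => norm_le_pi_norm w i
  have key : ∀ i j k l : Fin 3, |v i * w j - v k * w l| ≤ 2 * ‖v‖ * ‖w‖ := by
    intro i j k l
    calc _ ≤ |v i * w j| + |v k * w l| := abs_sub _ _
      _ = |v i| * |w j| + |v k| * |w l| := by rw [abs_mul, abs_mul]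
      _ ≤ ‖v‖ * ‖w‖ + ‖v‖ * ‖w‖ := by gcongr <;> first | exact hv _ | exact hw _
      _ = _ := by ring
  refine (pi_norm_le_iff_of_nonneg (by positivity)).2 fun i => ?_
  rw [Real.norm_eq_abs]
  fin_cases i <;> simpa [crossProduct] using key _ _ _ _

/-- Since `η² = 1`, this is the triple product `(v × w) · w`. It is the cancellation behind
conservation of energy. -/
theorem lor_eta_cross_self (v w : Amb) : lor (eta (crossProduct v w)) w = 0 := by
  rw [lor_eq, eta_apply_zero, eta_apply_one, eta_apply_two]
  simp [crossProduct]
  ring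

/-! ### Cutoff functions -/

/-- A smooth bump equal to `1` on the unit disc of the plane and supported in the disc of radius `2`. -/
noncomputable def planeBump : ContDiffBump (0 : Plane) := ⟨1, 2, one_pos, one_lt_two⟩

/-- Smooth cutoffs, equal to `1` on the ball of radius `n + 1`. -/
noncomputable def cutoff (n : ℕ) (x : Plane) : ℝ := planeBump ((n + 1 : ℝ)⁻¹ • x)

theorem contDiff_cutoff (n : ℕ) : ContDiff ℝ ∞ (cutoff n) :=
  planeBump.contDiff.comp (contDiff_const_smul _)

theorem cutoff_nonneg (n : ℕ) (x : Plane) : 0 ≤ cutoff n x := planeBump.nonneg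

theorem cutoff_le_one (n : ℕ) (x : Plane) : cutoff n x ≤ 1 := planeBump.le_one

theorem cutoff_eq_one {n : ℕ} {x : Plane} (hx : x ∈ Metric.ball (0 : Plane) (n + 1)) :
    cutoff n x = 1 := by
  apply planeBump.one_of_mem_closedBall
  have hn : (0 : ℝ) < n + 1 := by positivity
  rw [mem_ball_zero_iff] at hx
  rw [mem_closedBall_zero_iff, norm_smul, norm_inv, Real.norm_of_nonneg hn.le]
  change _ ≤ (1 : ℝ)
  rw [inv_mul_le_iff₀ hn]
  linarith

theorem hasCompactSupport_cutoff (n : ℕ) : HasCompactSupport (cutoff n) :=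
  planeBump.hasCompactSupport.comp_smul (by positivity)

theorem exists_norm_fderiv_cutoff_le :
    ∃ c : ℝ≥0, ∀ n x, ‖fderiv ℝ (cutoff n) x‖ ≤ c / (n + 1) := by
  obtain ⟨c, hc⟩ := (planeBump.contDiff (n := 1)).continuous_fderiv (one_ne_zero) |>.bounded_above_of_compact_support
    (planeBump.hasCompactSupport.fderiv ℝ)
  refine ⟨c.toNNReal, fun n x => ?_⟩
  have hn : (0 : ℝ) < n + 1 := by positivity
  have h : fderiv ℝ (cutoff n) x = (n + 1 : ℝ)⁻¹ • fderiv ℝ planeBump ((n + 1 : ℝ)⁻¹ • x) :=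
    fderiv_comp_smul _
  rw [h, norm_smul, norm_inv, Real.norm_of_nonneg hn.le, inv_mul_eq_div]
  gcongr
  exact (hc _).trans (Real.le_coe_toNNReal c)

theorem cutoff_eventually_eq_one (x : Plane) : ∀ᶠ n in atTop, cutoff n x = 1 := by
  obtain ⟨N, hN⟩ := exists_nat_gt ‖x‖
  filter_upwards [eventually_ge_atTop N] with n hn
  apply cutoff_eq_one
  rw [mem_ball_zero_iff]
  have : (N : ℝ) ≤ n := by exact_mod_cast hn
  linarith

/-! ### A Moser–Trudinger inequality -/

theorem sq_lintegral_mul_le {α : Type*} [MeasurableSpace α] {μ : Measure α} {f g : α → ℝ≥0∞}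
    (hf : AEMeasurable f μ) (hg : AEMeasurable g μ) :
    (∫⁻ a, f a * g a ∂μ) ^ 2 ≤ (∫⁻ a, f a ^ 2 ∂μ) * ∫⁻ a, g a ^ 2 ∂μ := by
  have h := ENNReal.lintegral_mul_le_Lp_mul_Lq μ Real.HolderConjugate.two_two hf hg
  simp only [ENNReal.rpow_two] at h
  calc _ ≤ ((∫⁻ a, f a ^ 2 ∂μ) ^ (1 / 2 : ℝ) * (∫⁻ a, g a ^ 2 ∂μ) ^ (1 / 2 : ℝ)) ^ 2 := by
        gcongr; exact h
    _ = _ := by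
        rw [mul_pow]
        simp only [← ENNReal.rpow_two, ← ENNReal.rpow_mul]
        norm_num

/-- Gagliardo–Nirenberg–Sobolev in dimension two, from `W^{1,1}` to `L²`. It passes from compactly
supported to integrable functions by cutoffs, whose gradients contribute `c / (n + 1)` times the
`L¹` norm of `f`. -/
theorem exists_sq_lintegral_le_sq_lintegral_fderiv :
    ∃ K : ℝ≥0, ∀ f : Plane → ℝ, ContDiff ℝ 1 f → ∫⁻ x, ‖f x‖ₑ ≠ ⊤ →
      ∫⁻ x, ‖f x‖ₑ ^ 2 ≤ K * (∫⁻ x, ‖fderiv ℝ f x‖ₑ) ^ 2 := by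
  obtain ⟨c, hc⟩ := exists_norm_fderiv_cutoff_le
  have h2 : (Module.finrank ℝ Plane : ℝ).HolderConjugate 2 := by
    simpa using Real.HolderConjugate.two_two
  refine ⟨lintegralPowLePowLIntegralFDerivConst (volume : Measure Plane) 2, fun f hf hint => ?_⟩
  set K := lintegralPowLePowLIntegralFDerivConst (volume : Measure Plane) 2
  have hfm : Measurable f := hf.continuous.measurable
  have hDm : Measurable (fderiv ℝ f) := (hf.continuous_fderiv one_ne_zero).measurable
  have hstep : ∀ n : ℕ, ∫⁻ x in Metric.ball 0 (n + 1 : ℝ), ‖f x‖ₑ ^ 2 ≤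
      K * ((∫⁻ x, ‖fderiv ℝ f x‖ₑ) + ENNReal.ofReal (c / (n + 1)) * ∫⁻ x, ‖f x‖ₑ) ^ 2 := by
    intro n
    have hχ : ContDiff ℝ 1 (cutoff n) := (contDiff_cutoff n).of_le (by norm_cast)
    have h := lintegral_pow_le_pow_lintegral_fderiv (volume : Measure Plane)
      (u := cutoff n • f) (hχ.smul hf) ((hasCompactSupport_cutoff n).smul_right) h2
    simp only [ENNReal.rpow_two] at h
    calc ∫⁻ x in Metric.ball 0 (n + 1 : ℝ), ‖f x‖ₑ ^ 2
        = ∫⁻ x in Metric.ball 0 (n + 1 : ℝ), ‖(cutoff n • f) x‖ₑ ^ 2 := by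
          refine setLIntegral_congr_fun Metric.isOpen_ball.measurableSet fun x hx => ?_
          simp [cutoff_eq_one hx]
      _ ≤ ∫⁻ x, ‖(cutoff n • f) x‖ₑ ^ 2 := setLIntegral_le_lintegral _ _
      _ ≤ _ := h
      _ ≤ _ := by
        gcongr
        rw [← lintegral_const_mul _ (by fun_prop), ← lintegral_add_left (by fun_prop)]
        refine lintegral_mono fun x => ?_
        rw [fderiv_smul (hχ.differentiable one_ne_zero x) (hf.differentiable one_ne_zero x)]
        refine (enorm_add_le (E := Plane →L[ℝ] ℝ) _ _).trans (add_le_add ?_ ?_)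
        · rw [enorm_smul]
          calc _ ≤ 1 * ‖fderiv ℝ f x‖ₑ := by
                gcongr
                rw [Real.enorm_of_nonneg (cutoff_nonneg n x)]
                exact ENNReal.ofReal_le_one.2 (cutoff_le_one n x)
            _ = _ := one_mul _
        · rw [← ofReal_norm, ← ofReal_norm, ← ENNReal.ofReal_mul (by positivity),
            ContinuousLinearMap.norm_smulRight_apply]
          exact ENNReal.ofReal_le_ofReal (by gcongr; exact hc n x)
  have hl : Tendsto (fun n : ℕ => ∫⁻ x in Metric.ball 0 (n + 1 : ℝ), ‖f x‖ₑ ^ 2) atTop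
      (𝓝 (∫⁻ x, ‖f x‖ₑ ^ 2)) :=
    AECover.lintegral_tendsto_of_nat
      (aecover_ball (tendsto_natCast_atTop_atTop.atTop_add tendsto_const_nhds))
      (by fun_prop)
  have hr : Tendsto (fun n : ℕ => K * ((∫⁻ x, ‖fderiv ℝ f x‖ₑ)
      + ENNReal.ofReal (c / (n + 1)) * ∫⁻ x, ‖f x‖ₑ) ^ 2) atTop
      (𝓝 (K * ((∫⁻ x, ‖fderiv ℝ f x‖ₑ) + 0 * ∫⁻ x, ‖f x‖ₑ) ^ 2)) := by
    refine ENNReal.Tendsto.const_mul (ENNReal.Tendsto.pow (tendsto_const_nhds.add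
      (ENNReal.Tendsto.mul_const ?_ (Or.inr hint)))) (Or.inr ENNReal.coe_ne_top)
    rw [← ENNReal.ofReal_zero]
    refine ENNReal.tendsto_ofReal ?_
    exact tendsto_const_nhds.div_atTop (tendsto_natCast_atTop_atTop.atTop_add tendsto_const_nhds)
  have := le_of_tendsto_of_tendsto' hl hr hstep
  simpa using this

theorem exists_norm_deriv_smoothTransition_le :
    ∃ L : ℝ≥0, ∀ s, ‖deriv Real.smoothTransition s‖ ≤ L := by
  have hc : Continuous (deriv Real.smoothTransition) :=
    (Real.smoothTransition.contDiff (n := 1)).continuous_deriv le_rfl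
  have hs : HasCompactSupport (deriv Real.smoothTransition) := by
    refine HasCompactSupport.intro (isCompact_Icc (a := (0 : ℝ)) (b := 1)) fun x hx => ?_
    rw [Set.mem_Icc, not_and_or, not_le, not_le] at hx
    rcases hx with hx | hx
    · have : Real.smoothTransition =ᶠ[𝓝 x] fun _ => 0 := by
        filter_upwards [gt_mem_nhds hx] with y hy using Real.smoothTransition.zero_of_nonpos hy.le
      rw [this.deriv_eq, deriv_const]
    · have : Real.smoothTransition =ᶠ[𝓝 x] fun _ => 1 := by
        filter_upwards [lt_mem_nhds hx] with y hy using Real.smoothTransition.one_of_one_le hy.le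
      rw [this.deriv_eq, deriv_const]
  obtain ⟨c, h⟩ := hc.bounded_above_of_compact_support hs
  exact ⟨c.toNNReal, fun s => (h s).trans (Real.le_coe_toNNReal c)⟩

/-- The measure of successive superlevel sets decreases by a factor controlled by the Dirichlet
energy between the two levels. -/
theorem exists_volume_superlevel_le :
    ∃ K : ℝ≥0, ∀ (g : Plane → ℝ) (s : ℝ), ContDiff ℝ ∞ g → volume {x | s ≤ g x} ≠ ⊤ →
      volume {x | s + 1 ≤ g x} ≤
        K * (∫⁻ x in {x | s ≤ g x ∧ g x < s + 1}, ‖fderiv ℝ g x‖ₑ ^ 2) * volume {x | s ≤ g x} := by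
  obtain ⟨K, hK⟩ := exists_sq_lintegral_le_sq_lintegral_fderiv
  obtain ⟨L, hL⟩ := exists_norm_deriv_smoothTransition_le
  refine ⟨K * L ^ 2, fun g s hg hfin => ?_⟩
  have hgm : Measurable g := hg.continuous.measurable
  have hg1 : ContDiff ℝ 1 g := hg.of_le (by norm_cast)
  have hDm : Measurable (fderiv ℝ g) := (hg1.continuous_fderiv one_ne_zero).measurable
  -- A truncation of `g` equal to `0` below the level `s` and to `1` above `s + 1`, with gradient
  -- supported in the strip between. Sobolev and Cauchy–Schwarz on the strip then give the claim.
  set f : Plane → ℝ := fun x => Real.smoothTransition (g x - s) with hf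
  have hfc : ContDiff ℝ 1 f := (Real.smoothTransition.contDiff (n := 1)).comp (hg1.sub contDiff_const)
  have hS : MeasurableSet {x | s ≤ g x} := measurableSet_le measurable_const hgm
  have hT : MeasurableSet {x | s ≤ g x ∧ g x < s + 1} :=
    hS.inter (measurableSet_lt hgm measurable_const)
  have hfS : ∀ x, ‖f x‖ₑ ≤ Set.indicator {x | s ≤ g x} 1 x := by
    intro x
    by_cases hx : s ≤ g x
    · rw [Set.indicator_of_mem (by exact hx), Real.enorm_of_nonneg (Real.smoothTransition.nonneg _)]
      exact ENNReal.ofReal_le_one.2 (Real.smoothTransition.le_one _)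
    · have : f x = 0 := Real.smoothTransition.zero_of_nonpos (by linarith)
      simp [this]
  have hint : ∫⁻ x, ‖f x‖ₑ ≠ ⊤ := by
    refine ne_top_of_le_ne_top hfin ?_
    calc _ ≤ ∫⁻ x, Set.indicator {x | s ≤ g x} 1 x := lintegral_mono hfS
      _ = _ := by rw [lintegral_indicator_one hS]
  have hD : ∀ x, ‖fderiv ℝ f x‖ₑ ≤
      Set.indicator {x | s ≤ g x ∧ g x < s + 1} (fun x => L * ‖fderiv ℝ g x‖ₑ) x := by
    intro x
    by_cases hx : s ≤ g x ∧ g x < s + 1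
    · rw [Set.indicator_of_mem (by exact hx)]
      have hd : HasFDerivAt f (deriv Real.smoothTransition (g x - s) • fderiv ℝ g x) x :=
        HasDerivAt.comp_hasFDerivAt x
          ((Real.smoothTransition.contDiff (n := 1)).differentiable one_ne_zero _).hasDerivAt
          ((hg1.differentiable one_ne_zero x).hasFDerivAt.sub_const s)
      rw [hd.fderiv, enorm_smul]
      gcongr
      rw [← ofReal_norm, ENNReal.ofReal_le_iff_le_toReal ENNReal.coe_ne_top]
      exact hL _
    · rw [Set.indicator_of_notMem (by exact hx)]
      rw [not_and_or, not_le, not_lt] at hx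
      have : fderiv ℝ f x = 0 := by
        rcases hx with hx | hx
        · have : f =ᶠ[𝓝 x] fun _ => 0 := by
            filter_upwards [hg.continuous.continuousAt.eventually (gt_mem_nhds hx)] with y hy
            exact Real.smoothTransition.zero_of_nonpos (by linarith)
          rw [this.fderiv_eq, fderiv_const_apply]
        -- At `g x = s + 1` the function `f` need not be constant nearby, but it attains its maximum
        -- value `1`, so its derivative vanishes.
        · have : IsLocalMax f x := Eventually.of_forall fun y => by
            have : f x = 1 := Real.smoothTransition.one_of_one_le (by linarith)
            rw [this]
            exact Real.smoothTransition.le_one _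
          exact this.fderiv_eq_zero
      rw [this]
      exact (enorm_zero (E := Plane →L[ℝ] ℝ)).le
  calc volume {x | s + 1 ≤ g x}
      = ∫⁻ x in {x | s + 1 ≤ g x}, ‖f x‖ₑ ^ 2 := by
        rw [← setLIntegral_one]
        refine setLIntegral_congr_fun (measurableSet_le measurable_const hgm) fun x hx => ?_
        have : f x = 1 := Real.smoothTransition.one_of_one_le (by
          have : s + 1 ≤ g x := hx
          linarith)
        simp [this]
    _ ≤ ∫⁻ x, ‖f x‖ₑ ^ 2 := setLIntegral_le_lintegral _ _
    _ ≤ K * (∫⁻ x, ‖fderiv ℝ f x‖ₑ) ^ 2 := hK f hfc hint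
    _ ≤ K * (∫⁻ x in {x | s ≤ g x ∧ g x < s + 1}, L * ‖fderiv ℝ g x‖ₑ) ^ 2 := by
        exact mul_le_mul' le_rfl (pow_le_pow_left'
          ((lintegral_mono hD).trans_eq (lintegral_indicator hT _)) 2)
    _ = K * L ^ 2 * (∫⁻ x in {x | s ≤ g x ∧ g x < s + 1}, ‖fderiv ℝ g x‖ₑ * 1) ^ 2 := by
        rw [lintegral_const_mul _ (by fun_prop)]
        simp only [mul_one]
        ring
    _ ≤ K * L ^ 2 * ((∫⁻ x in {x | s ≤ g x ∧ g x < s + 1}, ‖fderiv ℝ g x‖ₑ ^ 2)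
          * volume {x | s ≤ g x}) := by
        gcongr
        refine (sq_lintegral_mul_le (by fun_prop) (by fun_prop)).trans ?_
        gcongr
        simp only [one_pow, lintegral_const, Measure.restrict_apply_univ, one_mul]
        exact measure_mono fun x hx => hx.1
    _ = _ := by push_cast; ring

/-- **Moser–Trudinger inequality**: exponential integrability, with every exponent, of a function
with finite Dirichlet energy on its superlevel sets. -/
theorem exists_lintegral_exp_le (q : ℝ) (A C : ℝ≥0) :
    ∃ M : ℝ≥0, ∀ g : Plane → ℝ, ContDiff ℝ ∞ g → volume {x | 1 ≤ g x} ≤ A →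
      ∫⁻ x, ‖fderiv ℝ g x‖ₑ ^ 2 ≤ C →
      ∫⁻ x in {x | 1 ≤ g x}, ENNReal.ofReal (Real.exp (q * g x)) ≤ M := by
  wlog hq : 0 ≤ q generalizing q
  · obtain ⟨M, hM⟩ := this 0 le_rfl
    refine ⟨M, fun g hg hA hC => le_trans ?_ (hM g hg hA hC)⟩
    refine setLIntegral_mono' (measurableSet_le measurable_const hg.continuous.measurable)
      fun x hx => ENNReal.ofReal_le_ofReal (Real.exp_le_exp.2 ?_)
    have : 1 ≤ g x := hx
    nlinarith
  obtain ⟨K, hK⟩ := exists_volume_superlevel_le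
  -- The superlevel sets will decay like `εⁿ`. This beats the growth `e^{qn}` of the integrand and
  -- leaves the geometric ratio `1/2`.
  set ε : ℝ := Real.exp (-q) / 2 with hε
  have hε0 : 0 < ε := by positivity
  refine ⟨(Real.exp (2 * q)).toNNReal * (Real.exp (K * C / ε)).toNNReal * A * 2,
    fun g hg hA hC => ?_⟩
  have hgm : Measurable g := hg.continuous.measurable
  have hg1 : ContDiff ℝ 1 g := hg.of_le (by norm_cast)
  have hDm : Measurable (fderiv ℝ g) := (hg1.continuous_fderiv one_ne_zero).measurable
  set T : ℕ → Set Plane := fun n => {x | (n + 1 : ℝ) ≤ g x ∧ g x < n + 1 + 1} with hT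
  have hTm : ∀ n, MeasurableSet (T n) := fun n =>
    (measurableSet_le measurable_const hgm).inter (measurableSet_lt hgm measurable_const)
  set E : ℕ → ℝ≥0∞ := fun n => ∫⁻ x in T n, ‖fderiv ℝ g x‖ₑ ^ 2 with hE
  set a : ℕ → ℝ≥0∞ := fun n => volume {x | (n + 1 : ℝ) ≤ g x} with ha
  have hdisj : Pairwise (Function.onFun Disjoint T) := by
    have key : ∀ m n x, x ∈ T m → x ∈ T n → m ≤ n := by
      rintro m n x ⟨h1, -⟩ ⟨-, h2⟩
      have : (m : ℝ) < n + 1 := by linarith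
      exact Nat.lt_succ_iff.1 (by exact_mod_cast this)
    intro m n hmn
    exact Set.disjoint_left.2 fun x hx hx' =>
      hmn (le_antisymm (key m n x hx hx') (key n m x hx' hx))
  have hEsum : ∑' n, E n ≤ C := by
    rw [hE, ← lintegral_iUnion hTm hdisj]
    exact (setLIntegral_le_lintegral _ _).trans hC
  have hEfin : ∀ n, E n ≠ ⊤ := fun n =>
    ne_top_of_le_ne_top ENNReal.coe_ne_top ((ENNReal.le_tsum n).trans hEsum)
  have ha0 : a 0 ≤ A := by simpa [ha] using hA
  have hafin : ∀ n, a n ≠ ⊤ := fun n => by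
    refine ne_top_of_le_ne_top ENNReal.coe_ne_top (le_trans (measure_mono fun x hx => ?_) ha0)
    have hx' : (n + 1 : ℝ) ≤ g x := hx
    have : (0 : ℝ) ≤ n := Nat.cast_nonneg n
    simp only [Set.mem_ofPred_eq, CharP.cast_eq_zero]
    linarith
  have hrec : ∀ n, a (n + 1) ≤ K * E n * a n := fun n => by
    have := hK g (n + 1) hg (hafin n)
    simpa [ha, hE, hT] using this
  set κ : ℕ → ℝ := fun n => (K * E n).toReal with hκ
  have hκE : ∀ n, K * E n = ENNReal.ofReal (κ n) := fun n =>
    (ENNReal.ofReal_toReal (ENNReal.mul_ne_top ENNReal.coe_ne_top (hEfin n))).symm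
  -- The recursion gives the product of the `κᵢ`, and `κ ≤ ε e^{κ/ε}` turns it into `εⁿ` times an
  -- exponential of their sum. That sum is at most `K C` because the strips are disjoint.
  have hbound : ∀ n, a n ≤
      ENNReal.ofReal (ε ^ n * Real.exp ((∑ i ∈ Finset.range n, κ i) / ε)) * A := by
    intro n
    induction n with
    | zero => simpa using ha0
    | succ n ih =>
      calc a (n + 1) ≤ ENNReal.ofReal (κ n) * a n := by rw [← hκE]; exact hrec n
        _ ≤ ENNReal.ofReal (ε * Real.exp (κ n / ε)) *
            (ENNReal.ofReal (ε ^ n * Real.exp ((∑ i ∈ Finset.range n, κ i) / ε)) * A) := by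
          gcongr
          have : κ n / ε ≤ Real.exp (κ n / ε) := by linarith [Real.add_one_le_exp (κ n / ε)]
          rwa [div_le_iff₀' hε0] at this
        _ = _ := by
          rw [← mul_assoc, ← ENNReal.ofReal_mul (by positivity), Finset.sum_range_succ, add_div,
            Real.exp_add]
          congr 2
          ring
  have hκsum : ∀ n, ∑ i ∈ Finset.range n, κ i ≤ K * C := by
    intro n
    have h1 : ENNReal.ofReal (∑ i ∈ Finset.range n, κ i) ≤ ENNReal.ofReal (K * C) := by
      rw [ENNReal.ofReal_sum_of_nonneg fun i _ => ENNReal.toReal_nonneg,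
        Finset.sum_congr rfl fun i _ => (hκE i).symm]
      rw [← Finset.mul_sum, ENNReal.ofReal_mul (by positivity), ENNReal.ofReal_coe_nnreal,
        ENNReal.ofReal_coe_nnreal]
      gcongr
      exact (ENNReal.sum_le_tsum _).trans hEsum
    exact (ENNReal.ofReal_le_ofReal_iff (by positivity)).1 h1
  have hterm : ∀ n, ∫⁻ x in T n, ENNReal.ofReal (Real.exp (q * g x)) ≤
      ENNReal.ofReal (Real.exp (2 * q)) * ENNReal.ofReal (Real.exp (K * C / ε)) * A
        * (2⁻¹ : ℝ≥0∞) ^ n := by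
    intro n
    calc _ ≤ ∫⁻ x in T n, ENNReal.ofReal (Real.exp (q * (n + 2))) := by
          refine setLIntegral_mono' (hTm n) fun x hx => ?_
          have : g x ≤ n + 2 := by linarith [hx.2]
          exact ENNReal.ofReal_le_ofReal (Real.exp_le_exp.2 (by gcongr))
      _ = ENNReal.ofReal (Real.exp (q * (n + 2))) * volume (T n) := by simp
      _ ≤ ENNReal.ofReal (Real.exp (q * (n + 2))) *
          (ENNReal.ofReal (ε ^ n * Real.exp (K * C / ε)) * A) := by
        gcongr
        refine (measure_mono (t := {x | (n + 1 : ℝ) ≤ g x}) fun x hx => hx.1).trans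
          ((hbound n).trans ?_)
        gcongr
        exact hκsum n
      _ = _ := by
        have h2 : (2⁻¹ : ℝ≥0∞) ^ n = ENNReal.ofReal ((2⁻¹ : ℝ) ^ n) := by
          rw [ENNReal.ofReal_pow (by norm_num), ENNReal.ofReal_inv_of_pos (by norm_num)]
          simp
        rw [h2, ← mul_assoc, ← ENNReal.ofReal_mul (by positivity), ← ENNReal.ofReal_mul (by positivity),
          mul_right_comm, ← ENNReal.ofReal_mul (by positivity)]
        congr 2
        rw [hε, div_pow, ← Real.exp_nat_mul, inv_pow]
        have : Real.exp (q * (n + 2)) * Real.exp (n * -q) = Real.exp (2 * q) := by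
          rw [← Real.exp_add]; congr 1; ring
        rw [← this]
        field_simp
  have hcover : {x | 1 ≤ g x} ⊆ ⋃ n, T n := by
    intro x hx
    have hx' : 1 ≤ g x := hx
    refine Set.mem_iUnion.2 ⟨⌊g x - 1⌋₊, ?_, ?_⟩
    · linarith [Nat.floor_le (by linarith : 0 ≤ g x - 1)]
    · linarith [Nat.lt_floor_add_one (g x - 1)]
  calc _ ≤ ∫⁻ x in ⋃ n, T n, ENNReal.ofReal (Real.exp (q * g x)) := lintegral_mono_set hcover
    _ ≤ ∑' n, ∫⁻ x in T n, ENNReal.ofReal (Real.exp (q * g x)) := lintegral_iUnion_le _ _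
    _ ≤ ∑' n, _ := ENNReal.tsum_le_tsum hterm
    _ = _ := by
      rw [ENNReal.tsum_mul_left, ENNReal.tsum_geometric, ENNReal.one_sub_inv_two, inv_inv]
      simp [ENNReal.ofReal]

/-! ### Maps of the plane into the hyperbolic plane -/

theorem continuous_lorNormSq : Continuous lorNormSq := by
  unfold lorNormSq
  simp only [lor_eq]
  fun_prop

theorem lorNormSq_nonneg (w : Amb) : 0 ≤ lorNormSq w := abs_nonneg _

/-- `f` is a map of the plane into the hyperbolic plane and the pair `D` consists of tangent vector
fields along `f` with `∫ ‖D‖² ≤ C`. -/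
structure IsFieldPair (C : ℝ≥0) (f : Plane → Amb) (D : Fin 2 → Plane → Amb) : Prop where
  meas : AEStronglyMeasurable f
  meas_field : ∀ k, AEStronglyMeasurable (D k)
  mem : ∀ᵐ x, f x ∈ hypPlane
  tangent : ∀ k, ∀ᵐ x, lor (f x) (D k x) = 0
  energy_le : ∫⁻ x, ENNReal.ofReal (∑ k, lorNormSq (D k x)) ≤ C

/-- Bounds of `f` in `Lˢ` on all sets of given finite measure, for all finite `s`. -/
def HasLpBounds (N : ℝ≥0∞ → ℝ≥0 → ℝ≥0) (f : Plane → Amb) : Prop :=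
  ∀ (s : ℝ≥0∞) (V : ℝ≥0) (K : Set Plane), s ≠ ⊤ → MeasurableSet K → volume K ≤ V →
    eLpNorm f s (volume.restrict K) ≤ N s V

/-- The length `(∑ₖ ‖Dₖ‖²)^(1/2)` of a pair of tangent fields. -/
noncomputable def fieldLength (D : Fin 2 → Plane → Amb) (x : Plane) : ℝ :=
  √(∑ k, lorNormSq (D k x))

namespace IsFieldPair

variable {C : ℝ≥0} {f : Plane → Amb} {D : Fin 2 → Plane → Amb} {N : ℝ≥0∞ → ℝ≥0 → ℝ≥0}

theorem aestronglyMeasurable_fieldLength (h : IsFieldPair C f D) :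
    AEStronglyMeasurable (fieldLength D) := by
  refine Real.continuous_sqrt.comp_aestronglyMeasurable ?_
  refine Finset.aestronglyMeasurable_fun_sum _ fun k _ => ?_
  exact continuous_lorNormSq.comp_aestronglyMeasurable (h.meas_field k)

theorem eLpNorm_fieldLength_le (h : IsFieldPair C f D) (μ : Measure Plane) (hμ : μ ≤ volume) :
    eLpNorm (fieldLength D) 2 μ ≤ (NNReal.sqrt C : ℝ≥0) := by
  rw [eLpNorm_eq_lintegral_rpow_enorm_toReal two_ne_zero ENNReal.ofNat_ne_top]
  have : ∫⁻ x, ‖fieldLength D x‖ₑ ^ (2 : ℝ≥0∞).toReal ∂μ ≤ C := by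
    refine le_trans (lintegral_mono' hμ le_rfl) (le_trans (le_of_eq ?_) h.energy_le)
    refine lintegral_congr fun x => ?_
    rw [fieldLength, Real.enorm_of_nonneg (Real.sqrt_nonneg _), ENNReal.toReal_ofNat, ENNReal.rpow_two,
      ← ENNReal.ofReal_pow (Real.sqrt_nonneg _), Real.sq_sqrt]
    exact Finset.sum_nonneg fun k _ => lorNormSq_nonneg _
  calc _ ≤ (C : ℝ≥0∞) ^ (1 / (2 : ℝ≥0∞).toReal) := by gcongr
    _ = _ := by
      rw [← ENNReal.coe_rpow_of_nonneg _ (by positivity), NNReal.sqrt_eq_rpow]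
      simp

theorem norm_field_le (h : IsFieldPair C f D) (k : Fin 2) :
    ∀ᵐ x, ‖D k x‖ ≤ 2 * ‖f x‖ * fieldLength D x := by
  filter_upwards [h.mem, h.tangent k] with x hx ht
  have := norm_frameComb_le hx (fun a => frameCoeff a (f x) (D k x))
  rw [frameComb_frameCoeff hx ht, ← lorNormSq_eq_sum hx ht] at this
  refine this.trans (mul_le_mul_of_nonneg_left (Real.sqrt_le_sqrt ?_) (by positivity))
  exact Finset.single_le_sum (f := fun k => lorNormSq (D k x)) (fun i _ => lorNormSq_nonneg _)
    (Finset.mem_univ k)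

theorem eLpNorm_field_le (h : IsFieldPair C f D) (hN : HasLpBounds N f) {p s : ℝ≥0∞}
    (hs : s ≠ ⊤) [s.HolderTriple 2 p] (V : ℝ≥0) {K : Set Plane} (hK : MeasurableSet K)
    (hV : volume K ≤ V) (k : Fin 2) :
    eLpNorm (D k) p (volume.restrict K) ≤ (2 * N s V * NNReal.sqrt C : ℝ≥0) := by
  calc eLpNorm (D k) p (volume.restrict K)
      ≤ eLpNorm (fun x => 2 * ‖f x‖ * fieldLength D x) p (volume.restrict K) :=
        eLpNorm_mono_ae_real (ae_restrict_of_ae (h.norm_field_le k))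
    _ ≤ (2 : ℝ≥0) * eLpNorm f s (volume.restrict K)
        * eLpNorm (fieldLength D) 2 (volume.restrict K) := by
      refine eLpNorm_le_eLpNorm_mul_eLpNorm'_of_norm h.meas.restrict
        h.aestronglyMeasurable_fieldLength.restrict (fun v r => 2 * ‖v‖ * r) 2 ?_
      refine Eventually.of_forall fun x => ?_
      simp
    _ ≤ (2 : ℝ≥0) * N s V * (NNReal.sqrt C : ℝ≥0) := by
      gcongr
      · exact hN s V K hs hK hV
      · exact h.eLpNorm_fieldLength_le _ Measure.restrict_le_self
    _ = _ := by push_cast; rfl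

theorem exists_eLpNorm_field_le (C : ℝ≥0) (N : ℝ≥0∞ → ℝ≥0 → ℝ≥0) {p : ℝ≥0∞} (hp : p < 2)
    (V : ℝ≥0) : ∃ B : ℝ≥0, ∀ f D, IsFieldPair C f D → HasLpBounds N f → ∀ K, MeasurableSet K →
      volume K ≤ V → ∀ k, eLpNorm (D k) p (volume.restrict K) ≤ B := by
  have h2 : (2 : ℝ≥0∞)⁻¹ < p⁻¹ := ENNReal.inv_lt_inv.2 hp
  -- Hölder with `1/p = 1/s + 1/2`. The exponent `s` is finite because `p < 2`, and only finite
  -- exponents are available for `f`.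
  have : (p⁻¹ - 2⁻¹)⁻¹.HolderTriple 2 p := ⟨by rw [inv_inv, tsub_add_cancel_of_le h2.le]⟩
  have hs : (p⁻¹ - 2⁻¹)⁻¹ ≠ ⊤ := by
    rw [ENNReal.inv_ne_top]
    exact (tsub_pos_of_lt h2).ne'
  exact ⟨_, fun f D h hN K hK hV k => h.eLpNorm_field_le hN hs V hK hV k⟩

theorem exists_eLpNorm_cross_le (C : ℝ≥0) (N : ℝ≥0∞ → ℝ≥0 → ℝ≥0) (V : ℝ≥0) :
    ∃ B : ℝ≥0, ∀ f D, IsFieldPair C f D → HasLpBounds N f → ∀ K, MeasurableSet K →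
      volume K ≤ V → ∀ k,
      eLpNorm (fun x => crossProduct (f x) (D k x)) 1 (volume.restrict K) ≤ B := by
  -- The product is estimated with `1/4 + 3/4 = 1`: the map in `L⁴`, the field in `L^{4/3}`.
  have h43 : (4 / 3 : ℝ≥0∞) < 2 := by
    rw [ENNReal.div_lt_iff (by simp) (by simp)]; norm_num
  obtain ⟨B, hB⟩ := exists_eLpNorm_field_le C N h43 V
  have : (4 : ℝ≥0∞).HolderTriple (4 / 3) 1 := ⟨by
    rw [ENNReal.inv_div (by simp) (by simp), inv_one, ← one_div, ENNReal.div_add_div_same]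
    norm_num
    exact ENNReal.div_self (by simp) (by simp)⟩
  refine ⟨2 * N 4 V * B, fun f D h hN K hK hV k => ?_⟩
  calc _ ≤ (2 : ℝ≥0) * eLpNorm f 4 (volume.restrict K)
        * eLpNorm (D k) (4 / 3) (volume.restrict K) := by
        refine eLpNorm_le_eLpNorm_mul_eLpNorm'_of_norm h.meas.restrict
          (h.meas_field k).restrict (fun v w => crossProduct v w) 2 ?_
        exact Eventually.of_forall fun x => norm_crossProduct_le _ _
    _ ≤ (2 : ℝ≥0) * N 4 V * B := by
      gcongr
      · exact hN 4 V K (by simp) hK hV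
      · exact hB f D h hN K hK hV k
    _ = _ := by push_cast; rfl

end IsFieldPair

/-! ### Smooth maps into the hyperbolic plane -/

theorem norm_sq_le_sum_sq (L : Plane →L[ℝ] ℝ) :
    ‖L‖ ^ 2 ≤ ∑ k, L (EuclideanSpace.single k 1) ^ 2 := by
  set S := ∑ k, L (EuclideanSpace.single k 1) ^ 2 with hS
  have hS0 : 0 ≤ S := by positivity
  have : ‖L‖ ≤ √S := by
    refine L.opNorm_le_bound (Real.sqrt_nonneg _) fun x => ?_
    have hx : L x = ∑ k, x k * L (EuclideanSpace.single k 1) := by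
      conv_lhs => rw [← (EuclideanSpace.basisFun (Fin 2) ℝ).sum_repr x]
      simp
    rw [hx, EuclideanSpace.norm_eq, ← Real.sqrt_mul hS0, Real.norm_eq_abs]
    apply Real.abs_le_sqrt
    refine (Finset.sum_mul_sq_le_sq_mul_sq _ _ _).trans_eq ?_
    simp [hS, mul_comm]
  calc _ ≤ √S ^ 2 := by gcongr
    _ = S := Real.sq_sqrt hS0

section Smooth

variable {f : Plane → Amb}

theorem lor_hasDerivAt {γ : ℝ → Amb} {γ' : Amb} {s : ℝ} (h : HasDerivAt γ γ' s)
    (hγ : ∀ r, γ r ∈ hypPlane) : lor (γ s) γ' = 0 := by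
  have hc : ∀ i, HasDerivAt (fun r => γ r i) (γ' i) s := fun i => (hasDerivAt_pi.1 h) i
  have h1 : HasDerivAt (fun r => lor (γ r) (γ r)) (2 * lor (γ s) γ') s := by
    simp only [lor_eq]
    refine ((((hc 0).mul (hc 0)).neg.add ((hc 1).mul (hc 1))).add
      ((hc 2).mul (hc 2))).congr_deriv ?_
    ring
  have h2 : (fun r => lor (γ r) (γ r)) = fun _ => -1 := funext fun r => (hγ r).1
  rw [h2] at h1
  linarith [h1.unique (hasDerivAt_const s (-1 : ℝ))]

theorem hasDerivAt_line {F : Type*} [NormedAddCommGroup F] [NormedSpace ℝ F] {f : Plane → F}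
    {x : Plane} (hf : DifferentiableAt ℝ f x) (k : Fin 2) :
    HasDerivAt (fun r : ℝ => f (x + r • EuclideanSpace.single k 1)) (partialDeriv k f x) 0 := by
  have h1 : HasDerivAt (fun r : ℝ => x + r • (EuclideanSpace.single k 1 : Plane))
      (EuclideanSpace.single k 1) 0 := by
    simpa using ((hasDerivAt_id (0 : ℝ)).smul_const (EuclideanSpace.single k 1 : Plane)).const_add x
  have hf' : HasFDerivAt f (fderiv ℝ f x) (x + (0 : ℝ) • (EuclideanSpace.single k 1 : Plane)) := by
    simpa using hf.hasFDerivAt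
  exact hf'.comp_hasDerivAt 0 h1

theorem lor_partialDeriv (hf : Differentiable ℝ f) (hm : ∀ x, f x ∈ hypPlane) (k : Fin 2)
    (x : Plane) : lor (f x) (partialDeriv k f x) = 0 := by
  simpa using lor_hasDerivAt (hasDerivAt_line (hf x) k) fun r => hm _

theorem continuous_partialDeriv {F : Type*} [NormedAddCommGroup F] [NormedSpace ℝ F]
    {f : Plane → F} (hf : ContDiff ℝ ∞ f) (k : Fin 2) : Continuous (partialDeriv k f) :=
  (hf.continuous_fderiv (by simp)).clm_apply continuous_const

theorem norm_fderiv_log_sq_le (hf : Differentiable ℝ f) (hm : ∀ x, f x ∈ hypPlane) (x : Plane) :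
    ‖fderiv ℝ (fun y => Real.log (f y 0)) x‖ ^ 2 ≤ ∑ k, lorNormSq (partialDeriv k f x) := by
  refine (norm_sq_le_sum_sq _).trans (Finset.sum_le_sum fun k _ => ?_)
  have h0 : (0 : ℝ) < f x 0 := (hm x).2
  have hp : HasFDerivAt (fun y => f y 0)
      ((ContinuousLinearMap.proj (R := ℝ) (φ := fun _ : Fin 3 => ℝ) 0).comp (fderiv ℝ f x)) x :=
    (hasFDerivAt_pi'.1 (hf x).hasFDerivAt) 0
  rw [(hp.log h0.ne').fderiv]
  have := sq_zero_le (hm x) (lor_partialDeriv hf hm k x)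
  have e : ((f x 0)⁻¹ • (ContinuousLinearMap.proj (R := ℝ) (φ := fun _ : Fin 3 => ℝ) 0).comp
      (fderiv ℝ f x)) (EuclideanSpace.single k 1) = (f x 0)⁻¹ * partialDeriv k f x 0 := rfl
  rw [e, mul_pow, inv_pow, inv_mul_le_iff₀ (by positivity)]
  exact this

/-- Chebyshev's inequality, as `e - 1 ≥ 1`. The level `e` is chosen to correspond to `log u₀ = 1`.
-/
theorem volume_le_of_mass {C : ℝ≥0} (hf : Continuous f)
    (hM : ∫⁻ x, ENNReal.ofReal (f x 0 - 1) ≤ C) : volume {x | Real.exp 1 ≤ f x 0} ≤ C := by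
  have hmeas : Measurable fun x => ENNReal.ofReal (f x 0 - 1) := by
    have : Continuous fun x => f x 0 := (continuous_apply 0).comp hf
    fun_prop
  have h := mul_meas_ge_le_lintegral (μ := volume) hmeas 1
  rw [one_mul] at h
  refine le_trans (measure_mono fun x hx => ?_) (h.trans hM)
  have hx' : Real.exp 1 ≤ f x 0 := hx
  have : (2 : ℝ) ≤ Real.exp 1 := by linarith [Real.add_one_le_exp 1]
  change 1 ≤ ENNReal.ofReal _
  rw [ENNReal.one_le_ofReal]
  linarith

/-- On the set where a map into the hyperbolic plane is large, all its powers are integrable,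
with bounds depending only on the energy and on the measure of this set. -/
theorem exists_lintegral_rpow_le (q : ℝ) (A C : ℝ≥0) :
    ∃ M : ℝ≥0, ∀ f : Plane → Amb, ContDiff ℝ ∞ f → (∀ x, f x ∈ hypPlane) →
      volume {x | Real.exp 1 ≤ f x 0} ≤ A →
      ∫⁻ x, ENNReal.ofReal (∑ k, lorNormSq (partialDeriv k f x)) ≤ C →
      ∫⁻ x in {x | Real.exp 1 ≤ f x 0}, ENNReal.ofReal (f x 0 ^ q) ≤ M := by
  obtain ⟨M, hM⟩ := exists_lintegral_exp_le q A C
  refine ⟨M, fun f hf hm hA hC => ?_⟩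
  have h0 : ∀ x, (0 : ℝ) < f x 0 := fun x => (hm x).2
  have hset : {x | Real.exp 1 ≤ f x 0} = {x | 1 ≤ Real.log (f x 0)} := by
    ext x
    exact (Real.le_log_iff_exp_le (h0 x)).symm
  have hg : ContDiff ℝ ∞ fun x => Real.log (f x 0) :=
    ContDiff.log (contDiff_pi.1 hf 0) fun x => (h0 x).ne'
  have := hM _ hg (by rwa [← hset]) (le_trans (lintegral_mono fun x => ?_) hC)
  · rw [← hset] at this
    refine le_trans (le_of_eq (lintegral_congr fun x => ?_)) this
    rw [Real.rpow_def_of_pos (h0 x), mul_comm]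
  · rw [← ofReal_norm, ← ENNReal.ofReal_pow (norm_nonneg _)]
    exact ENNReal.ofReal_le_ofReal (norm_fderiv_log_sq_le (hf.differentiable (by simp)) hm x)

end Smooth

/-- A smooth map of the plane into the hyperbolic plane with energy and mass at most `C`. -/
structure IsSlice (C : ℝ≥0) (f : Plane → Amb) : Prop where
  smooth : ContDiff ℝ ∞ f
  mem : ∀ x, f x ∈ hypPlane
  energy_le : ∫⁻ x, ENNReal.ofReal (∑ k, lorNormSq (partialDeriv k f x)) ≤ C
  mass_le : ∫⁻ x, ENNReal.ofReal (f x 0 - 1) ≤ C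

theorem IsSlice.isFieldPair {C : ℝ≥0} {f : Plane → Amb} (h : IsSlice C f) :
    IsFieldPair C f (fun k => partialDeriv k f) where
  meas := h.smooth.continuous.aestronglyMeasurable
  meas_field k := (continuous_partialDeriv h.smooth k).aestronglyMeasurable
  mem := Eventually.of_forall h.mem
  tangent k := Eventually.of_forall fun x =>
    lor_partialDeriv (h.smooth.differentiable (by simp)) h.mem k x
  energy_le := h.energy_le

/-- Below the level `e` the map is bounded and `K` has finite measure, while above it the
Moser–Trudinger bound applies. The condition `s ≠ ⊤` stands after the quantifier over `N` so that a
constant can be chosen for every `s` at once. -/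
theorem exists_eLpNorm_slice_le (C : ℝ≥0) (s : ℝ≥0∞) (V : ℝ≥0) :
    ∃ N : ℝ≥0, s ≠ ⊤ → ∀ f, IsSlice C f → ∀ K : Set Plane, MeasurableSet K → volume K ≤ V →
      eLpNorm f s (volume.restrict K) ≤ N := by
  by_cases hs : s = ⊤
  · exact ⟨0, fun h => (h hs).elim⟩
  by_cases hs0 : s = 0
  · exact ⟨0, fun _ f _ K _ _ => by simp [hs0]⟩
  obtain ⟨M, hM⟩ := exists_lintegral_rpow_le s.toReal C C
  have hs1 : 0 < s.toReal := ENNReal.toReal_pos hs0 hs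
  refine ⟨((Real.exp 1 ^ s.toReal).toNNReal * V + M) ^ (1 / s.toReal), fun _ f hf K hK hV => ?_⟩
  have hcont : Continuous fun x => f x 0 := (continuous_apply 0).comp hf.smooth.continuous
  have hmS : MeasurableSet {x | Real.exp 1 ≤ f x 0} :=
    measurableSet_le measurable_const hcont.measurable
  rw [eLpNorm_eq_lintegral_rpow_enorm_toReal hs0 hs, ENNReal.coe_rpow_of_nonneg _ (by positivity)]
  gcongr
  have hpt : ∀ x, ‖f x‖ₑ ^ s.toReal = ENNReal.ofReal (f x 0 ^ s.toReal) := fun x => by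
    rw [← ofReal_norm, norm_eq_of_mem (hf.mem x), ENNReal.ofReal_rpow_of_pos (hf.mem x).2]
  simp only [hpt]
  calc ∫⁻ x in K, ENNReal.ofReal (f x 0 ^ s.toReal)
      ≤ ∫⁻ x in K, (ENNReal.ofReal (Real.exp 1 ^ s.toReal) + Set.indicator
          {x | Real.exp 1 ≤ f x 0} (fun x => ENNReal.ofReal (f x 0 ^ s.toReal)) x) := by
        refine lintegral_mono fun x => ?_
        by_cases hx : Real.exp 1 ≤ f x 0
        · rw [Set.indicator_of_mem (by exact hx)]
          exact le_add_self
        · rw [Set.indicator_of_notMem (by exact hx), add_zero]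
          exact ENNReal.ofReal_le_ofReal
            (Real.rpow_le_rpow (hf.mem x).2.le (not_le.1 hx).le hs1.le)
    _ = ENNReal.ofReal (Real.exp 1 ^ s.toReal) * volume K + ∫⁻ x in K, Set.indicator
          {x | Real.exp 1 ≤ f x 0} (fun x => ENNReal.ofReal (f x 0 ^ s.toReal)) x := by
        rw [lintegral_add_left measurable_const]
        simp
    _ ≤ ENNReal.ofReal (Real.exp 1 ^ s.toReal) * V + M := by
        gcongr
        refine (setLIntegral_le_lintegral _ _).trans ?_
        rw [lintegral_indicator hmS]
        exact hM f hf.smooth hf.mem (volume_le_of_mass hf.smooth.continuous hf.mass_le)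
          hf.energy_le
    _ = _ := by push_cast; rfl

/-- The bounds in `Lˢ` satisfied by all smooth maps with energy and mass at most `C`. -/
noncomputable def sliceBound (C : ℝ≥0) (s : ℝ≥0∞) (V : ℝ≥0) : ℝ≥0 :=
  (exists_eLpNorm_slice_le C s V).choose

theorem IsSlice.hasLpBounds {C : ℝ≥0} {f : Plane → Amb} (h : IsSlice C f) :
    HasLpBounds (sliceBound C) f := fun s V K hs hK hV =>
  (exists_eLpNorm_slice_le C s V).choose_spec hs f h K hK hV

/-! ### Calculus on space-time -/

instance isAddHaarMeasure_spaceTime : (volume : Measure SpaceTime).IsAddHaarMeasure :=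
  Measure.prod.instIsAddHaarMeasure (volume : Measure ℝ) (volume : Measure Plane)

section Calculus

variable {E F G : Type*} [NormedAddCommGroup E] [NormedSpace ℝ E] [NormedAddCommGroup F]
  [NormedSpace ℝ F] [NormedAddCommGroup G] [NormedSpace ℝ G]

theorem hasDerivAt_dt {u : SpaceTime → F} (hu : Differentiable ℝ u) (t : ℝ) (x : Plane) :
    HasDerivAt (fun s => u (s, x)) (dt u (t, x)) t := by
  have h : Differentiable ℝ fun s => u (s, x) := hu.comp (by fun_prop)
  exact (h t).hasDerivAt

theorem dt_eq_fderiv {u : SpaceTime → F} (hu : Differentiable ℝ u) :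
    dt u = fun z => fderiv ℝ u z (1, 0) := by
  funext z
  have h1 : HasDerivAt (fun s : ℝ => (s, z.2)) ((1, 0) : SpaceTime) z.1 :=
    (hasDerivAt_id z.1).prodMk (hasDerivAt_const _ _)
  exact ((hu z).hasFDerivAt.comp_hasDerivAt z.1 h1).deriv

theorem dx_eq_fderiv {u : SpaceTime → F} (hu : Differentiable ℝ u) (k : Fin 2) :
    dx k u = fun z => fderiv ℝ u z (0, EuclideanSpace.single k 1) := by
  funext z
  have h1 : HasFDerivAt (fun y : Plane => (z.1, y)) (ContinuousLinearMap.inr ℝ ℝ Plane) z.2 :=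
    hasFDerivAt_prodMk_right z.1 z.2
  have h2 := ((hu z).hasFDerivAt.comp z.2 h1).fderiv
  change fderiv ℝ (fun y => u (z.1, y)) z.2 _ = _
  have h3 : (u ∘ fun y => (z.1, y)) = fun y => u (z.1, y) := rfl
  rw [h3] at h2
  rw [h2]
  simp

theorem contDiff_dt {u : SpaceTime → F} (hu : ContDiff ℝ ∞ u) : ContDiff ℝ ∞ (dt u) := by
  rw [dt_eq_fderiv (hu.differentiable (by simp))]
  exact (hu.fderiv_right (by simp)).clm_apply contDiff_const

theorem contDiff_dx {u : SpaceTime → F} (hu : ContDiff ℝ ∞ u) (k : Fin 2) :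
    ContDiff ℝ ∞ (dx k u) := by
  rw [dx_eq_fderiv (hu.differentiable (by simp))]
  exact (hu.fderiv_right (by simp)).clm_apply contDiff_const

theorem dt_dx_comm {u : SpaceTime → F} (hu : ContDiff ℝ ∞ u) (k : Fin 2) (z : SpaceTime) :
    dt (dx k u) z = dx k (dt u) z := by
  rw [dt_eq_fderiv ((contDiff_dx hu k).differentiable (by simp)),
    dx_eq_fderiv ((contDiff_dt hu).differentiable (by simp)),
    dx_eq_fderiv (hu.differentiable (by simp)), dt_eq_fderiv (hu.differentiable (by simp))]
  have hd : DifferentiableAt ℝ (fderiv ℝ u) z :=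
    (hu.fderiv_right (m := 1) (by norm_cast)).differentiable one_ne_zero z
  have key : ∀ v w : SpaceTime, fderiv ℝ (fun z => fderiv ℝ u z v) z w =
      fderiv ℝ (fderiv ℝ u) z w v := fun v w => by
    rw [fderiv_clm_apply hd (differentiableAt_const v)]
    simp
  beta_reduce
  rw [key, key]
  exact (hu.contDiffAt.isSymmSndFDerivAt (by
    rw [minSmoothness_of_isRCLikeNormedField]; exact WithTop.coe_le_coe.2 le_top)).eq _ _

theorem dt_bilin (B : E →L[ℝ] F →L[ℝ] G) {f : SpaceTime → E} {g : SpaceTime → F}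
    (hf : ContDiff ℝ ∞ f) (hg : ContDiff ℝ ∞ g) (z : SpaceTime) :
    dt (fun z => B (f z) (g z)) z = B (f z) (dt g z) + B (dt f z) (g z) := by
  have hf' := hf.differentiable (by simp)
  have hg' := hg.differentiable (by simp)
  rw [dt_eq_fderiv fun z => (B.hasFDerivAt_of_bilinear (hf' z).hasFDerivAt
    (hg' z).hasFDerivAt).differentiableAt, dt_eq_fderiv hf', dt_eq_fderiv hg']
  beta_reduce
  rw [ContinuousLinearMap.fderiv_of_bilinear B (hf' z) (hg' z)]
  rfl

theorem dx_bilin (B : E →L[ℝ] F →L[ℝ] G) (k : Fin 2) {f : SpaceTime → E} {g : SpaceTime → F}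
    (hf : ContDiff ℝ ∞ f) (hg : ContDiff ℝ ∞ g) (z : SpaceTime) :
    dx k (fun z => B (f z) (g z)) z = B (f z) (dx k g z) + B (dx k f z) (g z) := by
  have hf' := hf.differentiable (by simp)
  have hg' := hg.differentiable (by simp)
  rw [dx_eq_fderiv (fun z => (B.hasFDerivAt_of_bilinear (hf' z).hasFDerivAt
    (hg' z).hasFDerivAt).differentiableAt) k, dx_eq_fderiv hf', dx_eq_fderiv hg']
  beta_reduce
  rw [ContinuousLinearMap.fderiv_of_bilinear B (hf' z) (hg' z)]
  rfl

theorem dt_clm (L : E →L[ℝ] F) {f : SpaceTime → E} (hf : ContDiff ℝ ∞ f) (z : SpaceTime) :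
    dt (fun z => L (f z)) z = L (dt f z) := by
  have hf' := hf.differentiable (by simp)
  have : HasFDerivAt (fun z => L (f z)) (L.comp (fderiv ℝ f z)) z :=
    L.hasFDerivAt.comp z (hf' z).hasFDerivAt
  rw [dt_eq_fderiv (u := fun z => L (f z)) (L.differentiable.comp hf'), dt_eq_fderiv hf']
  beta_reduce
  rw [this.fderiv]
  rfl

theorem dx_clm (L : E →L[ℝ] F) (k : Fin 2) {f : SpaceTime → E} (hf : ContDiff ℝ ∞ f)
    (z : SpaceTime) : dx k (fun z => L (f z)) z = L (dx k f z) := by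
  have hf' := hf.differentiable (by simp)
  have : HasFDerivAt (fun z => L (f z)) (L.comp (fderiv ℝ f z)) z :=
    L.hasFDerivAt.comp z (hf' z).hasFDerivAt
  rw [dx_eq_fderiv (u := fun z => L (f z)) (L.differentiable.comp hf'), dx_eq_fderiv hf']
  beta_reduce
  rw [this.fderiv]
  rfl

theorem contDiff_slice {u : SpaceTime → F} (hu : ContDiff ℝ ∞ u) (t : ℝ) :
    ContDiff ℝ ∞ fun x => u (t, x) := hu.comp (by fun_prop)

theorem integral_smul_partialDeriv {χ : Plane → ℝ} {g : Plane → F} (hχ : ContDiff ℝ ∞ χ)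
    (hc : HasCompactSupport χ) (hg : ContDiff ℝ ∞ g) (k : Fin 2) :
    ∫ x, χ x • partialDeriv k g x = -∫ x, partialDeriv k χ x • g x := by
  have hχ' := continuous_partialDeriv hχ k
  have hg' := continuous_partialDeriv hg k
  have hc' : HasCompactSupport (partialDeriv k χ) := hc.fderiv_apply ℝ _
  exact integral_smul_fderiv_eq_neg_fderiv_smul_of_integrable
    ((hχ'.smul hg.continuous).integrable_of_hasCompactSupport hc'.smul_right)
    ((hχ.continuous.smul hg').integrable_of_hasCompactSupport hc.smul_right)
    ((hχ.continuous.smul hg.continuous).integrable_of_hasCompactSupport hc.smul_right)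
    (fun x _ => hχ.differentiable (by simp) x) fun x _ => hg.differentiable (by simp) x

theorem integrable_smul_of_hasCompactSupport {X : Type*} [TopologicalSpace X] [MeasurableSpace X]
    [OpensMeasurableSpace X] {μ : Measure X} [IsFiniteMeasureOnCompacts μ] {χ : X → ℝ}
    {g : X → F} (hχ : Continuous χ) (hc : HasCompactSupport χ) (hg : Continuous g) :
    Integrable (fun x => χ x • g x) μ :=
  (hχ.smul hg).integrable_of_hasCompactSupport hc.smul_right

/-- The localized form of a conservation law `∂ₜ f = ∑ₖ ∂ₖ Fₖ`. -/
theorem integral_smul_sub_eq [CompleteSpace F] {f : SpaceTime → F} {J : Fin 2 → SpaceTime → F}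
    (hf : ContDiff ℝ ∞ f) (hJ : ∀ k, ContDiff ℝ ∞ (J k))
    (hfJ : ∀ z, dt f z = ∑ k, dx k (J k) z) {χ : Plane → ℝ} (hχ : ContDiff ℝ ∞ χ)
    (hc : HasCompactSupport χ) (s t : ℝ) :
    (∫ x, χ x • f (t, x)) - ∫ x, χ x • f (s, x) =
      -∫ r in s..t, ∫ x, ∑ k, partialDeriv k χ x • J k (r, x) := by
  have hdt : Continuous (dt f) := (contDiff_dt hf).continuous
  have h1 : ∀ r, ∫ x, χ x • dt f (r, x) = -∫ x, ∑ k, partialDeriv k χ x • J k (r, x) := by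
    intro r
    have hcd : ∀ k, HasCompactSupport (partialDeriv k χ) := fun k => hc.fderiv_apply ℝ _
    rw [integral_finsetSum _ fun k _ => integrable_smul_of_hasCompactSupport
      (continuous_partialDeriv hχ k) (hcd k) (contDiff_slice (hJ k) r).continuous,
      ← Finset.sum_neg_distrib]
    simp only [hfJ, Finset.smul_sum]
    rw [integral_finsetSum _ fun k _ => integrable_smul_of_hasCompactSupport
      hχ.continuous hc (contDiff_slice (contDiff_dx (hJ k) k) r).continuous]
    exact Finset.sum_congr rfl fun k _ =>
      integral_smul_partialDeriv hχ hc (contDiff_slice (hJ k) r) k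
  have h2 : Integrable (Function.uncurry fun (r : ℝ) (x : Plane) => χ x • dt f (r, x))
      ((volume.restrict (Set.uIoc s t)).prod volume) := by
    have hcont : Continuous fun z : SpaceTime => χ z.2 • dt f z :=
      (hχ.continuous.comp continuous_snd).smul hdt
    have hK : IsCompact (Set.uIcc s t ×ˢ tsupport χ) := isCompact_uIcc.prod hc
    have hi : IntegrableOn (fun z : SpaceTime => χ z.2 • dt f z)
        (Set.uIcc s t ×ˢ tsupport χ) (volume.prod volume) :=
      hcont.continuousOn.integrableOn_compact hK
    have hi2 : IntegrableOn (fun z : SpaceTime => χ z.2 • dt f z)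
        (Set.uIcc s t ×ˢ (Set.univ : Set Plane)) (volume.prod volume) := by
      refine hi.of_forall_sdiff_eq_zero
        (measurableSet_uIcc.prod MeasurableSet.univ) fun z hz => ?_
      have : z.2 ∉ tsupport χ := fun h => hz.2 ⟨hz.1.1, h⟩
      simp [image_eq_zero_of_notMem_tsupport this]
    have hi3 := hi2.mono_set (Set.prod_mono_left Set.uIoc_subset_uIcc)
    rw [IntegrableOn, ← Measure.prod_restrict, Measure.restrict_univ] at hi3
    exact hi3
  have hint : ∀ r, Integrable fun x => χ x • f (r, x) := fun r =>
    integrable_smul_of_hasCompactSupport hχ.continuous hc (contDiff_slice hf r).continuous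
  rw [← integral_sub (hint t) (hint s)]
  simp only [← smul_sub]
  calc ∫ x, χ x • (f (t, x) - f (s, x)) = ∫ x, ∫ r in s..t, χ x • dt f (r, x) := by
        refine integral_congr_ae (Eventually.of_forall fun x => ?_)
        simp only
        rw [intervalIntegral.integral_smul, intervalIntegral.integral_eq_sub_of_hasDerivAt
          fun r _ => hasDerivAt_dt (hf.differentiable (by simp)) r x]
        exact (hdt.comp (by fun_prop : Continuous fun r : ℝ => (r, x))).intervalIntegrable _ _
    _ = ∫ r in s..t, ∫ x, χ x • dt f (r, x) := (intervalIntegral_integral_swap h2).symm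
    _ = _ := by
        simp only [h1]
        rw [intervalIntegral.integral_neg]

/-- The weak form of a conservation law on space-time. -/
theorem integral_dt_smul_eq {f : SpaceTime → F} {J : Fin 2 → SpaceTime → F}
    (hf : ContDiff ℝ ∞ f) (hJ : ∀ k, ContDiff ℝ ∞ (J k))
    (hfJ : ∀ z, dt f z = ∑ k, dx k (J k) z) {φ : SpaceTime → ℝ} (hφ : ContDiff ℝ ∞ φ)
    (hc : HasCompactSupport φ) :
    ∫ z, dt φ z • f z = ∫ z, ∑ k, dx k φ z • J k z := by
  have hφ' := hφ.differentiable (by simp)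
  have hcd : ∀ v, HasCompactSupport fun z => fderiv ℝ φ z v := fun v => hc.fderiv_apply ℝ v
  have hcont : ∀ v, Continuous fun z => fderiv ℝ φ z v := fun v =>
    (hφ.continuous_fderiv (by simp)).clm_apply continuous_const
  have parts : ∀ (g : SpaceTime → F), ContDiff ℝ ∞ g → ∀ v,
      ∫ z, φ z • fderiv ℝ g z v = -∫ z, fderiv ℝ φ z v • g z := fun g hg v =>
    integral_smul_fderiv_eq_neg_fderiv_smul_of_integrable
      (integrable_smul_of_hasCompactSupport (hcont v) (hcd v) hg.continuous)
      (integrable_smul_of_hasCompactSupport hφ.continuous hc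
        ((hg.continuous_fderiv (by simp)).clm_apply continuous_const))
      (integrable_smul_of_hasCompactSupport hφ.continuous hc hg.continuous)
      (fun z _ => hφ' z) fun z _ => hg.differentiable (by simp) z
  have h1 : ∫ z, φ z • dt f z = -∫ z, dt φ z • f z := by
    rw [dt_eq_fderiv (hf.differentiable (by simp)), dt_eq_fderiv hφ']
    exact parts f hf _
  have h2 : ∀ k, ∫ z, φ z • dx k (J k) z = -∫ z, dx k φ z • J k z := fun k => by
    rw [dx_eq_fderiv ((hJ k).differentiable (by simp)), dx_eq_fderiv hφ']
    exact parts (J k) (hJ k) _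
  have h3 : ∫ z, φ z • dt f z = ∑ k, ∫ z, φ z • dx k (J k) z := by
    simp only [hfJ, Finset.smul_sum]
    exact integral_finsetSum _ fun k _ => integrable_smul_of_hasCompactSupport
      hφ.continuous hc (contDiff_dx (hJ k) k).continuous
  rw [integral_finsetSum _ fun k _ => integrable_smul_of_hasCompactSupport
      (by simpa only [dx_eq_fderiv hφ'] using hcont _)
      (by simpa only [dx_eq_fderiv hφ'] using hcd _) (hJ k).continuous]
  rw [h1, Finset.sum_congr rfl fun k _ => h2 k, Finset.sum_neg_distrib] at h3
  exact neg_injective h3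

end Calculus

/-! ### Conservation laws for smooth Schrödinger maps -/

/-- The vector product as a continuous bilinear map. -/
noncomputable def crossL : Amb →L[ℝ] Amb →L[ℝ] Amb :=
  LinearMap.mkContinuous₂ crossProduct 2 norm_crossProduct_le

theorem crossL_apply (v w : Amb) : crossL v w = crossProduct v w := rfl

/-- The Lorentz product as a continuous bilinear map. -/
noncomputable def lorL : Amb →L[ℝ] Amb →L[ℝ] ℝ :=
  LinearMap.mkContinuous₂
    (LinearMap.mk₂ ℝ lor (fun _ _ _ => by simp only [lor_eq, Pi.add_apply]; ring)
      (fun _ _ _ => by simp only [lor_eq, Pi.smul_apply, smul_eq_mul]; ring)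
      (fun _ _ _ => by simp only [lor_eq, Pi.add_apply]; ring)
      (fun _ _ _ => by simp only [lor_eq, Pi.smul_apply, smul_eq_mul]; ring)) 3 (by
    intro v w
    have hv : ∀ i, |v i| ≤ ‖v‖ := fun i => norm_le_pi_norm v i
    have hw : ∀ i, |w i| ≤ ‖w‖ := fun i => norm_le_pi_norm w i
    have h : ∀ i, |v i * w i| ≤ ‖v‖ * ‖w‖ := fun i => by
      rw [abs_mul]
      exact mul_le_mul (hv i) (hw i) (abs_nonneg _) (norm_nonneg _)
    rw [LinearMap.mk₂_apply, lor_eq, Real.norm_eq_abs]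
    calc _ ≤ |-(v 0 * w 0)| + |v 1 * w 1| + |v 2 * w 2| := abs_add_three _ _ _
      _ ≤ 3 * ‖v‖ * ‖w‖ := by rw [abs_neg]; linarith [h 0, h 1, h 2])

theorem lorL_apply (v w : Amb) : lorL v w = lor v w := rfl

namespace IsSmoothSchrodingerMap

variable {u : SpaceTime → Amb}

/-- The fluxes `η (u × ∂ₖ u)` of a map. -/
noncomputable def flux (u : SpaceTime → Amb) (k : Fin 2) (z : SpaceTime) : Amb :=
  eta (crossProduct (u z) (dx k u z))

theorem contDiff_flux (hu : ContDiff ℝ ∞ u) (k : Fin 2) : ContDiff ℝ ∞ (flux u k) :=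
  etaL.contDiff.comp ((crossL.contDiff.comp hu).clm_apply (contDiff_dx hu k))

/-- The divergence form: in `∂ₖ (u × ∂ₖ u)` the term `∂ₖ u × ∂ₖ u` vanishes. -/
theorem dt_eq (h : IsSmoothSchrodingerMap u) (z : SpaceTime) :
    dt u z = ∑ k, dx k (flux u k) z := by
  have hk : ∀ k, dx k (flux u k) z = etaL (crossL (u z) (dx k (dx k u) z)) := fun k => by
    have hc : ContDiff ℝ ∞ fun z => crossL (u z) (dx k u z) :=
      (crossL.contDiff.comp h.smooth).clm_apply (contDiff_dx h.smooth k)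
    have h1 : flux u k = fun z => etaL (crossL (u z) (dx k u z)) := rfl
    rw [h1, dx_clm etaL k hc, dx_bilin crossL k h.smooth (contDiff_dx h.smooth k)]
    rw [crossL_apply (dx k u z), cross_self, add_zero]
  rw [h.equation z, Finset.sum_congr rfl fun k _ => hk k, ← map_sum, ← map_sum]
  rfl

theorem lor_dx (h : IsSmoothSchrodingerMap u) (k : Fin 2) (z : SpaceTime) :
    lor (u z) (dx k u z) = 0 :=
  lor_partialDeriv ((contDiff_slice h.smooth z.1).differentiable (by simp))
    (fun _ => h.mem_hypPlane _) k z.2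

theorem lor_dt (h : IsSmoothSchrodingerMap u) (z : SpaceTime) :
    lor (u z) (dt u z) = 0 :=
  lor_hasDerivAt (hasDerivAt_dt (h.smooth.differentiable (by simp)) z.1 z.2)
    fun _ => h.mem_hypPlane _

/-- The energy density. -/
noncomputable def energyDensity (u : SpaceTime → Amb) (z : SpaceTime) : ℝ :=
  ∑ k, lor (dx k u z) (dx k u z)

theorem energyDensity_eq (h : IsSmoothSchrodingerMap u) (z : SpaceTime) :
    energyDensity u z = ∑ k, lorNormSq (dx k u z) :=
  Finset.sum_congr rfl fun k _ => (lorNormSq_eq (h.mem_hypPlane z) (h.lor_dx k z)).symm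

theorem contDiff_lor {f g : SpaceTime → Amb} (hf : ContDiff ℝ ∞ f) (hg : ContDiff ℝ ∞ g) :
    ContDiff ℝ ∞ fun z => lor (f z) (g z) := (lorL.contDiff.comp hf).clm_apply hg

theorem contDiff_energyDensity (hu : ContDiff ℝ ∞ u) : ContDiff ℝ ∞ (energyDensity u) :=
  ContDiff.sum fun k _ => contDiff_lor (contDiff_dx hu k) (contDiff_dx hu k)

/-- The divergence on the right contains the extra term `2⟨∂ₜ u, η Δu⟩`, which is zero by
`lor_eta_cross_self` because `∂ₜ u = η (u × Δu)`. -/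
theorem dt_energyDensity (h : IsSmoothSchrodingerMap u) (z : SpaceTime) :
    dt (energyDensity u) z = ∑ k, dx k (fun z => 2 * lor (dt u z) (dx k u z)) z := by
  have hu := h.smooth
  have h1 : ∀ k, dx k (fun z => 2 * lor (dt u z) (dx k u z)) z =
      2 * (lor (dt u z) (dx k (dx k u) z) + lor (dx k (dt u) z) (dx k u z)) := fun k => by
    have e : (fun z => 2 * lor (dt u z) (dx k u z)) =
        fun z => ((2 : ℝ) • lorL) (dt u z) (dx k u z) := rfl
    rw [e, dx_bilin _ k (contDiff_dt hu) (contDiff_dx hu k)]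
    simp only [smul_apply, lorL_apply, smul_eq_mul, mul_add]
  have h2 : dt (energyDensity u) z = ∑ k, 2 * lor (dx k (dt u) z) (dx k u z) := by
    have hd : ∀ k, HasDerivAt (fun s => lor (dx k u (s, z.2)) (dx k u (s, z.2)))
        (2 * lor (dx k (dt u) z) (dx k u z)) z.1 := fun k => by
      have := hasDerivAt_dt ((contDiff_lor (contDiff_dx hu k) (contDiff_dx hu k)).differentiable
        (by simp)) z.1 z.2
      refine this.congr_deriv ?_
      have e := dt_bilin lorL (contDiff_dx hu k) (contDiff_dx hu k) z
      simp only [lorL_apply] at e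
      rw [Prod.mk.eta, e, dt_dx_comm hu, lor_comm (dx k u z)]
      ring
    exact (HasDerivAt.fun_sum fun k _ => hd k).deriv
  have h3 : ∑ k, lor (dt u z) (dx k (dx k u) z) = 0 := by
    have e : ∑ k, lor (dt u z) (dx k (dx k u) z) = lorL (dt u z) (∑ k, dx k (dx k u) z) := by
      rw [map_sum]; rfl
    rw [e, lorL_apply, h.equation z, lor_eta_cross_self]
  rw [h2, Finset.sum_congr rfl fun k _ => h1 k, ← Finset.mul_sum, ← Finset.mul_sum,
    Finset.sum_add_distrib, h3, zero_add]

theorem contDiff_mass (hu : ContDiff ℝ ∞ u) : ContDiff ℝ ∞ fun z => u z 0 - 1 :=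
  (contDiff_pi.1 hu 0).sub contDiff_const

theorem dt_mass (h : IsSmoothSchrodingerMap u) (z : SpaceTime) :
    dt (fun z => u z 0 - 1) z = ∑ k, dx k (fun z => flux u k z 0) z := by
  let L : Amb →L[ℝ] ℝ := ContinuousLinearMap.proj 0
  have h1 : ∀ k, dx k (fun z => flux u k z 0) z = L (dx k (flux u k) z) := fun k =>
    dx_clm L k (contDiff_flux h.smooth k) z
  have h2 : dt (fun z => u z 0 - 1) z = L (dt u z) := by
    rw [← dt_clm L h.smooth]
    simp only [dt]
    exact deriv_sub_const _
  rw [h2, h.dt_eq, map_sum, Finset.sum_congr rfl fun k _ => h1 k]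

end IsSmoothSchrodingerMap

/-! ### Conservation of energy and mass -/

/-- For `y ≥ 0` put `w = √(1 + y²)`, so that `arsinh y = log (y + w)`. The bound `log z ≥ 1 - 1/z`
at `z = (y + w)²` yields `y / (y + w) ≤ arsinh y`, and `y + w ≤ 2w`. -/
theorem abs_le_two_mul_arsinh (y : ℝ) : |y| ≤ 2 * √(1 + y ^ 2) * |Real.arsinh y| := by
  wlog hy : 0 ≤ y generalizing y
  · have := this (-y) (by linarith)
    simpa using this
  have hw1 : √(1 + y ^ 2) ^ 2 = 1 + y ^ 2 := Real.sq_sqrt (by positivity)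
  have hw0 : 0 ≤ √(1 + y ^ 2) := Real.sqrt_nonneg _
  have hyw : y ≤ √(1 + y ^ 2) := Real.le_sqrt_of_sq_le (by linarith)
  have hpos : 0 < √(1 + y ^ 2) := Real.sqrt_pos.2 (by positivity)
  rw [abs_of_nonneg hy, abs_of_nonneg (Real.arsinh_nonneg_iff.2 hy), Real.arsinh]
  set w := √(1 + y ^ 2)
  have hz : 0 < y + w := by positivity
  have h1 := Real.one_sub_inv_le_log_of_pos (by positivity : 0 < (y + w) ^ 2)
  rw [Real.log_pow] at h1
  have h2 : 1 - ((y + w) ^ 2)⁻¹ = 2 * (y / (y + w)) := by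
    field_simp
    linear_combination hw1
  rw [h2] at h1
  push_cast at h1
  have h3 : y / (y + w) ≤ Real.log (y + w) := by linarith
  rw [div_le_iff₀ hz] at h3
  have h4 : 0 ≤ Real.log (y + w) := by
    refine le_trans ?_ (by linarith : y / (y + w) ≤ _)
    positivity
  nlinarith

/-- With `h = arsinh y` the right side is `2 (cosh h - 1) = 4 sinh² (h/2)`, and `|sinh (h/2)| ≥
|h/2|`. -/
theorem arsinh_sq_le (y : ℝ) : Real.arsinh y ^ 2 ≤ 2 * (√(1 + y ^ 2) - 1) := by
  rw [← Real.cosh_arsinh]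
  set h := Real.arsinh y
  have h1 : Real.cosh h = 1 + 2 * Real.sinh (h / 2) ^ 2 := by
    have := Real.cosh_two_mul (h / 2)
    rw [show 2 * (h / 2) = h by ring] at this
    rw [this, Real.cosh_sq]
    ring
  have h2 : (h / 2) ^ 2 ≤ Real.sinh (h / 2) ^ 2 := by
    rw [sq_le_sq]
    rcases le_total 0 (h / 2) with h0 | h0
    · rw [abs_of_nonneg h0, abs_of_nonneg (Real.sinh_nonneg_iff.2 h0)]
      exact Real.self_le_sinh_iff.2 h0
    · rw [abs_of_nonpos h0, abs_of_nonpos (Real.sinh_nonpos_iff.2 h0)]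
      exact neg_le_neg (Real.sinh_le_self_iff.2 h0)
  rw [h1]
  nlinarith

theorem continuous_slice {F : Type*} [TopologicalSpace F] {u : SpaceTime → F} (hu : Continuous u)
    (t : ℝ) : Continuous fun x => u (t, x) := hu.comp (by fun_prop)

theorem setLIntegral_slab {g : SpaceTime → ℝ≥0∞} (hg : Measurable g) (S : Set ℝ) :
    ∫⁻ z in S ×ˢ (Set.univ : Set Plane), g z = ∫⁻ r in S, ∫⁻ x, g (r, x) := by
  change ∫⁻ z in S ×ˢ (Set.univ : Set Plane), g z ∂(volume.prod volume) = _
  rw [← Measure.prod_restrict, Measure.restrict_univ, lintegral_prod _ hg.aemeasurable]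

/-- A nonnegative density satisfying a conservation law with integrable flux has nonincreasing
total integral. -/
theorem lintegral_le_of_conservation {f : SpaceTime → ℝ} {J : Fin 2 → SpaceTime → ℝ}
    (hf : ContDiff ℝ ∞ f) (hJ : ∀ k, ContDiff ℝ ∞ (J k)) (hf0 : ∀ z, 0 ≤ f z)
    (hfJ : ∀ z, dt f z = ∑ k, dx k (J k) z)
    (hfin : ∀ T : ℝ, ∫⁻ z in Set.Icc (-T) T ×ˢ (Set.univ : Set Plane), ∑ k, ‖J k z‖ₑ ≠ ⊤) (t : ℝ) :
    ∫⁻ x, ENNReal.ofReal (f (t, x)) ≤ ∫⁻ x, ENNReal.ofReal (f (0, x)) := by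
  obtain ⟨c, hc⟩ := exists_norm_fderiv_cutoff_le
  set I := ∫⁻ z in Set.Icc (-|t|) |t| ×ˢ (Set.univ : Set Plane), ∑ k, ‖J k z‖ₑ with hI
  have hint : ∀ n r, Integrable fun x => cutoff n x * f (r, x) := fun n r =>
    integrable_smul_of_hasCompactSupport (contDiff_cutoff n).continuous (hasCompactSupport_cutoff n)
      (contDiff_slice hf r).continuous
  have hnn : ∀ n r x, 0 ≤ cutoff n x * f (r, x) := fun n r x =>
    mul_nonneg (cutoff_nonneg n x) (hf0 _)
  have hJm : Measurable fun z => ∑ k, ‖J k z‖ₑ :=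
    Finset.measurable_sum _ fun k _ => (hJ k).continuous.measurable.enorm
  -- The flux is paired only with the gradient of the cutoff, of size `c / (n + 1)`. Its total
  -- contribution is thus `c / (n + 1)` times the finite integral `I` and disappears in the limit.
  have hstep : ∀ n : ℕ, ∫⁻ x, ENNReal.ofReal (cutoff n x * f (t, x)) ≤
      (∫⁻ x, ENNReal.ofReal (f (0, x))) + ENNReal.ofReal (c / (n + 1)) * I := by
    intro n
    have h := integral_smul_sub_eq hf hJ hfJ (contDiff_cutoff n) (hasCompactSupport_cutoff n) 0 t
    simp only [smul_eq_mul] at h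
    set R := ∫ r in (0 : ℝ)..t, ∫ x, ∑ k, partialDeriv k (cutoff n) x * J k (r, x) with hR
    have hRle : ENNReal.ofReal ‖R‖ ≤ ENNReal.ofReal (c / (n + 1)) * I := by
      rw [hR, intervalIntegral.norm_integral_eq_norm_integral_uIoc, ofReal_norm]
      calc _ ≤ ∫⁻ r in Set.uIoc 0 t, ‖∫ x, ∑ k, partialDeriv k (cutoff n) x * J k (r, x)‖ₑ :=
            enorm_integral_le_lintegral_enorm _
        _ ≤ ∫⁻ r in Set.uIoc 0 t, ∫⁻ x, ENNReal.ofReal (c / (n + 1)) * ∑ k, ‖J k (r, x)‖ₑ := by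
          refine lintegral_mono fun r => (enorm_integral_le_lintegral_enorm _).trans
            (lintegral_mono fun x => ?_)
          refine (enorm_sum_le _ _).trans ?_
          rw [Finset.mul_sum]
          refine Finset.sum_le_sum fun k _ => ?_
          rw [enorm_mul]
          gcongr
          rw [← ofReal_norm]
          refine ENNReal.ofReal_le_ofReal ?_
          refine (ContinuousLinearMap.le_opNorm _ _).trans ?_
          simpa using hc n x
        _ ≤ ∫⁻ r in Set.Icc (-|t|) |t|,
              ∫⁻ x, ENNReal.ofReal (c / (n + 1)) * ∑ k, ‖J k (r, x)‖ₑ := by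
          refine lintegral_mono_set fun r hr => ?_
          rcases Set.mem_uIoc.1 hr with hr | hr
          · exact ⟨by linarith [abs_nonneg t], by linarith [le_abs_self t]⟩
          · exact ⟨by linarith [neg_abs_le t], by linarith [abs_nonneg t]⟩
        _ = _ := by
          rw [hI, ← lintegral_const_mul _ hJm, setLIntegral_slab (hJm.const_mul _)]
    rw [← ofReal_integral_eq_lintegral_ofReal (hint n t) (Eventually.of_forall (hnn n t))]
    have h2 : ∫ x, cutoff n x * f (t, x) ≤ (∫ x, cutoff n x * f (0, x)) + ‖R‖ := by
      have := neg_le_abs R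
      rw [Real.norm_eq_abs]
      linarith
    calc _ ≤ ENNReal.ofReal ((∫ x, cutoff n x * f (0, x)) + ‖R‖) := ENNReal.ofReal_le_ofReal h2
      _ ≤ ENNReal.ofReal (∫ x, cutoff n x * f (0, x)) + ENNReal.ofReal ‖R‖ :=
        ENNReal.ofReal_add_le
      _ ≤ _ := by
        refine add_le_add ?_ hRle
        rw [ofReal_integral_eq_lintegral_ofReal (hint n 0) (Eventually.of_forall (hnn n 0))]
        refine lintegral_mono fun x => ENNReal.ofReal_le_ofReal ?_
        exact mul_le_of_le_one_left (hf0 _) (cutoff_le_one n x)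
  have hlim : Tendsto (fun n : ℕ => (∫⁻ x, ENNReal.ofReal (f (0, x)))
      + ENNReal.ofReal (c / (n + 1)) * I) atTop
      (𝓝 ((∫⁻ x, ENNReal.ofReal (f (0, x))) + 0 * I)) := by
    refine tendsto_const_nhds.add (ENNReal.Tendsto.mul_const ?_ (Or.inr (hfin _)))
    rw [← ENNReal.ofReal_zero]
    refine ENNReal.tendsto_ofReal ?_
    exact tendsto_const_nhds.div_atTop (tendsto_natCast_atTop_atTop.atTop_add tendsto_const_nhds)
  rw [zero_mul, add_zero] at hlim
  have hft : Continuous fun x => f (t, x) := continuous_slice hf.continuous t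
  calc ∫⁻ x, ENNReal.ofReal (f (t, x))
      = ∫⁻ x, liminf (fun n => ENNReal.ofReal (cutoff n x * f (t, x))) atTop := by
        refine lintegral_congr fun x => (Tendsto.liminf_eq ?_).symm
        refine tendsto_const_nhds.congr' ?_
        filter_upwards [cutoff_eventually_eq_one x] with n hn
        rw [hn, one_mul]
    _ ≤ liminf (fun n => ∫⁻ x, ENNReal.ofReal (cutoff n x * f (t, x))) atTop :=
        lintegral_liminf_le fun n =>
          ((contDiff_cutoff n).continuous.mul hft).measurable.ennreal_ofReal
    _ ≤ liminf (fun n : ℕ => (∫⁻ x, ENNReal.ofReal (f (0, x)))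
          + ENNReal.ofReal (c / (n + 1)) * I) atTop :=
        liminf_le_liminf (Eventually.of_forall hstep)
    _ = _ := hlim.liminf_eq

namespace IsSmoothSchrodingerMap

variable {u : SpaceTime → Amb}

/-- The square of the `L²` norm of `‖∂ₜ u‖` and `‖∇ u‖` on the slab `[-T, T] × ℝ²`. -/
noncomputable def slabNorm (u : SpaceTime → Amb) (T : ℝ) : ℝ≥0∞ :=
  ∫⁻ z in Set.Icc (-T) T ×ˢ (Set.univ : Set Plane),
    ENNReal.ofReal (lorNormSq (dt u z) + ∑ k : Fin 2, lorNormSq (dx k u z))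

theorem measurable_slabDensity (hu : ContDiff ℝ ∞ u) : Measurable fun z =>
    ENNReal.ofReal (lorNormSq (dt u z) + ∑ k : Fin 2, lorNormSq (dx k u z)) :=
  ((continuous_lorNormSq.comp (contDiff_dt hu).continuous).add (continuous_finsetSum _ fun k _ =>
    continuous_lorNormSq.comp (contDiff_dx hu k).continuous)).measurable.ennreal_ofReal

theorem energy_le_energy_zero (h : IsSmoothSchrodingerMap u) (hs : ∀ T, slabNorm u T < ⊤) (t : ℝ) :
    energy (fun k => dx k u) t ≤ energy (fun k => dx k u) 0 := by
  have hcons := lintegral_le_of_conservation (f := energyDensity u)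
    (J := fun k z => 2 * lor (dt u z) (dx k u z)) (contDiff_energyDensity h.smooth)
    (fun k => contDiff_const.mul (contDiff_lor (contDiff_dt h.smooth) (contDiff_dx h.smooth k)))
    (fun z => by
      rw [h.energyDensity_eq]
      exact Finset.sum_nonneg fun k _ => lorNormSq_nonneg _)
    h.dt_energyDensity (fun T => ?_) t
  · simp only [energyDensity_eq h] at hcons
    exact hcons
  -- Each flux is at most `2 (‖∂ₜ u‖² + ‖∂ₖ u‖²)` by `abs_lor_le`. The sum over the two directions
  -- is at most four times the slab density.
  · refine ne_top_of_le_ne_top (ENNReal.mul_ne_top (by simp : (4 : ℝ≥0∞) ≠ ⊤) (hs T).ne) ?_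
    rw [slabNorm, ← lintegral_const_mul _ (measurable_slabDensity h.smooth)]
    refine lintegral_mono fun z => ?_
    have h4 : (4 : ℝ≥0∞) = ENNReal.ofReal 4 := by simp
    rw [h4, ← ENNReal.ofReal_mul (by norm_num), Fin.sum_univ_two, ← ofReal_norm, ← ofReal_norm,
      ← ENNReal.ofReal_add (norm_nonneg _) (norm_nonneg _)]
    refine ENNReal.ofReal_le_ofReal ?_
    have hk := fun k => abs_lor_le (h.mem_hypPlane z) (h.lor_dt z) (h.lor_dx k z)
    rw [Real.norm_eq_abs, Real.norm_eq_abs, abs_mul, abs_mul, abs_two, Fin.sum_univ_two]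
    nlinarith [hk 0, hk 1, lorNormSq_nonneg (dx 0 u z), lorNormSq_nonneg (dx 1 u z)]

/-! ### Square integrability of the coordinates `u₁`, `u₂`. -/

section Displacement

/-- The map `z ↦ (arsinh u₁, arsinh u₂)`, a contraction of the hyperbolic plane into each axis. -/
noncomputable def arsinhCoord (u : SpaceTime → Amb) (a : Fin 2) (z : SpaceTime) : ℝ :=
  Real.arsinh (u z a.succ)

theorem contDiff_arsinhCoord (hu : ContDiff ℝ ∞ u) (a : Fin 2) :
    ContDiff ℝ ∞ (arsinhCoord u a) := (contDiff_pi.1 hu a.succ).arsinh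

theorem dt_arsinhCoord_sq_le (h : IsSmoothSchrodingerMap u) (a : Fin 2) (z : SpaceTime) :
    dt (arsinhCoord u a) z ^ 2 ≤ lorNormSq (dt u z) := by
  have hd := (hasDerivAt_pi.1 (hasDerivAt_dt (h.smooth.differentiable (by simp)) z.1 z.2)
    a.succ).arsinh
  have e : dt (arsinhCoord u a) z = (√(1 + u z a.succ ^ 2))⁻¹ • dt u z a.succ := hd.deriv
  have := sq_succ_le (h.mem_hypPlane z) (h.lor_dt z) a
  rw [e, smul_eq_mul, mul_pow, inv_pow, Real.sq_sqrt (by positivity),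
    inv_mul_le_iff₀ (by positivity)]
  exact this

/-- The increment in time is the integral of a derivative bounded by `‖∂ₜ u‖`, and Cauchy–Schwarz on
an interval of length `2T` gives the factor. Using `arsinh u_a` instead of `u_a` avoids a weight
`√(1 + u_a²)` on `∂ₜ u`. -/
theorem enorm_arsinhCoord_sq_le (h : IsSmoothSchrodingerMap u) (a : Fin 2) {t T : ℝ}
    (ht : |t| ≤ T) (x : Plane) :
    ‖arsinhCoord u a (t, x)‖ₑ ^ 2 ≤ 2 * ‖arsinhCoord u a (0, x)‖ₑ ^ 2 +
      2 * ENNReal.ofReal (2 * T) * ∫⁻ r in Set.Icc (-T) T, ENNReal.ofReal (lorNormSq (dt u (r, x))) := by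
  have hs := contDiff_arsinhCoord h.smooth a
  have hdc : Continuous fun r => dt (arsinhCoord u a) (r, x) :=
    (contDiff_dt hs).continuous.comp (by fun_prop)
  have hftc : arsinhCoord u a (t, x) - arsinhCoord u a (0, x) =
      ∫ r in (0 : ℝ)..t, dt (arsinhCoord u a) (r, x) :=
    (intervalIntegral.integral_eq_sub_of_hasDerivAt
      (fun r _ => hasDerivAt_dt (hs.differentiable (by simp)) r x)
      (hdc.intervalIntegrable _ _)).symm
  set A := arsinhCoord u a (t, x)
  set B := arsinhCoord u a (0, x)
  have h1 : ‖A - B‖ₑ ≤ ∫⁻ r in Set.Icc (-T) T, ‖dt (arsinhCoord u a) (r, x)‖ₑ * 1 := by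
    rw [hftc, ← ofReal_norm, intervalIntegral.norm_integral_eq_norm_integral_uIoc, ofReal_norm]
    refine (enorm_integral_le_lintegral_enorm _).trans ?_
    simp only [mul_one]
    refine lintegral_mono_set fun r hr => ?_
    rcases Set.mem_uIoc.1 hr with hr | hr
    · exact ⟨by linarith [abs_nonneg t], by linarith [le_abs_self t]⟩
    · exact ⟨by linarith [neg_abs_le t], by linarith [abs_nonneg t]⟩
  have h2 : ‖A - B‖ₑ ^ 2 ≤ ENNReal.ofReal (2 * T) *
      ∫⁻ r in Set.Icc (-T) T, ENNReal.ofReal (lorNormSq (dt u (r, x))) := by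
    calc _ ≤ _ := pow_le_pow_left' h1 2
      _ ≤ _ := sq_lintegral_mul_le hdc.measurable.enorm.aemeasurable aemeasurable_const
      _ ≤ _ := by
        rw [mul_comm]
        refine mul_le_mul' ?_ (lintegral_mono fun r => ?_)
        · simp only [one_pow, lintegral_const, Measure.restrict_apply_univ, one_mul, Real.volume_Icc]
          exact ENNReal.ofReal_le_ofReal (by linarith)
        · rw [← ofReal_norm, ← ENNReal.ofReal_pow (norm_nonneg _), Real.norm_eq_abs, sq_abs]
          exact ENNReal.ofReal_le_ofReal (h.dt_arsinhCoord_sq_le a (r, x))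
  have h3 : ‖A‖ₑ ^ 2 ≤ 2 * ‖B‖ₑ ^ 2 + 2 * ‖A - B‖ₑ ^ 2 := by
    have h2' : (2 : ℝ≥0∞) = ENNReal.ofReal 2 := by simp
    simp only [← ofReal_norm, h2']
    rw [← ENNReal.ofReal_pow (norm_nonneg _), ← ENNReal.ofReal_pow (norm_nonneg _),
      ← ENNReal.ofReal_pow (norm_nonneg _), ← ENNReal.ofReal_mul (by norm_num),
      ← ENNReal.ofReal_mul (by norm_num), ← ENNReal.ofReal_add (by positivity) (by positivity)]
    refine ENNReal.ofReal_le_ofReal ?_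
    simp only [Real.norm_eq_abs, sq_abs]
    nlinarith [sq_nonneg (A - 2 * B)]
  calc _ ≤ _ := h3
    _ ≤ _ := by rw [mul_assoc]; gcongr

/-- At time `0` the mass suffices: `arsinh² u_a ≤ 2 (√(1 + u_a²) - 1) ≤ 2 (u₀ - 1)`. The increment
is controlled by the slab norm. -/
theorem exists_lintegral_arsinhCoord_le (h : IsSmoothSchrodingerMap u) (hm : mass u 0 < ⊤) {T : ℝ}
    (hs : slabNorm u T < ⊤) : ∃ H : ℝ≥0, ∀ a t, |t| ≤ T →
      ∫⁻ x, ‖arsinhCoord u a (t, x)‖ₑ ^ 2 ≤ H := by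
  have hm' := h.smooth.continuous
  have hc0 : ∀ a, Continuous (arsinhCoord u a) := fun a =>
    (contDiff_arsinhCoord h.smooth a).continuous
  have hdm : Measurable fun z => ENNReal.ofReal (lorNormSq (dt u z)) :=
    (continuous_lorNormSq.comp (contDiff_dt h.smooth).continuous).measurable.ennreal_ofReal
  have hfin : 2 * (2 * mass u 0) + 2 * ENNReal.ofReal (2 * T) * slabNorm u T ≠ ⊤ :=
    ENNReal.add_ne_top.2 ⟨ENNReal.mul_ne_top (by simp) (ENNReal.mul_ne_top (by simp) hm.ne),
      ENNReal.mul_ne_top (ENNReal.mul_ne_top (by simp) ENNReal.ofReal_ne_top) hs.ne⟩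
  refine ⟨ENNReal.toNNReal _, fun a t ht => le_trans ?_ (ENNReal.coe_toNNReal hfin).ge⟩
  calc ∫⁻ x, ‖arsinhCoord u a (t, x)‖ₑ ^ 2
      ≤ ∫⁻ x, (2 * ‖arsinhCoord u a (0, x)‖ₑ ^ 2 + 2 * ENNReal.ofReal (2 * T) *
        ∫⁻ r in Set.Icc (-T) T, ENNReal.ofReal (lorNormSq (dt u (r, x)))) :=
        lintegral_mono fun x => h.enorm_arsinhCoord_sq_le a ht x
    _ = 2 * (∫⁻ x, ‖arsinhCoord u a (0, x)‖ₑ ^ 2) + 2 * ENNReal.ofReal (2 * T) *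
        ∫⁻ x, ∫⁻ r in Set.Icc (-T) T, ENNReal.ofReal (lorNormSq (dt u (r, x))) := by
        have hm1 : Measurable fun x => ‖arsinhCoord u a (0, x)‖ₑ ^ 2 :=
          (continuous_slice (hc0 a) 0).measurable.enorm.pow_const 2
        rw [lintegral_add_left (hm1.const_mul 2), lintegral_const_mul _ hm1, lintegral_const_mul]
        exact hdm.lintegral_prod_left'
    _ ≤ _ := by
        gcongr
        · have h2' : (2 : ℝ≥0∞) = ENNReal.ofReal 2 := by simp
          rw [mass, ← lintegral_const_mul]
          · refine lintegral_mono fun x => ?_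
            rw [h2', ← ofReal_norm, ← ENNReal.ofReal_pow (norm_nonneg _),
              ← ENNReal.ofReal_mul (by norm_num), Real.norm_eq_abs, sq_abs]
            refine ENNReal.ofReal_le_ofReal ((arsinh_sq_le _).trans ?_)
            have : √(1 + u (0, x) a.succ ^ 2) ≤ u (0, x) 0 := by
              have h1 := sq_of_mem (h.mem_hypPlane (0, x))
              rw [Real.sqrt_le_left (h.mem_hypPlane (0, x)).2.le]
              fin_cases a <;> simp <;>
                nlinarith [sq_nonneg (u (0, x) 1), sq_nonneg (u (0, x) 2)]
            linarith
          · exact (((continuous_apply 0).comp (continuous_slice hm' 0)).sub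
              continuous_const).measurable.ennreal_ofReal
        · rw [slabNorm, setLIntegral_slab (measurable_slabDensity h.smooth),
            lintegral_lintegral_swap (f := fun x r => ENNReal.ofReal (lorNormSq (dt u (r, x))))]
          · refine lintegral_mono fun r => lintegral_mono fun x => ENNReal.ofReal_le_ofReal ?_
            linarith [Finset.sum_nonneg fun k (_ : k ∈ Finset.univ) =>
              lorNormSq_nonneg (dx k u (r, x))]
          · exact (hdm.comp measurable_swap).aemeasurable

/-- The `L²` bound on `arsinh u₁`, `arsinh u₂` plays the role that the mass plays at time `0`. It
bounds the measure of `{u₀ ≥ e}`, where Moser–Trudinger controls `u₀²`, and off this set `|u_a|` is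
comparable to `|arsinh u_a|`. -/
theorem exists_lintegral_spatial_sq_le (h : IsSmoothSchrodingerMap u) (hm : mass u 0 < ⊤)
    {C : ℝ≥0} (hE : ∀ t, energy (fun k => dx k u) t ≤ C) {T : ℝ} (hs : slabNorm u T < ⊤) :
    ∃ B : ℝ≥0, ∀ t, |t| ≤ T →
      ∫⁻ x, ENNReal.ofReal (u (t, x) 1 ^ 2 + u (t, x) 2 ^ 2) ≤ B := by
  obtain ⟨H, hH⟩ := h.exists_lintegral_arsinhCoord_le hm hs
  -- Where `u₀ ≥ e` one has `u₁² + u₂² ≥ 3`, so one of the two coordinates is at least `1` in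
  -- absolute value and the density `g` below is at least `δ`.
  set δ : ℝ≥0∞ := ENNReal.ofReal (Real.arsinh 1 ^ 2) with hδ
  have hδ0 : δ ≠ 0 := by
    rw [hδ, Ne, ENNReal.ofReal_eq_zero, not_le]
    have : 0 < Real.arsinh 1 := Real.arsinh_pos_iff.2 one_pos
    positivity
  have hAfin : 2 * (H : ℝ≥0∞) / δ ≠ ⊤ := ENNReal.div_ne_top (ENNReal.mul_ne_top (by simp) (by simp)) hδ0
  obtain ⟨M, hM⟩ := exists_lintegral_rpow_le 2 (2 * (H : ℝ≥0∞) / δ).toNNReal C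
  -- The square of the constant `2 √(1 + y²)` in `abs_le_two_mul_arsinh`, where `√(1 + y²) ≤ u₀ <
  -- e`.
  set e4 : ℝ≥0∞ := ENNReal.ofReal (4 * Real.exp 1 ^ 2) with he4
  have hBfin : (M : ℝ≥0∞) + e4 * (2 * H) ≠ ⊤ :=
    ENNReal.add_ne_top.2 ⟨by simp, ENNReal.mul_ne_top ENNReal.ofReal_ne_top (ENNReal.mul_ne_top (by simp) (by simp))⟩
  refine ⟨ENNReal.toNNReal _, fun t ht => le_trans ?_ (ENNReal.coe_toNNReal hBfin).ge⟩
  have hcont : Continuous fun x => u (t, x) := continuous_slice h.smooth.continuous t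
  have hc0 : Continuous fun x => u (t, x) 0 := (continuous_apply 0).comp hcont
  have hS : MeasurableSet {x | Real.exp 1 ≤ u (t, x) 0} :=
    measurableSet_le measurable_const hc0.measurable
  set g : Plane → ℝ≥0∞ := fun x => ‖arsinhCoord u 0 (t, x)‖ₑ ^ 2 + ‖arsinhCoord u 1 (t, x)‖ₑ ^ 2
    with hg
  have hgmeas : Measurable g := by
    have h1 := (contDiff_arsinhCoord h.smooth 0).continuous
    have h2 := (contDiff_arsinhCoord h.smooth 1).continuous
    fun_prop
  have hgm : ∀ a, Measurable fun x => ‖arsinhCoord u a (t, x)‖ₑ ^ 2 := fun a =>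
    (continuous_slice (contDiff_arsinhCoord h.smooth a).continuous t).measurable.enorm.pow_const 2
  have hgle : ∫⁻ x, g x ≤ 2 * H := by
    rw [hg, lintegral_add_left (hgm 0), two_mul]
    exact add_le_add (hH 0 t ht) (hH 1 t ht)
  have hgeq : ∀ x, g x = ENNReal.ofReal
      (Real.arsinh (u (t, x) 1) ^ 2 + Real.arsinh (u (t, x) 2) ^ 2) := fun x => by
    simp only [hg, ← ofReal_norm]
    rw [← ENNReal.ofReal_pow (norm_nonneg _), ← ENNReal.ofReal_pow (norm_nonneg _),
      ← ENNReal.ofReal_add (by positivity) (by positivity)]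
    simp [arsinhCoord]
  have hvol : volume {x | Real.exp 1 ≤ u (t, x) 0} ≤ (2 * (H : ℝ≥0∞) / δ).toNNReal := by
    rw [ENNReal.coe_toNNReal hAfin]
    calc _ ≤ volume {x | δ ≤ g x} := measure_mono fun x hx => by
          have hx' : Real.exp 1 ≤ u (t, x) 0 := hx
          have h2 : (2 : ℝ) ≤ Real.exp 1 := by linarith [Real.add_one_le_exp 1]
          have h1 := sq_of_mem (h.mem_hypPlane (t, x))
          change δ ≤ g x
          rw [hgeq]
          refine ENNReal.ofReal_le_ofReal ?_
          have key : ∀ y : ℝ, 1 ≤ y ^ 2 → Real.arsinh 1 ^ 2 ≤ Real.arsinh y ^ 2 := by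
            intro y hy
            have hy' : 1 ≤ |y| := by rwa [one_le_sq_iff_one_le_abs] at hy
            rw [sq_le_sq, abs_of_pos (Real.arsinh_pos_iff.2 one_pos)]
            rcases le_total 0 y with h0 | h0
            · rw [abs_of_nonneg h0] at hy'
              exact (Real.arsinh_le_arsinh.2 hy').trans (le_abs_self _)
            · rw [abs_of_nonpos h0] at hy'
              refine (Real.arsinh_le_arsinh.2 hy').trans ?_
              rw [Real.arsinh_neg]
              exact neg_le_abs _
          by_cases hy : 1 ≤ u (t, x) 1 ^ 2
          · linarith [key _ hy, sq_nonneg (Real.arsinh (u (t, x) 2))]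
          · have : 1 ≤ u (t, x) 2 ^ 2 := by nlinarith
            linarith [key _ this, sq_nonneg (Real.arsinh (u (t, x) 1))]
      _ ≤ (∫⁻ x, g x) / δ :=
        meas_ge_le_lintegral_div hgmeas.aemeasurable hδ0 ENNReal.ofReal_ne_top
      _ ≤ _ := by gcongr
  have hlarge := hM (fun x => u (t, x)) (contDiff_slice h.smooth t) (fun x => h.mem_hypPlane _)
    hvol (hE t)
  calc ∫⁻ x, ENNReal.ofReal (u (t, x) 1 ^ 2 + u (t, x) 2 ^ 2)
      ≤ ∫⁻ x, (Set.indicator {x | Real.exp 1 ≤ u (t, x) 0}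
          (fun x => ENNReal.ofReal (u (t, x) 0 ^ (2 : ℝ))) x + e4 * g x) := by
        refine lintegral_mono fun x => ?_
        have h1 := sq_of_mem (h.mem_hypPlane (t, x))
        have h0 := one_le_of_mem (h.mem_hypPlane (t, x))
        by_cases hx : Real.exp 1 ≤ u (t, x) 0
        · rw [Set.indicator_of_mem (by exact hx)]
          refine le_add_right (ENNReal.ofReal_le_ofReal ?_)
          rw [Real.rpow_two]
          linarith
        · rw [Set.indicator_of_notMem (by exact hx), zero_add, hgeq, he4,
            ← ENNReal.ofReal_mul (by positivity)]
          refine ENNReal.ofReal_le_ofReal ?_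
          have key : ∀ y : ℝ, 1 + y ^ 2 ≤ u (t, x) 0 ^ 2 →
              y ^ 2 ≤ 4 * Real.exp 1 ^ 2 * Real.arsinh y ^ 2 := by
            intro y hy
            have h2 := abs_le_two_mul_arsinh y
            have h3 : √(1 + y ^ 2) ≤ Real.exp 1 := by
              rw [Real.sqrt_le_left (Real.exp_pos 1).le]
              exact hy.trans (pow_le_pow_left₀ (by linarith) (not_le.1 hx).le 2)
            have h4 : |y| ≤ 2 * Real.exp 1 * |Real.arsinh y| := h2.trans (by gcongr)
            calc y ^ 2 = |y| ^ 2 := (sq_abs y).symm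
              _ ≤ (2 * Real.exp 1 * |Real.arsinh y|) ^ 2 := by gcongr
              _ = _ := by rw [mul_pow, mul_pow, sq_abs]; ring
          have k1 := key (u (t, x) 1) (by nlinarith [sq_nonneg (u (t, x) 2)])
          have k2 := key (u (t, x) 2) (by nlinarith [sq_nonneg (u (t, x) 1)])
          linarith
    _ = (∫⁻ x in {x | Real.exp 1 ≤ u (t, x) 0}, ENNReal.ofReal (u (t, x) 0 ^ (2 : ℝ)))
          + e4 * ∫⁻ x, g x := by
        rw [lintegral_add_right _ (hgmeas.const_mul _), lintegral_indicator hS,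
          lintegral_const_mul _ hgmeas]
    _ ≤ _ := by gcongr

end Displacement

/-- Mass flux is not controlled by the slab norm alone: `abs_cross_zero_le` also needs `u₁² + u₂²`,
which the preceding bound integrates over the slab. That bound uses the energy at all times, so
energy has to be propagated before mass. -/
theorem mass_le_mass_zero (h : IsSmoothSchrodingerMap u) (hm : mass u 0 < ⊤) {C : ℝ≥0}
    (hE : ∀ t, energy (fun k => dx k u) t ≤ C) (hs : ∀ T, slabNorm u T < ⊤) (t : ℝ) :
    mass u t ≤ mass u 0 := by
  refine lintegral_le_of_conservation (f := fun z => u z 0 - 1) (J := fun k z => flux u k z 0)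
    (contDiff_mass h.smooth) (fun k => contDiff_pi.1 (contDiff_flux h.smooth k) 0)
    (fun z => by linarith [one_le_of_mem (h.mem_hypPlane z)]) h.dt_mass (fun T => ?_) t
  obtain ⟨B, hB⟩ := h.exists_lintegral_spatial_sq_le hm hE (hs T)
  have hc := h.smooth.continuous
  have hm2 : Measurable fun z => ENNReal.ofReal (u z 1 ^ 2 + u z 2 ^ 2) := by
    have h1 : Continuous fun z => u z 1 := (continuous_apply 1).comp hc
    have h2 : Continuous fun z => u z 2 := (continuous_apply 2).comp hc
    fun_prop
  have hfin : slabNorm u T + 2 * (B * ENNReal.ofReal (2 * T)) ≠ ⊤ :=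
    ENNReal.add_ne_top.2 ⟨(hs T).ne, ENNReal.mul_ne_top (by simp) (ENNReal.mul_ne_top (by simp)
      ENNReal.ofReal_ne_top)⟩
  refine ne_top_of_le_ne_top hfin ?_
  calc _ ≤ ∫⁻ z in Set.Icc (-T) T ×ˢ (Set.univ : Set Plane),
        (ENNReal.ofReal (lorNormSq (dt u z) + ∑ k : Fin 2, lorNormSq (dx k u z))
          + 2 * ENNReal.ofReal (u z 1 ^ 2 + u z 2 ^ 2)) := by
        refine lintegral_mono fun z => ?_
        have h2 : (2 : ℝ≥0∞) = ENNReal.ofReal 2 := by simp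
        have hk : ∀ k, ‖flux u k z 0‖ ≤ lorNormSq (dx k u z) + (u z 1 ^ 2 + u z 2 ^ 2) := fun k => by
          have := abs_cross_zero_le (h.mem_hypPlane z) (h.lor_dx k z)
          rw [flux, eta_apply_zero, norm_neg]
          exact this
        have hdn := lorNormSq_nonneg (dt u z)
        have hsn := Finset.sum_nonneg fun k (_ : k ∈ Finset.univ) => lorNormSq_nonneg (dx k u z)
        rw [h2, ← ENNReal.ofReal_mul (by norm_num), ← ENNReal.ofReal_add (by positivity)
          (by positivity), Fin.sum_univ_two, ← ofReal_norm, ← ofReal_norm,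
          ← ENNReal.ofReal_add (norm_nonneg _) (norm_nonneg _)]
        refine ENNReal.ofReal_le_ofReal ?_
        rw [Fin.sum_univ_two]
        linarith [hk 0, hk 1]
    _ = slabNorm u T + 2 * ∫⁻ r in Set.Icc (-T) T, ∫⁻ x,
          ENNReal.ofReal (u (r, x) 1 ^ 2 + u (r, x) 2 ^ 2) := by
        rw [lintegral_add_left (measurable_slabDensity h.smooth), lintegral_const_mul _ hm2,
          setLIntegral_slab hm2]
        rfl
    _ ≤ slabNorm u T + 2 * ∫⁻ r in Set.Icc (-T) T, B := by
        exact add_le_add le_rfl (mul_le_mul' le_rfl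
          (setLIntegral_mono' measurableSet_Icc fun r hr => hB r (abs_le.2 hr)))
    _ ≤ _ := by
        rw [lintegral_const, Measure.restrict_apply_univ, Real.volume_Icc]
        gcongr
        linarith

/-- At each time, a smooth Schrödinger map satisfying the bounds is a map of the plane with energy
and mass at most `C`. -/
theorem isSlice (h : IsSmoothSchrodingerMap u) {C : ℝ≥0} (hb : HasBounds C u) (t : ℝ) :
    IsSlice C (fun x => u (t, x)) := by
  have key : energy (fun k => dx k u) t ≤ C ∧ mass u t ≤ C := by
    rcases hb with hb | ⟨hE, hM, hs⟩
    · exact hb t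
    · have hE' : ∀ t, energy (fun k => dx k u) t ≤ C := fun t =>
        (h.energy_le_energy_zero hs t).trans hE
      exact ⟨hE' t, (h.mass_le_mass_zero (hM.trans_lt (by simp)) hE' hs t).trans hM⟩
  exact ⟨contDiff_slice h.smooth t, fun x => h.mem_hypPlane _, key.1, key.2⟩

end IsSmoothSchrodingerMap

/-! ### Compactness of equi-Lipschitz families -/

/-- Diagonal extraction for countably many bounded equi-Lipschitz families. -/
theorem exists_subseq_tendsto_of_lipschitz {X E : Type*} [PseudoMetricSpace X]
    [TopologicalSpace.SeparableSpace X] [Nonempty X] [NormedAddCommGroup E] [ProperSpace E]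
    {Φ : ℕ → ℕ → X → E} {B Λ : ℕ → ℝ} (hB : ∀ k n z, ‖Φ k n z‖ ≤ B n)
    (hΛ : ∀ k n z z', dist (Φ k n z) (Φ k n z') ≤ Λ n * dist z z') :
    ∃ σ : ℕ → ℕ, StrictMono σ ∧ ∀ n z, ∃ l, Tendsto (fun k => Φ (σ k) n z) atTop (𝓝 l) := by
  set D := TopologicalSpace.denseSeq X
  -- The values at all points of a countable dense set and for all indices `n` lie in a countable
  -- product of closed balls. Sequential compactness of this product replaces the diagonal argument.
  have hK : IsCompact (Set.pi Set.univ fun i : ℕ × ℕ => Metric.closedBall (0 : E) (B i.1)) :=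
    isCompact_univ_pi fun i => isCompact_closedBall _ _
  obtain ⟨l, -, σ, hσ, hl⟩ := hK.tendsto_subseq (x := fun k (i : ℕ × ℕ) => Φ k i.1 (D i.2))
    fun k i _ => by simpa using hB k i.1 (D i.2)
  refine ⟨σ, hσ, fun n z => cauchySeq_tendsto_of_complete ?_⟩
  rw [tendsto_pi_nhds] at hl
  refine Metric.cauchySeq_iff'.2 fun ε hε => ?_
  have hL : 0 < |Λ n| + 1 := by positivity
  obtain ⟨x, hx, i, rfl⟩ := (TopologicalSpace.denseRange_denseSeq X).exists_mem_open
    (Metric.isOpen_ball (x := z) (ε := ε / (4 * (|Λ n| + 1)))) ⟨z, Metric.mem_ball_self (by positivity)⟩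
    |>.elim fun i hi => (⟨D i, hi, i, rfl⟩ : ∃ x, x ∈ Metric.ball z (ε / (4 * (|Λ n| + 1))) ∧ ∃ i, D i = x)
  have hnear : ∀ k, dist (Φ k n z) (Φ k n (D i)) ≤ ε / 4 := fun k => by
    refine (hΛ k n z (D i)).trans ?_
    rw [Metric.mem_ball, dist_comm] at hx
    calc Λ n * dist z (D i) ≤ (|Λ n| + 1) * (ε / (4 * (|Λ n| + 1))) := by
          gcongr
          linarith [le_abs_self (Λ n)]
      _ = ε / 4 := by field_simp
  obtain ⟨N, hN⟩ := Metric.cauchySeq_iff'.1 (hl (n, i)).cauchySeq (ε / 4) (by positivity)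
  refine ⟨N, fun k hk => ?_⟩
  have h1 := hnear (σ k)
  have h2 := hnear (σ N)
  have h3 : dist (Φ (σ k) n (D i)) (Φ (σ N) n (D i)) < ε / 4 := hN k hk
  rw [dist_comm] at h2
  calc _ ≤ dist (Φ (σ k) n z) (Φ (σ k) n (D i)) + dist (Φ (σ k) n (D i)) (Φ (σ N) n (D i))
        + dist (Φ (σ N) n (D i)) (Φ (σ N) n z) := dist_triangle4 _ _ _ _
    _ < ε := by linarith

theorem tendsto_ofReal_one_div (A : ℝ≥0) :
    Tendsto (fun n : ℕ => ENNReal.ofReal (1 / (n + 1)) * A) atTop (𝓝 0) := by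
  have h : Tendsto (fun n : ℕ => ENNReal.ofReal (1 / (n + 1))) atTop (𝓝 (ENNReal.ofReal 0)) :=
    ENNReal.tendsto_ofReal tendsto_one_div_add_atTop_nhds_zero_nat
  simpa using ENNReal.Tendsto.mul_const h (Or.inr (ENNReal.coe_ne_top (r := A)))

theorem lintegral_enorm_sub_le {α E : Type*} [MeasurableSpace α] [NormedAddCommGroup E]
    {μ : Measure α} {f g h : α → E}
    (hfg : AEMeasurable (fun x => ‖f x - g x‖ₑ) μ) :
    ∫⁻ x, ‖f x - h x‖ₑ ∂μ ≤ ∫⁻ x, ‖f x - g x‖ₑ ∂μ + ∫⁻ x, ‖g x - h x‖ₑ ∂μ := by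
  rw [← lintegral_add_left' hfg]
  refine lintegral_mono fun x => ?_
  rw [← sub_add_sub_cancel (f x) (g x) (h x)]
  exact enorm_add_le _ _

/-- An Aubin–Lions type compactness principle: a sequence `w` on space-time with regularizations
that are equi-Lipschitz on space-time and approximate `w` in `L¹_loc` uniformly in time has a
subsequence converging in `L¹_loc` at every time. -/
theorem exists_subseq_tendsto_of_regularization {E : Type*} [NormedAddCommGroup E]
    [ProperSpace E] {w : ℕ → SpaceTime → E} (hw : ∀ k, Continuous (w k))
    {Φ : ℕ → ℕ → SpaceTime → E} {B Λ : ℕ → ℝ} (hB : ∀ k n z, ‖Φ k n z‖ ≤ B n)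
    (hΛ : ∀ k n z z', dist (Φ k n z) (Φ k n z') ≤ Λ n * dist z z')
    {A : ℝ → ℝ≥0} (hA : ∀ R k n t, ∫⁻ x in Metric.ball (0 : Plane) R,
      ‖Φ k n (t, x) - w k (t, x)‖ₑ ≤ ENNReal.ofReal (1 / (n + 1)) * A R) :
    ∃ σ : ℕ → ℕ, ∃ v : SpaceTime → E, StrictMono σ ∧ StronglyMeasurable v ∧
      (∀ t R, Tendsto (fun k => ∫⁻ x in Metric.ball (0 : Plane) R, ‖w (σ k) (t, x) - v (t, x)‖ₑ)
        atTop (𝓝 0)) ∧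
      ∀ t R, Tendsto (fun s => ∫⁻ x in Metric.ball (0 : Plane) R, ‖v (s, x) - v (t, x)‖ₑ)
        (𝓝 t) (𝓝 0) := by
  obtain ⟨σ, hσ, hlim⟩ := exists_subseq_tendsto_of_lipschitz hB hΛ
  choose V hV using hlim
  have hcont : ∀ k n, Continuous (Φ k n) := fun k n => by
    refine (LipschitzWith.of_dist_le_mul (K := (Λ n).toNNReal) fun z z' => ?_).continuous
    refine (hΛ k n z z').trans ?_
    gcongr
    exact Real.le_coe_toNNReal _
  have hVlip : ∀ n z z', dist (V n z) (V n z') ≤ Λ n * dist z z' := fun n z z' =>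
    le_of_tendsto ((hV n z).dist (hV n z')) (Eventually.of_forall fun k => hΛ _ _ _ _)
  have hVcont : ∀ n, Continuous (V n) := fun n => by
    refine (LipschitzWith.of_dist_le_mul (K := (Λ n).toNNReal) fun z z' => ?_).continuous
    refine (hVlip n z z').trans ?_
    gcongr
    exact Real.le_coe_toNNReal _
  have hVB : ∀ n z, ‖V n z‖ ≤ B n := fun n z =>
    le_of_tendsto (hV n z).norm (Eventually.of_forall fun k => hB _ _ _)
  borelize E
  -- convergence of the regularizations at each time
  have hΦV : ∀ n t R, Tendsto (fun k => ∫⁻ x in Metric.ball (0 : Plane) R,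
      ‖Φ (σ k) n (t, x) - V n (t, x)‖ₑ) atTop (𝓝 0) := by
    intro n t R
    have := tendsto_lintegral_of_dominated_convergence
      (μ := volume.restrict (Metric.ball (0 : Plane) R))
      (F := fun k x => ‖Φ (σ k) n (t, x) - V n (t, x)‖ₑ) (f := fun _ => 0)
      (fun _ => ENNReal.ofReal (B n + B n))
      (fun k => ((continuous_slice (hcont (σ k) n) t).sub
        (continuous_slice (hVcont n) t)).enorm.measurable)
      (fun k => Eventually.of_forall fun x => by
        beta_reduce
        rw [← ofReal_norm]
        exact ENNReal.ofReal_le_ofReal ((norm_sub_le _ _).trans (add_le_add (hB _ _ _) (hVB _ _))))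
      (by
        rw [lintegral_const, Measure.restrict_apply_univ]
        exact ENNReal.mul_ne_top ENNReal.ofReal_ne_top measure_ball_lt_top.ne)
      (Eventually.of_forall fun x => by
        have := ((hV n (t, x)).sub_const (V n (t, x))).enorm
        simpa using this)
    simpa using this
  have hmeasΦw : ∀ k n t, Measurable fun x => ‖Φ k n (t, x) - w k (t, x)‖ₑ := fun k n t =>
    ((continuous_slice (hcont k n) t).sub (continuous_slice (hw k) t)).enorm.measurable
  -- the regularized limits are Cauchy in `L¹_loc`
  have hVV : ∀ R n m t, ∫⁻ x in Metric.ball (0 : Plane) R, ‖V n (t, x) - V m (t, x)‖ₑ ≤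
      ENNReal.ofReal (1 / (n + 1)) * A R + ENNReal.ofReal (1 / (m + 1)) * A R := by
    intro R n m t
    have hle : ∀ k, ∫⁻ x in Metric.ball (0 : Plane) R, ‖V n (t, x) - V m (t, x)‖ₑ ≤
        (∫⁻ x in Metric.ball (0 : Plane) R, ‖Φ (σ k) n (t, x) - V n (t, x)‖ₑ)
        + (ENNReal.ofReal (1 / (n + 1)) * A R + (ENNReal.ofReal (1 / (m + 1)) * A R
        + ∫⁻ x in Metric.ball (0 : Plane) R, ‖Φ (σ k) m (t, x) - V m (t, x)‖ₑ)) := by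
      intro k
      refine (lintegral_enorm_sub_le (g := fun x => Φ (σ k) n (t, x)) ?_).trans
        (add_le_add (le_of_eq (lintegral_congr fun x => enorm_sub_rev _ _)) ?_)
      · exact ((continuous_slice (hVcont n) t).sub
          (continuous_slice (hcont (σ k) n) t)).enorm.measurable.aemeasurable
      refine (lintegral_enorm_sub_le (g := fun x => w (σ k) (t, x))
        (hmeasΦw _ _ _).aemeasurable).trans (add_le_add (hA _ _ _ _) ?_)
      refine (lintegral_enorm_sub_le (g := fun x => Φ (σ k) m (t, x)) ?_).trans
        (add_le_add_left ?_ _)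
      · exact ((continuous_slice (hw (σ k)) t).sub
          (continuous_slice (hcont (σ k) m) t)).enorm.measurable.aemeasurable
      · exact (le_of_eq (lintegral_congr fun x => enorm_sub_rev _ _)).trans (hA R (σ k) m t)
    have := (hΦV n t R).add (tendsto_const_nhds (x := ENNReal.ofReal (1 / (n + 1)) * A R) |>.add
      (tendsto_const_nhds (x := ENNReal.ofReal (1 / (m + 1)) * A R) |>.add (hΦV m t R)))
    simpa using le_of_tendsto_of_tendsto' tendsto_const_nhds this hle
  -- Along the scales `2ⁱ` the approximation errors are summable, so the limit exists almost
  -- everywhere at every time. Taking `limUnder` of continuous functions makes `v` jointly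
  -- measurable.
  set v : SpaceTime → E := fun z => limUnder atTop fun i : ℕ => V (2 ^ i) z with hv
  have hvm : StronglyMeasurable v :=
    StronglyMeasurable.limUnder fun i => (hVcont (2 ^ i)).stronglyMeasurable
  have hae : ∀ t, ∀ᵐ x, Tendsto (fun i : ℕ => V (2 ^ i) (t, x)) atTop (𝓝 (v (t, x))) := by
    intro t
    have hball : ∀ N : ℕ, ∀ᵐ x ∂(volume.restrict (Metric.ball (0 : Plane) N)),
        ∃ l, Tendsto (fun i : ℕ => V (2 ^ i) (t, x)) atTop (𝓝 l) := by
      intro N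
      -- The `+ 1` makes the Cauchy bound strict even when `A N = 0`.
      refine Lp.ae_tendsto_of_cauchy_eLpNorm (p := 1) (B := fun i => ENNReal.ofReal
        ((1 / 2) ^ i) * (2 * A N + 1 : ℝ≥0)) (fun i => (continuous_slice (hVcont _) t).aestronglyMeasurable)
        le_rfl ?_ ?_
      · rw [ENNReal.tsum_mul_right, ← ENNReal.ofReal_tsum_of_nonneg (fun i => by positivity)
          summable_geometric_two]
        exact ENNReal.mul_ne_top ENNReal.ofReal_ne_top ENNReal.coe_ne_top
      · intro N' n m hn hm
        have hp : ∀ j, N' ≤ j → 1 / (((2 ^ j : ℕ) : ℝ) + 1) ≤ (1 / 2) ^ N' := fun j hj => by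
          rw [one_div_pow]
          refine one_div_le_one_div_of_le (by positivity) ?_
          push_cast
          have : (2 : ℝ) ^ N' ≤ 2 ^ j := pow_le_pow_right₀ (by norm_num) hj
          linarith
        rw [eLpNorm_one_eq_lintegral_enorm]
        refine (hVV N (2 ^ n) (2 ^ m) t).trans_lt ?_
        calc _ ≤ ENNReal.ofReal ((1 / 2) ^ N') * A N + ENNReal.ofReal ((1 / 2) ^ N') * A N := by
              gcongr
              · exact hp n hn
              · exact hp m hm
          _ = ENNReal.ofReal ((1 / 2) ^ N') * (2 * A N : ℝ≥0) := by push_cast; ring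
          _ < _ := by
            refine (ENNReal.mul_lt_mul_iff_right ?_ ENNReal.ofReal_ne_top).2 ?_
            · rw [Ne, ENNReal.ofReal_eq_zero, not_le]; positivity
            · rw [ENNReal.coe_lt_coe]
              exact lt_add_one _
    have hall : ∀ᵐ x, ∀ N : ℕ, x ∈ Metric.ball (0 : Plane) N →
        ∃ l, Tendsto (fun i : ℕ => V (2 ^ i) (t, x)) atTop (𝓝 l) :=
      ae_all_iff.2 fun N => (ae_restrict_iff' measurableSet_ball).1 (hball N)
    filter_upwards [hall] with x hx
    obtain ⟨N, hN⟩ := exists_nat_gt ‖x‖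
    exact tendsto_nhds_limUnder (hx N (by simpa using hN))
  have hvt : ∀ t, StronglyMeasurable fun x => v (t, x) := fun t =>
    hvm.comp_measurable (by fun_prop)
  have hVv : ∀ R n t, ∫⁻ x in Metric.ball (0 : Plane) R, ‖V n (t, x) - v (t, x)‖ₑ ≤
      ENNReal.ofReal (1 / (n + 1)) * A R := by
    intro R n t
    calc _ = ∫⁻ x in Metric.ball (0 : Plane) R,
          liminf (fun i : ℕ => ‖V n (t, x) - V (2 ^ i) (t, x)‖ₑ) atTop := by
          refine lintegral_congr_ae ?_
          filter_upwards [ae_restrict_of_ae (hae t)] with x hx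
          exact ((hx.const_sub (V n (t, x))).enorm.liminf_eq).symm
      _ ≤ liminf (fun i : ℕ => ∫⁻ x in Metric.ball (0 : Plane) R,
          ‖V n (t, x) - V (2 ^ i) (t, x)‖ₑ) atTop :=
          lintegral_liminf_le fun i => ((continuous_slice (hVcont n) t).sub
            (continuous_slice (hVcont _) t)).enorm.measurable
      _ ≤ liminf (fun i : ℕ => ENNReal.ofReal (1 / (n + 1)) * A R
            + ENNReal.ofReal (1 / ((2 ^ i : ℕ) + 1)) * A R) atTop :=
          liminf_le_liminf (Eventually.of_forall fun i => hVV R n (2 ^ i) t)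
      _ = _ := by
          have h2 : Tendsto (fun i : ℕ => 2 ^ i) atTop atTop :=
            tendsto_pow_atTop_atTop_of_one_lt one_lt_two
          have := (tendsto_const_nhds (x := ENNReal.ofReal (1 / (n + 1)) * A R)).add
            ((tendsto_ofReal_one_div (A R)).comp h2)
          rw [add_zero] at this
          exact this.liminf_eq
  refine ⟨σ, v, hσ, hvm, fun t R => ?_, fun t R => ?_⟩
  · refine ENNReal.tendsto_nhds_zero.2 fun ε hε => ?_
    have h1 : ∀ᶠ n : ℕ in atTop, ENNReal.ofReal (1 / (n + 1)) * A R ≤ ε / 3 :=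
      ENNReal.tendsto_nhds_zero.1 (tendsto_ofReal_one_div (A R)) _ (ENNReal.div_pos hε.ne' (by simp))
    obtain ⟨n, hn⟩ := h1.exists
    filter_upwards [ENNReal.tendsto_nhds_zero.1 (hΦV n t R) (ε / 3)
      (ENNReal.div_pos hε.ne' (by simp))] with k hk
    calc _ ≤ (∫⁻ x in Metric.ball (0 : Plane) R, ‖w (σ k) (t, x) - Φ (σ k) n (t, x)‖ₑ)
          + ((∫⁻ x in Metric.ball (0 : Plane) R, ‖Φ (σ k) n (t, x) - V n (t, x)‖ₑ)
          + ∫⁻ x in Metric.ball (0 : Plane) R, ‖V n (t, x) - v (t, x)‖ₑ) := by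
          refine (lintegral_enorm_sub_le (g := fun x => Φ (σ k) n (t, x)) ?_).trans
            (add_le_add_right (lintegral_enorm_sub_le (g := fun x => V n (t, x)) ?_) _)
          · exact ((continuous_slice (hw (σ k)) t).sub
              (continuous_slice (hcont (σ k) n) t)).enorm.measurable.aemeasurable
          · exact ((continuous_slice (hcont (σ k) n) t).sub
              (continuous_slice (hVcont n) t)).enorm.measurable.aemeasurable
      _ ≤ ε / 3 + (ε / 3 + ε / 3) := by
          refine add_le_add ?_ (add_le_add hk ((hVv R n t).trans hn))
          exact (le_of_eq (lintegral_congr fun x => enorm_sub_rev _ _)).trans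
            ((hA R (σ k) n t).trans hn)
      _ = ε := by rw [← add_assoc, ENNReal.add_thirds]
  · refine ENNReal.tendsto_nhds_zero.2 fun ε hε => ?_
    have h1 : ∀ᶠ n : ℕ in atTop, ENNReal.ofReal (1 / (n + 1)) * A R ≤ ε / 3 :=
      ENNReal.tendsto_nhds_zero.1 (tendsto_ofReal_one_div (A R)) _ (ENNReal.div_pos hε.ne' (by simp))
    obtain ⟨n, hn⟩ := h1.exists
    have h2 : Tendsto (fun s => ∫⁻ x in Metric.ball (0 : Plane) R, ‖V n (s, x) - V n (t, x)‖ₑ)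
        (𝓝 t) (𝓝 0) := by
      have hle : ∀ s, ∫⁻ x in Metric.ball (0 : Plane) R, ‖V n (s, x) - V n (t, x)‖ₑ ≤
          ENNReal.ofReal (Λ n * dist s t) * volume (Metric.ball (0 : Plane) R) := fun s => by
        calc _ ≤ ∫⁻ x in Metric.ball (0 : Plane) R, ENNReal.ofReal (Λ n * dist s t) := by
              refine lintegral_mono fun x => ?_
              rw [← ofReal_norm, ← dist_eq_norm]
              refine ENNReal.ofReal_le_ofReal ((hVlip n _ _).trans_eq ?_)
              rw [Prod.dist_eq]
              simp
          _ = _ := by rw [lintegral_const, Measure.restrict_apply_univ]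
      have hl : Tendsto (fun s => ENNReal.ofReal (Λ n * dist s t)
          * volume (Metric.ball (0 : Plane) R)) (𝓝 t) (𝓝 0) := by
        have h0 : Tendsto (fun s => Λ n * dist s t) (𝓝 t) (𝓝 0) := by
          have : Continuous fun s => Λ n * dist s t := by fun_prop
          simpa using this.tendsto t
        have := ENNReal.Tendsto.mul_const (ENNReal.tendsto_ofReal h0)
          (Or.inr (measure_ball_lt_top (μ := volume) (x := (0 : Plane)) (r := R)).ne)
        simpa using this
      exact tendsto_of_tendsto_of_tendsto_of_le_of_le tendsto_const_nhds hl (fun _ => zero_le) hle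
    filter_upwards [ENNReal.tendsto_nhds_zero.1 h2 (ε / 3)
      (ENNReal.div_pos hε.ne' (by simp))] with s hs
    calc _ ≤ (∫⁻ x in Metric.ball (0 : Plane) R, ‖v (s, x) - V n (s, x)‖ₑ)
          + ((∫⁻ x in Metric.ball (0 : Plane) R, ‖V n (s, x) - V n (t, x)‖ₑ)
          + ∫⁻ x in Metric.ball (0 : Plane) R, ‖V n (t, x) - v (t, x)‖ₑ) := by
          refine (lintegral_enorm_sub_le (g := fun x => V n (s, x)) ?_).trans
            (add_le_add_right (lintegral_enorm_sub_le (g := fun x => V n (t, x)) ?_) _)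
          · exact ((hvt s).sub
              (continuous_slice (hVcont n) s).stronglyMeasurable).enorm.aemeasurable
          · exact ((continuous_slice (hVcont n) s).sub
              (continuous_slice (hVcont n) t)).enorm.measurable.aemeasurable
      _ ≤ ε / 3 + (ε / 3 + ε / 3) := by
          refine add_le_add ?_ (add_le_add hs ((hVv R n t).trans hn))
          exact (le_of_eq (lintegral_congr fun x => enorm_sub_rev _ _)).trans ((hVv R n s).trans hn)
      _ = ε := by rw [← add_assoc, ENNReal.add_thirds]

/-! ### Mollification in space -/

/-- Bumps shrinking to the origin. -/
noncomputable def mollBump (n : ℕ) : ContDiffBump (0 : Plane) :=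
  ⟨1 / (2 * (n + 1)), 1 / (n + 1), by positivity, by
    rw [one_div_lt_one_div (by positivity) (by positivity)]
    have : (0 : ℝ) < n + 1 := by positivity
    linarith⟩

/-- A smooth approximation of the identity. -/
noncomputable def moll (n : ℕ) : Plane → ℝ := (mollBump n).normed volume

/-- The regularization of `f` at scale `1 / (n + 1)`. -/
noncomputable def mollify {F : Type*} [NormedAddCommGroup F] [NormedSpace ℝ F] (n : ℕ)
    (f : Plane → F) (x : Plane) : F := ∫ y, moll n (x - y) • f y

theorem contDiff_moll (n : ℕ) : ContDiff ℝ ∞ (moll n) := (mollBump n).contDiff_normed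

theorem moll_nonneg (n : ℕ) (x : Plane) : 0 ≤ moll n x := (mollBump n).nonneg_normed x

theorem hasCompactSupport_moll (n : ℕ) : HasCompactSupport (moll n) :=
  (mollBump n).hasCompactSupport_normed

theorem integral_moll (n : ℕ) : ∫ x, moll n x = 1 := (mollBump n).integral_normed

theorem one_div_succ_le_one (n : ℕ) : (1 : ℝ) / (n + 1) ≤ 1 := by
  rw [div_le_one (by positivity)]
  have : (0 : ℝ) ≤ n := Nat.cast_nonneg n
  linarith

theorem norm_le_of_mem_tsupport_moll {n : ℕ} {x : Plane} (hx : x ∈ tsupport (moll n)) :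
    ‖x‖ ≤ 1 / (n + 1) := by
  have h : tsupport (moll n) = Metric.closedBall 0 (mollBump n).rOut :=
    (mollBump n).tsupport_normed_eq
  rw [h] at hx
  simpa [mollBump] using hx

theorem lintegral_moll (n : ℕ) : ∫⁻ x, ‖moll n x‖ₑ = 1 := by
  have h : ∀ x, ‖moll n x‖ₑ = ENNReal.ofReal (moll n x) := fun x =>
    Real.enorm_of_nonneg (moll_nonneg n x)
  simp only [h]
  rw [← ofReal_integral_eq_lintegral_ofReal ((contDiff_moll n).continuous.integrable_of_hasCompactSupport
    (hasCompactSupport_moll n)) (Eventually.of_forall (moll_nonneg n)), integral_moll,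
    ENNReal.ofReal_one]

theorem contDiff_moll_sub (n : ℕ) (x : Plane) : ContDiff ℝ ∞ fun y => moll n (x - y) :=
  (contDiff_moll n).comp (contDiff_const.sub contDiff_id)

theorem hasCompactSupport_moll_sub (n : ℕ) (x : Plane) :
    HasCompactSupport fun y => moll n (x - y) :=
  (hasCompactSupport_moll n).comp_homeomorph (Homeomorph.subLeft x)

theorem mem_closedBall_of_mem_tsupport_moll_sub {n : ℕ} {x y : Plane}
    (hy : y ∈ tsupport fun y => moll n (x - y)) : y ∈ Metric.closedBall x 1 := by
  have h : (tsupport fun y => moll n (x - y)) ⊆ Metric.closedBall x 1 := by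
    refine closure_minimal (fun y hy => ?_) Metric.isClosed_closedBall
    have := norm_le_of_mem_tsupport_moll (subset_tsupport _ hy : x - y ∈ tsupport (moll n))
    rw [mem_closedBall_iff_norm', ]
    exact this.trans (one_div_succ_le_one n)
  exact h hy

theorem exists_lipschitz_moll (n : ℕ) : ∃ L : ℝ≥0, LipschitzWith L (moll n) :=
  (contDiff_moll n).lipschitzWith_of_hasCompactSupport (hasCompactSupport_moll n) (by simp)

section Mollify

variable {F : Type*} [NormedAddCommGroup F] [NormedSpace ℝ F] {f : Plane → F}

theorem mollify_eq (n : ℕ) (f : Plane → F) (x : Plane) :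
    mollify n f x = ∫ y, moll n y • f (x - y) := by
  rw [← integral_sub_left_eq_self (fun y => moll n y • f (x - y)) volume x]
  simp [mollify]

theorem enorm_sub_le_lintegral_fderiv [CompleteSpace F] (hf : ContDiff ℝ ∞ f) (x y : Plane) :
    ‖f (x - y) - f x‖ₑ ≤ ‖y‖ₑ * ∫⁻ s in Set.Ioc (0 : ℝ) 1, ‖fderiv ℝ f (x - s • y)‖ₑ := by
  have hd : ∀ s : ℝ, HasDerivAt (fun s : ℝ => f (x - s • y)) (fderiv ℝ f (x - s • y) (-y)) s := by
    intro s
    have h1 : HasDerivAt (fun s : ℝ => x - s • y) (-y) s := by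
      simpa using ((hasDerivAt_id s).smul_const y).const_sub x
    exact (hf.differentiable (by simp) _).hasFDerivAt.comp_hasDerivAt s h1
  have hcD : Continuous fun s : ℝ => fderiv ℝ f (x - s • y) :=
    (hf.continuous_fderiv (by simp)).comp (by fun_prop)
  have hftc := intervalIntegral.integral_eq_sub_of_hasDerivAt (a := 0) (b := 1)
    (fun s _ => hd s) ((hcD.clm_apply continuous_const).intervalIntegrable _ _)
  rw [one_smul, zero_smul, sub_zero] at hftc
  rw [← hftc, intervalIntegral.integral_of_le zero_le_one,
    ← lintegral_const_mul _ hcD.enorm.measurable]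
  refine (enorm_integral_le_lintegral_enorm _).trans (lintegral_mono fun s => ?_)
  rw [mul_comm, ← enorm_neg y]
  exact ContinuousLinearMap.le_opENorm _ _

theorem lintegral_ball_sub_le (g : Plane → ℝ≥0∞) (R : ℝ) {w : Plane} (hw : ‖w‖ ≤ 1) :
    ∫⁻ x in Metric.ball (0 : Plane) R, g (x - w) ≤ ∫⁻ x in Metric.ball (0 : Plane) (R + 1), g x := by
  rw [← lintegral_indicator measurableSet_ball, ← lintegral_indicator measurableSet_ball,
    ← lintegral_sub_right_eq_self ((Metric.ball (0 : Plane) (R + 1)).indicator g) w]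
  refine lintegral_mono fun x => ?_
  by_cases hx : x ∈ Metric.ball (0 : Plane) R
  · have hx' : x - w ∈ Metric.ball (0 : Plane) (R + 1) := by
      rw [mem_ball_zero_iff] at hx ⊢
      linarith [norm_sub_le x w]
    rw [Set.indicator_of_mem hx, Set.indicator_of_mem hx']
  · rw [Set.indicator_of_notMem hx]
    exact zero_le

theorem measurable_lintegral_segment {g : Plane → ℝ≥0∞} (hg : Measurable g) :
    Measurable fun p : Plane × Plane => ∫⁻ s in Set.Ioc (0 : ℝ) 1, g (p.1 - s • p.2) :=
  (hg.comp (by fun_prop : Measurable fun p : (Plane × Plane) × ℝ =>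
    p.1.1 - p.2 • p.1.2)).lintegral_prod_right'

theorem lintegral_ball_segment_le {g : Plane → ℝ≥0∞} (hg : Measurable g) (R : ℝ) {y : Plane}
    (hy : ‖y‖ ≤ 1) : ∫⁻ x in Metric.ball (0 : Plane) R, ∫⁻ s in Set.Ioc (0 : ℝ) 1, g (x - s • y) ≤
      ∫⁻ x in Metric.ball (0 : Plane) (R + 1), g x := by
  have hm : Measurable fun p : Plane × ℝ => g (p.1 - p.2 • y) := hg.comp (by fun_prop)
  rw [lintegral_lintegral_swap (f := fun x s => g (x - s • y)) hm.aemeasurable]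
  calc _ ≤ ∫⁻ s in Set.Ioc (0 : ℝ) 1, ∫⁻ x in Metric.ball (0 : Plane) (R + 1), g x := by
        refine setLIntegral_mono' measurableSet_Ioc fun s hs => lintegral_ball_sub_le g R ?_
        rw [norm_smul, Real.norm_of_nonneg hs.1.le]
        exact mul_le_one₀ hs.2 (norm_nonneg _) hy
    _ = _ := by simp

theorem enorm_mollify_sub_le [CompleteSpace F] (hf : ContDiff ℝ ∞ f) (n : ℕ) (x : Plane) :
    ‖mollify n f x - f x‖ₑ ≤ ∫⁻ y, ENNReal.ofReal (1 / (n + 1)) * (‖moll n y‖ₑ *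
      ∫⁻ s in Set.Ioc (0 : ℝ) 1, ‖fderiv ℝ f (x - s • y)‖ₑ) := by
  have h1 : Integrable fun y => moll n y • f (x - y) :=
    integrable_smul_of_hasCompactSupport (contDiff_moll n).continuous (hasCompactSupport_moll n)
      (hf.continuous.comp (by fun_prop))
  have h2 : Integrable fun y => moll n y • f x :=
    integrable_smul_of_hasCompactSupport (contDiff_moll n).continuous (hasCompactSupport_moll n)
      continuous_const
  have h3 : f x = ∫ y, moll n y • f x := by
    rw [integral_smul_const, integral_moll, one_smul]
  rw [mollify_eq]
  conv_lhs => rw [h3]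
  rw [← integral_sub h1 h2]
  refine (enorm_integral_le_lintegral_enorm _).trans (lintegral_mono fun y => ?_)
  rw [← smul_sub, enorm_smul]
  by_cases hy : y ∈ tsupport (moll n)
  · rw [mul_left_comm]
    refine mul_le_mul' le_rfl ((enorm_sub_le_lintegral_fderiv hf x y).trans ?_)
    refine mul_le_mul' ?_ le_rfl
    rw [← ofReal_norm]
    exact ENNReal.ofReal_le_ofReal (norm_le_of_mem_tsupport_moll hy)
  · simp [image_eq_zero_of_notMem_tsupport hy]

theorem lintegral_moll_segment_le {g : Plane → ℝ≥0∞} (hg : Measurable g) (n : ℕ) (R : ℝ) :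
    ∫⁻ x in Metric.ball (0 : Plane) R, ∫⁻ y, ENNReal.ofReal (1 / (n + 1)) * (‖moll n y‖ₑ *
      ∫⁻ s in Set.Ioc (0 : ℝ) 1, g (x - s • y)) ≤
      ENNReal.ofReal (1 / (n + 1)) * ∫⁻ x in Metric.ball (0 : Plane) (R + 1), g x := by
  have hIm := measurable_lintegral_segment hg
  have hmm : Measurable fun y => ‖moll n y‖ₑ := (contDiff_moll n).continuous.enorm.measurable
  have hm : Measurable fun p : Plane × Plane => ENNReal.ofReal (1 / (n + 1)) * (‖moll n p.2‖ₑ *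
      ∫⁻ s in Set.Ioc (0 : ℝ) 1, g (p.1 - s • p.2)) :=
    ((hmm.comp measurable_snd).mul hIm).const_mul _
  rw [lintegral_lintegral_swap (f := fun x y => ENNReal.ofReal (1 / (n + 1)) * (‖moll n y‖ₑ *
      ∫⁻ s in Set.Ioc (0 : ℝ) 1, g (x - s • y))) hm.aemeasurable]
  calc _ = ∫⁻ y, ENNReal.ofReal (1 / (n + 1)) * (‖moll n y‖ₑ *
          ∫⁻ x in Metric.ball (0 : Plane) R, ∫⁻ s in Set.Ioc (0 : ℝ) 1, g (x - s • y)) := by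
        refine lintegral_congr fun y => ?_
        have hIy := hIm.comp (by fun_prop : Measurable fun x : Plane => (x, y))
        exact (lintegral_const_mul _ (hIy.const_mul _)).trans
          (congrArg _ (lintegral_const_mul _ hIy))
    _ ≤ ∫⁻ y, ENNReal.ofReal (1 / (n + 1)) * (‖moll n y‖ₑ *
          ∫⁻ x in Metric.ball (0 : Plane) (R + 1), g x) := by
        refine lintegral_mono fun y => mul_le_mul' le_rfl ?_
        by_cases hy : y ∈ tsupport (moll n)
        · exact mul_le_mul' le_rfl (lintegral_ball_segment_le hg R
            ((norm_le_of_mem_tsupport_moll hy).trans (one_div_succ_le_one n)))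
        · simp [image_eq_zero_of_notMem_tsupport hy]
    _ = _ := by
        rw [lintegral_const_mul _ (hmm.mul_const _), lintegral_mul_const _ hmm, lintegral_moll, one_mul]

/-- The difference is an average of increments over distances at most `1 / (n + 1)`, each an
integral of the gradient along a segment. The disc grows by `1` because the segments may leave it.
-/
theorem lintegral_enorm_mollify_sub_le [CompleteSpace F] (hf : ContDiff ℝ ∞ f) (n : ℕ) (R : ℝ) :
    ∫⁻ x in Metric.ball (0 : Plane) R, ‖mollify n f x - f x‖ₑ ≤
      ENNReal.ofReal (1 / (n + 1)) * ∫⁻ x in Metric.ball (0 : Plane) (R + 1), ‖fderiv ℝ f x‖ₑ :=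
  (lintegral_mono fun x => enorm_mollify_sub_le hf n x).trans
    (lintegral_moll_segment_le (hf.continuous_fderiv (by simp)).enorm.measurable n R)

theorem integrable_moll_smul (n : ℕ) (hf : Continuous f) (x : Plane) :
    Integrable fun y => moll n (x - y) • f y :=
  integrable_smul_of_hasCompactSupport (contDiff_moll_sub n x).continuous
    (hasCompactSupport_moll_sub n x) hf

/-- Only the `L¹` norm on two unit discs enters. Their measure does not depend on the centres, so
the Lipschitz constant is uniform over the whole plane. -/
theorem dist_mollify_le {n : ℕ} {L : ℝ≥0} (hL : LipschitzWith L (moll n)) (hf : Continuous f)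
    {N : ℝ≥0} (x x' : Plane) (hN : eLpNorm f 1
      (volume.restrict (Metric.closedBall x 1 ∪ Metric.closedBall x' 1)) ≤ N) :
    dist (mollify n f x) (mollify n f x') ≤ L * N * dist x x' := by
  rw [dist_eq_norm, mollify, mollify,
    ← integral_sub (integrable_moll_smul n hf x) (integrable_moll_smul n hf x')]
  have hS : MeasurableSet (Metric.closedBall x 1 ∪ Metric.closedBall x' 1) :=
    measurableSet_closedBall.union measurableSet_closedBall
  have h : ‖∫ y, (moll n (x - y) • f y - moll n (x' - y) • f y)‖ₑ ≤
      ENNReal.ofReal (L * N * dist x x') := by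
    calc _ ≤ ∫⁻ y, ‖moll n (x - y) • f y - moll n (x' - y) • f y‖ₑ :=
          enorm_integral_le_lintegral_enorm _
      _ ≤ ∫⁻ y, Set.indicator (Metric.closedBall x 1 ∪ Metric.closedBall x' 1)
            (fun y => ENNReal.ofReal (L * dist x x') * ‖f y‖ₑ) y := by
          refine lintegral_mono fun y => ?_
          by_cases hy : y ∈ Metric.closedBall x 1 ∪ Metric.closedBall x' 1
          · rw [Set.indicator_of_mem hy, ← sub_smul, enorm_smul, ← ofReal_norm (moll n _ - _)]
            gcongr
            rw [← dist_eq_norm]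
            simpa using hL.dist_le_mul (x - y) (x' - y)
          · have h1 : moll n (x - y) = 0 := by
              by_contra h0
              exact hy (Or.inl (mem_closedBall_of_mem_tsupport_moll_sub
                (subset_tsupport (fun y => moll n (x - y)) h0)))
            have h2 : moll n (x' - y) = 0 := by
              by_contra h0
              exact hy (Or.inr (mem_closedBall_of_mem_tsupport_moll_sub
                (subset_tsupport (fun y => moll n (x' - y)) h0)))
            simp [h1, h2]
      _ ≤ ENNReal.ofReal (L * dist x x') * N := by
          rw [lintegral_indicator hS, lintegral_const_mul _ hf.enorm.measurable]
          rw [eLpNorm_one_eq_lintegral_enorm] at hN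
          gcongr
      _ = _ := by
          rw [mul_right_comm (L : ℝ), ENNReal.ofReal_mul (by positivity) (q := (N : ℝ)),
            ENNReal.ofReal_coe_nnreal]
  rw [← ofReal_norm] at h
  exact (ENNReal.ofReal_le_ofReal_iff (by positivity)).1 h

theorem norm_mollify_le {n : ℕ} {S : ℝ≥0} (hS : ∀ x, ‖moll n x‖ ≤ S) {N : ℝ≥0} (x : Plane)
    (hf : Continuous f) (hN : eLpNorm f 1 (volume.restrict (Metric.closedBall x 1)) ≤ N) :
    ‖mollify n f x‖ ≤ S * N := by
  have h : ‖mollify n f x‖ₑ ≤ ENNReal.ofReal (S * N) := by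
    calc _ ≤ ∫⁻ y, ‖moll n (x - y) • f y‖ₑ := enorm_integral_le_lintegral_enorm _
      _ ≤ ∫⁻ y, Set.indicator (Metric.closedBall x 1) (fun y => (S : ℝ≥0∞) * ‖f y‖ₑ) y := by
          refine lintegral_mono fun y => ?_
          by_cases hy : y ∈ Metric.closedBall x 1
          · rw [Set.indicator_of_mem hy, enorm_smul]
            gcongr
            rw [← ofReal_norm, ENNReal.ofReal_le_iff_le_toReal ENNReal.coe_ne_top]
            exact hS _
          · have h1 : moll n (x - y) = 0 := by
              by_contra h0
              exact hy (mem_closedBall_of_mem_tsupport_moll_sub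
                (subset_tsupport (fun y => moll n (x - y)) h0))
            simp [h1]
      _ ≤ S * N := by
          rw [lintegral_indicator measurableSet_closedBall, lintegral_const_mul _ hf.enorm.measurable]
          rw [eLpNorm_one_eq_lintegral_enorm] at hN
          gcongr
      _ = _ := by
          rw [ENNReal.ofReal_mul (by positivity), ENNReal.ofReal_coe_nnreal,
            ENNReal.ofReal_coe_nnreal]
  rw [← ofReal_norm] at h
  exact (ENNReal.ofReal_le_ofReal_iff (by positivity)).1 h

end Mollify

/-! ### Extraction of the limit -/

/-- The divergence form of the equation is tested with `moll n (x - ·)`: the derivative falls on the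
mollifier, and only the `L¹` norm of `u × ∂ₖ u` on a unit disc is left. The factor `2` counts the
directions. -/
theorem dist_mollify_time_le {u : SpaceTime → Amb} (h : IsSmoothSchrodingerMap u) {n : ℕ}
    {L : ℝ≥0} (hL : LipschitzWith L (moll n)) {B : ℝ≥0} (x : Plane)
    (hB : ∀ t k, eLpNorm (fun y => crossProduct (u (t, y)) (dx k u (t, y))) 1
      (volume.restrict (Metric.closedBall x 1)) ≤ B) (s t : ℝ) :
    dist (mollify n (fun y => u (s, y)) x) (mollify n (fun y => u (t, y)) x) ≤
      2 * L * B * dist s t := by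
  have hcons := integral_smul_sub_eq h.smooth
    (fun k => IsSmoothSchrodingerMap.contDiff_flux h.smooth k) h.dt_eq (contDiff_moll_sub n x)
    (hasCompactSupport_moll_sub n x) t s
  rw [dist_eq_norm, mollify, mollify, hcons, norm_neg]
  refine intervalIntegral.norm_integral_le_of_norm_le_const fun r _ => ?_
  have hlip : LipschitzWith L fun y => moll n (x - y) := by
    refine LipschitzWith.of_dist_le_mul fun y y' => ?_
    rw [← dist_sub_left x y y']
    exact hL.dist_le_mul (x - y) (x - y')
  have hk : ∀ k, ∫⁻ y, ‖partialDeriv k (fun y => moll n (x - y)) y •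
      IsSmoothSchrodingerMap.flux u k (r, y)‖ₑ ≤ L * B := by
    intro k
    calc _ ≤ ∫⁻ y, Set.indicator (Metric.closedBall x 1)
          (fun y => (L : ℝ≥0∞) * ‖crossProduct (u (r, y)) (dx k u (r, y))‖ₑ) y := by
          refine lintegral_mono fun y => ?_
          by_cases hy : y ∈ Metric.closedBall x 1
          · rw [Set.indicator_of_mem hy, enorm_smul]
            refine mul_le_mul' ?_ ?_
            · rw [← ofReal_norm, ENNReal.ofReal_le_iff_le_toReal ENNReal.coe_ne_top]
              refine (ContinuousLinearMap.le_opNorm _ _).trans ?_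
              simpa using norm_fderiv_le_of_lipschitz ℝ hlip
            · rw [← ofReal_norm, ← ofReal_norm, IsSmoothSchrodingerMap.flux, norm_eta]
          · have h1 : y ∉ tsupport fun y => moll n (x - y) := fun h' =>
              hy (mem_closedBall_of_mem_tsupport_moll_sub h')
            simp [partialDeriv, fderiv_of_notMem_tsupport ℝ h1]
      _ ≤ L * B := by
          have hc : Continuous fun y => crossProduct (u (r, y)) (dx k u (r, y)) :=
            (crossL.continuous.comp (continuous_slice h.smooth.continuous r)).clm_apply
              (continuous_slice (contDiff_dx h.smooth k).continuous r)
          rw [lintegral_indicator measurableSet_closedBall, lintegral_const_mul _ hc.enorm.measurable]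
          have := hB r k
          rw [eLpNorm_one_eq_lintegral_enorm] at this
          gcongr
  have h2 : ‖∫ y, ∑ k, partialDeriv k (fun y => moll n (x - y)) y •
      IsSmoothSchrodingerMap.flux u k (r, y)‖ₑ ≤ ENNReal.ofReal (2 * L * B) := by
    calc _ ≤ ∫⁻ y, ‖∑ k, partialDeriv k (fun y => moll n (x - y)) y •
            IsSmoothSchrodingerMap.flux u k (r, y)‖ₑ := enorm_integral_le_lintegral_enorm _
      _ ≤ ∫⁻ y, ∑ k, ‖partialDeriv k (fun y => moll n (x - y)) y •
            IsSmoothSchrodingerMap.flux u k (r, y)‖ₑ := lintegral_mono fun y => enorm_sum_le _ _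
      _ = ∑ k, ∫⁻ y, ‖partialDeriv k (fun y => moll n (x - y)) y •
            IsSmoothSchrodingerMap.flux u k (r, y)‖ₑ := by
          refine lintegral_finsetSum _ fun k _ => ?_
          exact ((continuous_partialDeriv (contDiff_moll_sub n x) k).smul
            (continuous_slice (IsSmoothSchrodingerMap.contDiff_flux h.smooth k).continuous
              r)).enorm.measurable
      _ ≤ ∑ _k : Fin 2, (L * B : ℝ≥0∞) := Finset.sum_le_sum fun k _ => hk k
      _ = _ := by
          rw [mul_assoc, ENNReal.ofReal_mul (by positivity), ENNReal.ofReal_mul (by positivity),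
            ENNReal.ofReal_coe_nnreal, ENNReal.ofReal_coe_nnreal]
          simp
  rw [← ofReal_norm] at h2
  exact (ENNReal.ofReal_le_ofReal_iff (by positivity)).1 h2

theorem enorm_fderiv_le {F : Type*} [NormedAddCommGroup F] [NormedSpace ℝ F] (f : Plane → F)
    (x : Plane) : ‖fderiv ℝ f x‖ₑ ≤ ∑ k, ‖partialDeriv k f x‖ₑ := by
  have h : ‖fderiv ℝ f x‖ ≤ ∑ k, ‖partialDeriv k f x‖ := by
    refine ContinuousLinearMap.opNorm_le_bound _ (Finset.sum_nonneg fun k _ => norm_nonneg _)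
      fun y => ?_
    have hy : fderiv ℝ f x y = ∑ k, y k • partialDeriv k f x := by
      conv_lhs => rw [← (EuclideanSpace.basisFun (Fin 2) ℝ).sum_repr y]
      simp [partialDeriv]
    rw [hy, Finset.sum_mul]
    refine (norm_sum_le _ _).trans (Finset.sum_le_sum fun k _ => ?_)
    rw [norm_smul, mul_comm]
    gcongr
    exact PiLp.norm_apply_le y k
  rw [← ofReal_norm]
  refine (ENNReal.ofReal_le_ofReal h).trans_eq ?_
  rw [ENNReal.ofReal_sum_of_nonneg fun k _ => norm_nonneg _]
  simp

theorem exists_lintegral_fderiv_slice_le (C : ℝ≥0) (R : ℝ) :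
    ∃ A : ℝ≥0, ∀ f, IsSlice C f → ∫⁻ x in Metric.ball (0 : Plane) R, ‖fderiv ℝ f x‖ₑ ≤ A := by
  obtain ⟨B, hB⟩ := IsFieldPair.exists_eLpNorm_field_le C (sliceBound C) (p := 1) (by norm_num)
    (volume (Metric.ball (0 : Plane) R)).toNNReal
  refine ⟨2 * B, fun f hf => ?_⟩
  calc _ ≤ ∫⁻ x in Metric.ball (0 : Plane) R, ∑ k, ‖partialDeriv k f x‖ₑ :=
        lintegral_mono fun x => enorm_fderiv_le f x
    _ = ∑ k, ∫⁻ x in Metric.ball (0 : Plane) R, ‖partialDeriv k f x‖ₑ :=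
        lintegral_finsetSum _ fun k _ => (continuous_partialDeriv hf.smooth k).enorm.measurable
    _ ≤ ∑ _k : Fin 2, (B : ℝ≥0∞) := Finset.sum_le_sum fun k _ => by
        rw [← eLpNorm_one_eq_lintegral_enorm]
        exact hB f _ hf.isFieldPair hf.hasLpBounds _ measurableSet_ball
          (ENNReal.coe_toNNReal measure_ball_lt_top.ne).ge k
    _ = _ := by simp

/-- A sequence of smooth Schrödinger maps with uniform bounds has a subsequence which converges in
`L¹_loc` at each time, locally uniformly in time. -/
theorem exists_subseq_tendsto {C : ℝ≥0} {u : ℕ → SpaceTime → Amb}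
    (hsol : ∀ j, IsSmoothSchrodingerMap (u j)) (hsl : ∀ j t, IsSlice C fun x => u j (t, x)) :
    ∃ σ : ℕ → ℕ, ∃ v : SpaceTime → Amb, StrictMono σ ∧ StronglyMeasurable v ∧
      (∀ t R, Tendsto (fun k => ∫⁻ x in Metric.ball (0 : Plane) R, ‖u (σ k) (t, x) - v (t, x)‖ₑ)
        atTop (𝓝 0)) ∧
      ∀ t R, Tendsto (fun s => ∫⁻ x in Metric.ball (0 : Plane) R, ‖v (s, x) - v (t, x)‖ₑ)
        (𝓝 t) (𝓝 0) := by
  set V : ℝ≥0 := (volume (Metric.closedBall (0 : Plane) 1)).toNNReal with hV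
  have hVx : ∀ x : Plane, volume (Metric.closedBall x 1) = V := fun x => by
    rw [hV, ENNReal.coe_toNNReal measure_closedBall_lt_top.ne, Measure.addHaar_closedBall_center]
  choose L hL using exists_lipschitz_moll
  have hS : ∀ n, ∃ S : ℝ≥0, ∀ x, ‖moll n x‖ ≤ S := fun n => by
    obtain ⟨S, hS⟩ := (contDiff_moll n).continuous.bounded_above_of_compact_support
      (hasCompactSupport_moll n)
    exact ⟨S.toNNReal, fun x => (hS x).trans (Real.le_coe_toNNReal S)⟩
  choose S hS using hS
  obtain ⟨B, hB⟩ := IsFieldPair.exists_eLpNorm_cross_le C (sliceBound C) V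
  choose A hA using exists_lintegral_fderiv_slice_le C
  set N := sliceBound C 1 (2 * V)
  have hN : ∀ j t x x', eLpNorm (fun y => u j (t, y)) 1
      (volume.restrict (Metric.closedBall x 1 ∪ Metric.closedBall x' 1)) ≤ N := fun j t x x' => by
    refine (hsl j t).hasLpBounds 1 (2 * V) _ (by simp)
      (measurableSet_closedBall.union measurableSet_closedBall) ?_
    refine (measure_union_le _ _).trans ?_
    rw [hVx, hVx]
    push_cast
    rw [two_mul]
  have hcont : ∀ j t, Continuous fun x => u j (t, x) := fun j t =>
    continuous_slice (hsol j).smooth.continuous t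
  -- The two terms of `Λ` are the Lipschitz constants in time and in space. The radius `R + 1` in
  -- `A` comes from mollification reaching outside the disc.
  refine exists_subseq_tendsto_of_regularization (fun k => (hsol k).smooth.continuous)
    (Φ := fun k n z => mollify n (fun y => u k (z.1, y)) z.2) (B := fun n => S n * N)
    (Λ := fun n => 2 * L n * B + L n * N) (A := fun R => A (R + 1)) ?_ ?_ ?_
  · intro k n z
    refine norm_mollify_le (hS n) z.2 (hcont k z.1) ?_
    simpa using hN k z.1 z.2 z.2
  · intro k n z z'
    have h1 := dist_mollify_time_le (hsol k) (hL n) (B := B) z.2 (fun t i =>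
      hB _ _ (hsl k t).isFieldPair (hsl k t).hasLpBounds _ measurableSet_closedBall (hVx _).le i)
      z.1 z'.1
    have h2 := dist_mollify_le (hL n) (hcont k z'.1) z.2 z'.2 (hN k z'.1 z.2 z'.2)
    have h3 : dist z.1 z'.1 ≤ dist z z' := le_max_left _ _
    have h4 : dist z.2 z'.2 ≤ dist z z' := le_max_right _ _
    calc _ ≤ _ := dist_triangle _ (mollify n (fun y => u k (z'.1, y)) z.2) _
      _ ≤ 2 * L n * B * dist z.1 z'.1 + L n * N * dist z.2 z'.2 := add_le_add h1 h2
      _ ≤ 2 * L n * B * dist z z' + L n * N * dist z z' := by gcongr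
      _ = _ := by ring
  · intro R k n t
    refine (lintegral_enorm_mollify_sub_le (hsl k t).smooth n R).trans ?_
    gcongr
    exact hA (R + 1) _ (hsl k t)

/-! ### Weak and strong convergence -/

theorem exists_subseq_tendsto_inner {H : Type*} [NormedAddCommGroup H] [InnerProductSpace ℝ H]
    [CompleteSpace H] [TopologicalSpace.SeparableSpace H] {x : ℕ → H} {M : ℝ}
    (hM : ∀ k, ‖x k‖ ≤ M) :
    ∃ y : H, ∃ τ : ℕ → ℕ, StrictMono τ ∧ ‖y‖ ≤ M ∧
      ∀ z, Tendsto (fun k => inner ℝ (x (τ k)) z) atTop (𝓝 (inner ℝ y z)) := by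
  let ξ : ℕ → WeakDual ℝ H := fun k =>
    StrongDual.toWeakDual (InnerProductSpace.toDual ℝ H (x k))
  obtain ⟨η, hη, τ, hτ, hlim⟩ := WeakDual.isSeqCompact_closedBall ℝ H 0 M (x := ξ) fun k => by
    simpa [ξ] using hM k
  refine ⟨(InnerProductSpace.toDual ℝ H).symm (WeakDual.toStrongDual η), τ, hτ, by simpa using hη,
    fun z => ?_⟩
  rw [← InnerProductSpace.toDual_apply_apply, LinearIsometryEquiv.apply_symm_apply]
  exact ((WeakDual.eval_continuous z).tendsto η).comp hlim

theorem tendsto_inner_of_weak_strong {H : Type*} [NormedAddCommGroup H] [InnerProductSpace ℝ H]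
    {x g : ℕ → H} {y h : H} {M : ℝ} (hM : ∀ k, ‖x k‖ ≤ M)
    (hx : ∀ z, Tendsto (fun k => inner ℝ (x k) z) atTop (𝓝 (inner ℝ y z)))
    (hg : Tendsto g atTop (𝓝 h)) :
    Tendsto (fun k => inner ℝ (x k) (g k)) atTop (𝓝 (inner ℝ y h)) := by
  have h1 : Tendsto (fun k => inner ℝ (x k) (g k - h)) atTop (𝓝 0) := by
    refine squeeze_zero_norm (fun k => (norm_inner_le_norm _ _).trans
      (mul_le_mul_of_nonneg_right (hM k) (norm_nonneg _))) ?_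
    simpa using (tendsto_iff_norm_sub_tendsto_zero.1 hg).const_mul M
  simpa [inner_sub_right] using h1.add (hx h)

/-- Interpolation between `L¹` and a larger exponent. -/
theorem tendsto_eLpNorm_of_tendsto_lintegral {α E ι : Type*} [MeasurableSpace α]
    [NormedAddCommGroup E] {μ : Measure α} {l : Filter ι} {g : ι → α → E}
    (hg : ∀ i, AEStronglyMeasurable (g i) μ) {s : ℝ≥0∞} (hs1 : 1 ≤ s) (hs : s ≠ ⊤) {M : ℝ≥0}
    (hM : ∀ i, eLpNorm (g i) (2 * s - 1) μ ≤ M)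
    (h : Tendsto (fun i => ∫⁻ x, ‖g i x‖ₑ ∂μ) l (𝓝 0)) :
    Tendsto (fun i => eLpNorm (g i) s μ) l (𝓝 0) := by
  have hs0 : s ≠ 0 := (one_pos.trans_le hs1).ne'
  set r := s.toReal with hr
  have hr1 : 1 ≤ r := by
    rw [hr, ← ENNReal.toReal_one]
    exact ENNReal.toReal_mono hs hs1
  have hq : (2 * s - 1).toReal = 2 * r - 1 := by
    rw [ENNReal.toReal_sub_of_le (hs1.trans (by rw [two_mul]; exact le_self_add))
      (ENNReal.mul_ne_top ENNReal.ofNat_ne_top hs)]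
    simp [hr]
  have hqt : 2 * s - 1 ≠ ⊤ := ENNReal.sub_ne_top (ENNReal.mul_ne_top ENNReal.ofNat_ne_top hs)
  have hq0 : 2 * s - 1 ≠ 0 := fun h0 => by
    rw [h0] at hq
    simp at hq
    linarith
  -- Cauchy–Schwarz for the splitting `r = 1/2 + (r - 1/2)`, whose doubled exponents are `1` and `2r
  -- - 1`. This is the origin of the exponent `2 * s - 1`.
  have key : ∀ i, (∫⁻ x, ‖g i x‖ₑ ^ r ∂μ) ^ 2 ≤
      (∫⁻ x, ‖g i x‖ₑ ∂μ) * (M : ℝ≥0∞) ^ (2 * r - 1) := fun i => by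
    have e := (hg i).enorm
    calc (∫⁻ x, ‖g i x‖ₑ ^ r ∂μ) ^ 2
        = (∫⁻ x, ‖g i x‖ₑ ^ (1 / 2 : ℝ) * ‖g i x‖ₑ ^ (r - 1 / 2) ∂μ) ^ 2 := by
          congr 2
          funext x
          rw [← ENNReal.rpow_add_of_nonneg _ _ (by norm_num) (by linarith)]
          congr 1
          ring
      _ ≤ (∫⁻ x, (‖g i x‖ₑ ^ (1 / 2 : ℝ)) ^ 2 ∂μ) * ∫⁻ x, (‖g i x‖ₑ ^ (r - 1 / 2)) ^ 2 ∂μ :=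
          sq_lintegral_mul_le (e.pow_const _) (e.pow_const _)
      _ = (∫⁻ x, ‖g i x‖ₑ ∂μ) * ∫⁻ x, ‖g i x‖ₑ ^ (2 * r - 1) ∂μ := by
          congr 2 <;> funext x
          · rw [← ENNReal.rpow_two, ← ENNReal.rpow_mul]
            norm_num
          · rw [← ENNReal.rpow_two, ← ENNReal.rpow_mul]
            congr 1
            ring
      _ ≤ _ := by
          gcongr
          have h1 := hM i
          rw [eLpNorm_eq_lintegral_rpow_enorm_toReal hq0 hqt, hq] at h1
          rw [← ENNReal.rpow_inv_le_iff (by linarith), ← one_div]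
          exact h1
  have h2 : Tendsto (fun i => (∫⁻ x, ‖g i x‖ₑ ^ r ∂μ) ^ 2) l (𝓝 0) := by
    refine tendsto_of_tendsto_of_tendsto_of_le_of_le tendsto_const_nhds ?_ (fun _ => zero_le) key
    simpa using ENNReal.Tendsto.mul_const h
      (Or.inr (ENNReal.rpow_ne_top_of_nonneg (by linarith) (ENNReal.coe_ne_top (r := M))))
  have h3 : Tendsto (fun i => ((∫⁻ x, ‖g i x‖ₑ ^ r ∂μ) ^ 2) ^ (1 / (2 * r))) l (𝓝 0) := by
    have h0 : (0 : ℝ≥0∞) ^ (1 / (2 * r)) = 0 := ENNReal.zero_rpow_of_pos (by positivity)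
    have := (ENNReal.continuous_rpow_const (y := 1 / (2 * r))).tendsto 0
    rw [h0] at this
    exact this.comp h2
  refine h3.congr fun i => ?_
  rw [eLpNorm_eq_lintegral_rpow_enorm_toReal hs0 hs, ← ENNReal.rpow_two, ← ENNReal.rpow_mul]
  rw [← hr]
  congr 1
  field_simp

/-- A sequence converging in `L¹` on all discs has a subsequence converging almost everywhere. -/
theorem exists_subseq_ae_tendsto {E : Type*} [NormedAddCommGroup E] {fs : ℕ → Plane → E}
    {f : Plane → E} (hfs : ∀ k, AEStronglyMeasurable (fs k)) (hf : AEStronglyMeasurable f)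
    (h : ∀ R, Tendsto (fun k => ∫⁻ x in Metric.ball (0 : Plane) R, ‖fs k x - f x‖ₑ) atTop (𝓝 0)) :
    ∃ τ : ℕ → ℕ, StrictMono τ ∧ ∀ᵐ x, Tendsto (fun k => fs (τ k) x) atTop (𝓝 (f x)) := by
  -- The radius of the disc and the tolerance vary together: the `n`-th chosen map is within a
  -- summable `ε n` of the limit on the disc of radius `n`. Any given point lies in all but finitely
  -- many of these discs.
  obtain ⟨ε, hε0, hε⟩ := ENNReal.exists_pos_sum_of_countable' (ε := 1) one_ne_zero ℕ
  obtain ⟨τ, hτ, hb⟩ := Filter.extraction_forall_of_eventually'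
    (P := fun n k => ∫⁻ x in Metric.ball (0 : Plane) n, ‖fs k x - f x‖ₑ ≤ ε n) fun n =>
      eventually_atTop.1 ((h n).eventually_le_const (hε0 n))
  refine ⟨τ, hτ, ?_⟩
  have hm : ∀ k : ℕ, AEMeasurable (fun x =>
      (Metric.ball (0 : Plane) k).indicator (fun x => ‖fs (τ k) x - f x‖ₑ) x) volume := fun k =>
    ((hfs _).sub hf).enorm.indicator measurableSet_ball
  have hfin : ∫⁻ x, ∑' k : ℕ, (Metric.ball (0 : Plane) k).indicator
      (fun x => ‖fs (τ k) x - f x‖ₑ) x < ⊤ := by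
    rw [lintegral_tsum hm]
    refine lt_of_le_of_lt (ENNReal.tsum_le_tsum fun k => ?_) (hε.trans ENNReal.one_lt_top)
    rw [lintegral_indicator measurableSet_ball]
    exact hb k
  filter_upwards [ae_lt_top' (AEMeasurable.tsum hm) hfin.ne] with x hx
  have h0 := ENNReal.tendsto_atTop_zero_of_tsum_ne_top hx.ne
  rw [tendsto_iff_edist_tendsto_0]
  refine h0.congr' ?_
  obtain ⟨N, hN⟩ := exists_nat_gt ‖x‖
  filter_upwards [eventually_ge_atTop N] with k hk
  rw [Set.indicator_of_mem, edist_eq_enorm_sub]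
  rw [mem_ball_zero_iff]
  exact hN.trans_le (by exact_mod_cast hk)

/-! ### Pairings of tangent fields in a frame -/

/-- The space of coefficients of a pair of tangent vectors in a frame. -/
abbrev FrameCoeffs : Type := EuclideanSpace ℝ (Fin 2 × Fin 2)

theorem frameComb_single_dot (u w : Amb) (c : Fin 2 → ℝ) :
    frameComb u c ⬝ᵥ w = ∑ a, c a * (frameComb u (Pi.single a 1) ⬝ᵥ w) := by
  simp [frameComb, dotProduct, Fin.sum_univ_three, Fin.sum_univ_two]
  ring

theorem abs_dotProduct_le (v w : Amb) : |v ⬝ᵥ w| ≤ 3 * ‖v‖ * ‖w‖ := by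
  rw [dotProduct]
  refine (Finset.abs_sum_le_sum_abs _ _).trans ?_
  calc ∑ i, |v i * w i| ≤ ∑ _i : Fin 3, ‖v‖ * ‖w‖ := Finset.sum_le_sum fun i _ => by
        rw [abs_mul]
        exact mul_le_mul (norm_le_pi_norm v i) (norm_le_pi_norm w i) (abs_nonneg _) (norm_nonneg _)
    _ = _ := by simp; ring

theorem abs_frameComb_single_dot_le {u : Amb} (hu : u ∈ hypPlane) (a : Fin 2) (w : Amb) :
    |frameComb u (Pi.single a 1) ⬝ᵥ w| ≤ 6 * ‖u‖ * ‖w‖ := by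
  have h1 := norm_frameComb_le hu (Pi.single a 1)
  have h2 : √(∑ b : Fin 2, (Pi.single a 1 : Fin 2 → ℝ) b ^ 2) = 1 := by
    simp [Pi.single_apply, ite_pow]
  rw [h2, mul_one] at h1
  refine (abs_dotProduct_le _ _).trans ?_
  nlinarith [norm_nonneg w, norm_nonneg u]

theorem abs_frameComb_single_dot_sub_le {u v : Amb} (hu : u ∈ hypPlane) (hv : v ∈ hypPlane)
    (a : Fin 2) (w w' : Amb) :
    |frameComb u (Pi.single a 1) ⬝ᵥ w - frameComb v (Pi.single a 1) ⬝ᵥ w'| ≤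
      18 * ‖u - v‖ * ‖w'‖ + 6 * ‖u‖ * ‖w - w'‖ := by
  have e : frameComb u (Pi.single a 1) ⬝ᵥ w - frameComb v (Pi.single a 1) ⬝ᵥ w' =
      (frameComb u (Pi.single a 1) - frameComb v (Pi.single a 1)) ⬝ᵥ w' +
        frameComb u (Pi.single a 1) ⬝ᵥ (w - w') := by
    rw [sub_dotProduct, dotProduct_sub]; ring
  rw [e]
  refine (abs_add_le _ _).trans (add_le_add ((abs_dotProduct_le _ _).trans ?_)
    (abs_frameComb_single_dot_le hu a _))
  have h1 := norm_frameComb_sub_le hu hv (Pi.single a 1)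
  have h2 : ‖(Pi.single a 1 : Fin 2 → ℝ)‖ ≤ 1 := by
    rw [Pi.norm_single]; simp
  have h3 : 6 * ‖(Pi.single a 1 : Fin 2 → ℝ)‖ * ‖u - v‖ ≤ 6 * ‖u - v‖ := by
    nlinarith [norm_nonneg (u - v)]
  nlinarith [norm_nonneg w']

theorem measurable_frameComb : Measurable fun p : Amb × (Fin 2 → ℝ) => frameComb p.1 p.2 := by
  rw [measurable_pi_iff]
  intro i
  fin_cases i <;> simp [frameComb] <;> fun_prop

theorem measurable_dotProduct : Measurable fun p : Amb × Amb => p.1 ⬝ᵥ p.2 := by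
  simp only [dotProduct]
  fun_prop

theorem measurable_frameCoeff (a : Fin 2) :
    Measurable fun p : Amb × Amb => frameCoeff a p.1 p.2 := by
  unfold frameCoeff
  fun_prop

theorem FrameCoeffs.norm_le {v : FrameCoeffs} {B : ℝ} (hB : ∀ p, |v p| ≤ B) : ‖v‖ ≤ 2 * B := by
  have hB0 : 0 ≤ B := (abs_nonneg _).trans (hB (0, 0))
  rw [EuclideanSpace.norm_eq]
  apply Real.sqrt_le_iff.2 ⟨by positivity, ?_⟩
  calc ∑ p, ‖v p‖ ^ 2 ≤ ∑ _p : Fin 2 × Fin 2, B ^ 2 := by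
        gcongr with p
        exact hB p
    _ = _ := by simp; ring

/-- The coefficients in the frame at `f` of a pair of tangent fields along `f`. -/
noncomputable def frameCoeffs (f : Plane → Amb) (D : Fin 2 → Plane → Amb) (x : Plane) :
    FrameCoeffs := WithLp.toLp 2 fun p => frameCoeff p.2 (f x) (D p.1 x)

/-- The vector whose product with the coefficients of a pair of tangent vectors at `u` is the
product of the `l`-th vector with `w`. -/
noncomputable def frameTest (l : Fin 2) (u w : Amb) : FrameCoeffs :=
  WithLp.toLp 2 fun p => if p.1 = l then frameComb u (Pi.single p.2 1) ⬝ᵥ w else 0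

theorem inner_frameTest (l : Fin 2) (u w : Amb) (c : FrameCoeffs) :
    inner ℝ c (frameTest l u w) = frameComb u (fun a => c (l, a)) ⬝ᵥ w := by
  rw [frameComb_single_dot, PiLp.inner_apply, Fintype.sum_prod_type]
  simp [frameTest, mul_comm]

theorem norm_frameTest_le {u : Amb} (hu : u ∈ hypPlane) (l : Fin 2) (w : Amb) :
    ‖frameTest l u w‖ ≤ 12 * ‖u‖ * ‖w‖ := by
  refine (FrameCoeffs.norm_le (B := 6 * ‖u‖ * ‖w‖) fun p => ?_).trans_eq (by ring)
  by_cases hp : p.1 = l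
  · simpa [frameTest, hp] using abs_frameComb_single_dot_le hu p.2 w
  · simp only [frameTest, hp, if_false, abs_zero]
    positivity

theorem norm_frameTest_sub_le {u v : Amb} (hu : u ∈ hypPlane) (hv : v ∈ hypPlane) (l : Fin 2)
    (w w' : Amb) : ‖frameTest l u w - frameTest l v w'‖ ≤
      36 * ‖u - v‖ * ‖w'‖ + 12 * ‖u‖ * ‖w - w'‖ := by
  refine (FrameCoeffs.norm_le (B := 18 * ‖u - v‖ * ‖w'‖ + 6 * ‖u‖ * ‖w - w'‖)
    fun p => ?_).trans_eq (by ring)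
  by_cases hp : p.1 = l
  · simpa [frameTest, hp] using abs_frameComb_single_dot_sub_le hu hv p.2 w w'
  · simp only [frameTest, hp, if_false, PiLp.sub_apply, sub_self, abs_zero]
    positivity

theorem measurable_frameComb_single_dot (a : Fin 2) :
    Measurable fun p : Amb × Amb => frameComb p.1 (Pi.single a 1) ⬝ᵥ p.2 := by
  have hc : Measurable fun p : Amb × Amb => (p.1, (Pi.single a 1 : Fin 2 → ℝ)) := by fun_prop
  have h : Measurable fun p : Amb × Amb => (frameComb p.1 (Pi.single a 1), p.2) :=
    (measurable_frameComb.comp hc).prodMk measurable_snd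
  exact measurable_dotProduct.comp h

theorem measurable_frameTest (l : Fin 2) : Measurable fun p : Amb × Amb => frameTest l p.1 p.2 := by
  have h : Measurable fun (p : Amb × Amb) (q : Fin 2 × Fin 2) =>
      if q.1 = l then frameComb p.1 (Pi.single q.2 1) ⬝ᵥ p.2 else 0 := by
    refine measurable_pi_iff.2 fun q => ?_
    by_cases hq : q.1 = l
    · simpa only [hq, if_true] using measurable_frameComb_single_dot q.2
    · simp only [hq, if_false, measurable_const]
  exact (WithLp.measurable_toLp 2 _).comp h

theorem _root_.MeasureTheory.AEStronglyMeasurable.measurable_comp₂ {α E F G : Type*}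
    [MeasurableSpace α] {μ : Measure α} [TopologicalSpace E] [TopologicalSpace F]
    [TopologicalSpace G] [MeasurableSpace E] [MeasurableSpace F] [MeasurableSpace G] [BorelSpace E]
    [BorelSpace F] [BorelSpace G] [TopologicalSpace.PseudoMetrizableSpace E]
    [TopologicalSpace.PseudoMetrizableSpace F] [TopologicalSpace.PseudoMetrizableSpace G]
    [SecondCountableTopology G] {b : E × F → G} (hb : Measurable b) {f : α → E} {g : α → F}
    (hf : AEStronglyMeasurable f μ) (hg : AEStronglyMeasurable g μ) :
    AEStronglyMeasurable (fun x => b (f x, g x)) μ :=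
  (hb.comp_aemeasurable (hf.aemeasurable.prodMk hg.aemeasurable)).aestronglyMeasurable

namespace IsFieldPair

variable {C : ℝ≥0} {f : Plane → Amb} {D : Fin 2 → Plane → Amb} {N : ℝ≥0∞ → ℝ≥0 → ℝ≥0}

/-- By orthonormality of the frame the coefficient field carries the full energy. Weak compactness
in a fixed Hilbert space thus becomes available for tangent fields along varying maps. -/
theorem norm_frameCoeffs (h : IsFieldPair C f D) : ∀ᵐ x, ‖frameCoeffs f D x‖ = fieldLength D x := by
  filter_upwards [h.mem, h.tangent 0, h.tangent 1] with x hx h0 h1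
  rw [EuclideanSpace.norm_eq, fieldLength, Fintype.sum_prod_type]
  congr 1
  simp only [Fin.sum_univ_two, lorNormSq_eq_sum hx h0, lorNormSq_eq_sum hx h1, frameCoeffs,
    Real.norm_eq_abs, sq_abs]

theorem memLp_frameCoeffs (h : IsFieldPair C f D) :
    MemLp (frameCoeffs f D) 2 ∧ eLpNorm (frameCoeffs f D) 2 ≤ (NNReal.sqrt C : ℝ≥0) := by
  have hm : AEStronglyMeasurable (frameCoeffs f D) := by
    refine ((WithLp.measurable_toLp 2 _).comp_aemeasurable
      (aemeasurable_pi_iff.2 fun p => ?_)).aestronglyMeasurable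
    exact (measurable_frameCoeff p.2).comp_aemeasurable
      (h.meas.aemeasurable.prodMk (h.meas_field p.1).aemeasurable)
  have hle : eLpNorm (frameCoeffs f D) 2 ≤ (NNReal.sqrt C : ℝ≥0) := by
    rw [eLpNorm_congr_norm_ae (g := fieldLength D)]
    · exact h.eLpNorm_fieldLength_le _ le_rfl
    · filter_upwards [h.norm_frameCoeffs] with x hx
      rw [hx, fieldLength, Real.norm_of_nonneg (Real.sqrt_nonneg _)]
  exact ⟨⟨hm, hle.trans_lt ENNReal.coe_lt_top⟩, hle⟩

/-- The converse passage: an `L²` coefficient field yields tangent fields with the same energy.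
Applied to a weak limit of coefficients, it transfers the norm bound to an energy bound along the
limit map. -/
theorem of_frameCoeffs {y : Plane → FrameCoeffs} (hf : AEStronglyMeasurable f)
    (hmem : ∀ᵐ x, f x ∈ hypPlane) (hy : AEStronglyMeasurable y)
    (hle : eLpNorm y 2 ≤ (NNReal.sqrt C : ℝ≥0)) :
    IsFieldPair C f (fun l x => frameComb (f x) fun a => y x (l, a)) where
  meas := hf
  meas_field l := by
    have hc : Measurable fun (c : FrameCoeffs) (a : Fin 2) => c (l, a) :=
      measurable_pi_iff.2 fun a =>
        (EuclideanSpace.proj (l, a) : FrameCoeffs →L[ℝ] ℝ).continuous.measurable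
    have h := hf.aemeasurable.prodMk (hc.comp_aemeasurable hy.aemeasurable)
    exact (measurable_frameComb.comp_aemeasurable h).aestronglyMeasurable
  mem := hmem
  tangent l := hmem.mono fun x hx => lor_self_frameComb hx _
  energy_le := by
    rw [eLpNorm_eq_lintegral_rpow_enorm_toReal two_ne_zero ENNReal.ofNat_ne_top, one_div,
      ENNReal.rpow_inv_le_iff (by simp), ← ENNReal.coe_rpow_of_nonneg _ (by simp)] at hle
    refine le_trans (le_of_eq (lintegral_congr_ae ?_)) (hle.trans_eq ?_)
    · filter_upwards [hmem] with x hx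
      rw [← ofReal_norm, ENNReal.toReal_ofNat, ENNReal.rpow_two,
        ← ENNReal.ofReal_pow (norm_nonneg _), EuclideanSpace.norm_sq_eq, Fintype.sum_prod_type]
      simp [lorNormSq_frameComb hx]
    · rw [ENNReal.toReal_ofNat, NNReal.rpow_two, NNReal.sq_sqrt]

end IsFieldPair

/-! ### Limits of sequences of maps with bounded energy and mass -/

/-- `f` is the limit in `L¹_loc` of smooth maps with energy and mass at most `C`. -/
structure IsSliceLimit (C : ℝ≥0) (fs : ℕ → Plane → Amb) (f : Plane → Amb) : Prop where
  slice : ∀ k, IsSlice C (fs k)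
  meas : AEStronglyMeasurable f
  tendsto : ∀ R, Tendsto (fun k => ∫⁻ x in Metric.ball (0 : Plane) R, ‖fs k x - f x‖ₑ) atTop (𝓝 0)

/-- Convergence of pairings of vector fields on bounded sets with strongly convergent families in
`Lʳ`, for all `r > 2`. -/
def FieldTendsto (Ds : ℕ → Plane → Amb) (D : Plane → Amb) : Prop :=
  ∀ (s r : ℝ≥0∞), s.HolderTriple r 2 → s ≠ ⊤ → ∀ (K : Set Plane) (R : ℝ), MeasurableSet K →
    K ⊆ Metric.ball 0 R → ∀ (χs : ℕ → Plane → Amb) (χ : Plane → Amb),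
    (∀ k, MemLp (χs k) r (volume.restrict K)) → MemLp χ r (volume.restrict K) →
    Tendsto (fun k => eLpNorm (χs k - χ) r (volume.restrict K)) atTop (𝓝 0) →
    Tendsto (fun k => ∫ x in K, Ds k x ⬝ᵥ χs k x) atTop (𝓝 (∫ x in K, D x ⬝ᵥ χ x))

namespace IsSliceLimit

variable {C : ℝ≥0} {fs : ℕ → Plane → Amb} {f : Plane → Amb}

theorem comp (h : IsSliceLimit C fs f) {τ : ℕ → ℕ} (hτ : Tendsto τ atTop atTop) :
    IsSliceLimit C (fun k => fs (τ k)) f :=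
  ⟨fun k => h.slice _, h.meas, fun R => (h.tendsto R).comp hτ⟩

theorem exists_subseq (h : IsSliceLimit C fs f) :
    ∃ τ : ℕ → ℕ, StrictMono τ ∧ ∀ᵐ x, Tendsto (fun k => fs (τ k) x) atTop (𝓝 (f x)) :=
  exists_subseq_ae_tendsto (fun k => (h.slice k).smooth.continuous.aestronglyMeasurable) h.meas
    h.tendsto

theorem mem (h : IsSliceLimit C fs f) : ∀ᵐ x, f x ∈ hypPlane := by
  obtain ⟨τ, -, hτ⟩ := h.exists_subseq
  filter_upwards [hτ] with x hx
  exact isClosed_hypPlane.mem_of_tendsto hx (Eventually.of_forall fun k => (h.slice _).mem x)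

theorem mass_le (h : IsSliceLimit C fs f) : ∫⁻ x, ENNReal.ofReal (f x 0 - 1) ≤ C := by
  obtain ⟨τ, -, hτ⟩ := h.exists_subseq
  have hm : ∀ k, Measurable fun x => ENNReal.ofReal (fs (τ k) x 0 - 1) := fun k => by
    have : Continuous fun x => fs (τ k) x 0 := (continuous_apply 0).comp (h.slice _).smooth.continuous
    fun_prop
  calc _ = ∫⁻ x, liminf (fun k => ENNReal.ofReal (fs (τ k) x 0 - 1)) atTop := by
        refine lintegral_congr_ae ?_
        filter_upwards [hτ] with x hx
        refine (Tendsto.liminf_eq ?_).symm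
        exact ENNReal.tendsto_ofReal ((tendsto_pi_nhds.1 hx 0).sub_const 1)
    _ ≤ liminf (fun k => ∫⁻ x, ENNReal.ofReal (fs (τ k) x 0 - 1)) atTop := lintegral_liminf_le hm
    _ ≤ liminf (fun _ => (C : ℝ≥0∞)) (atTop : Filter ℕ) :=
        liminf_le_liminf (Eventually.of_forall fun k => (h.slice _).mass_le)
    _ = C := liminf_const _

/-- Fatou's lemma along an almost everywhere convergent subsequence. The limit inherits the
constants of the smooth slices. -/
theorem hasLpBounds (h : IsSliceLimit C fs f) : HasLpBounds (sliceBound C) f := by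
  intro s V K hs hK hV
  obtain ⟨τ, -, hτ⟩ := h.exists_subseq
  calc _ ≤ liminf (fun k => eLpNorm (fs (τ k)) s (volume.restrict K)) atTop :=
        Lp.eLpNorm_lim_le_liminf_eLpNorm
          (fun k => (h.slice _).smooth.continuous.aestronglyMeasurable) _ (ae_restrict_of_ae hτ)
    _ ≤ liminf (fun _ => (sliceBound C s V : ℝ≥0∞)) (atTop : Filter ℕ) :=
        liminf_le_liminf (Eventually.of_forall fun k => (h.slice _).hasLpBounds s V K hs hK hV)
    _ = _ := liminf_const _

end IsSliceLimit

theorem HasLpBounds.memLp {N : ℝ≥0∞ → ℝ≥0 → ℝ≥0} {f : Plane → Amb} (h : HasLpBounds N f)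
    (hf : AEStronglyMeasurable f) {s : ℝ≥0∞} (hs : s ≠ ⊤) {K : Set Plane} (hK : MeasurableSet K)
    (hV : volume K ≠ ⊤) : MemLp f s (volume.restrict K) :=
  ⟨hf.restrict, (h s _ K hs hK (ENNReal.coe_toNNReal hV).ge).trans_lt ENNReal.coe_lt_top⟩

/-- Convergence in `L¹` is interpolated with the uniform bound in `L^{2s-1}`. The index set is
arbitrary because this serves both the sequence and continuity in time. -/
theorem tendsto_eLpNorm_sub_of_hasLpBounds {N : ℝ≥0∞ → ℝ≥0 → ℝ≥0} {ι : Type*} {l : Filter ι}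
    {fs : ι → Plane → Amb} {f : Plane → Amb} (hfs : ∀ i, AEStronglyMeasurable (fs i))
    (hf : AEStronglyMeasurable f) (hNs : ∀ i, HasLpBounds N (fs i)) (hN : HasLpBounds N f)
    {K : Set Plane} {R : ℝ} (hK : MeasurableSet K) (hKR : K ⊆ Metric.ball 0 R)
    (h : Tendsto (fun i => ∫⁻ x in Metric.ball (0 : Plane) R, ‖fs i x - f x‖ₑ) l (𝓝 0))
    {s : ℝ≥0∞} (hs1 : 1 ≤ s) (hs : s ≠ ⊤) :
    Tendsto (fun i => eLpNorm (fs i - f) s (volume.restrict K)) l (𝓝 0) := by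
  have hV : volume K ≤ (volume (Metric.ball (0 : Plane) R)).toNNReal := by
    rw [ENNReal.coe_toNNReal measure_ball_lt_top.ne]
    exact measure_mono hKR
  have hst : 2 * s - 1 ≠ ⊤ := ENNReal.sub_ne_top (ENNReal.mul_ne_top ENNReal.ofNat_ne_top hs)
  have hs2 : 1 ≤ 2 * s - 1 := by
    refine ENNReal.le_sub_of_add_le_right ENNReal.one_ne_top ?_
    rw [two_mul]
    exact add_le_add hs1 hs1
  refine tendsto_eLpNorm_of_tendsto_lintegral (fun i => ((hfs i).sub hf).restrict) hs1 hs
    (M := N (2 * s - 1) (volume (Metric.ball (0 : Plane) R)).toNNReal +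
      N (2 * s - 1) (volume (Metric.ball (0 : Plane) R)).toNNReal) (fun i => ?_) ?_
  · refine (eLpNorm_sub_le (hfs i).restrict hf.restrict hs2).trans ?_
    push_cast
    exact add_le_add (hNs i _ _ K hst hK hV) (hN _ _ K hst hK hV)
  · refine tendsto_of_tendsto_of_tendsto_of_le_of_le tendsto_const_nhds h (fun _ => zero_le)
      fun i => ?_
    exact lintegral_mono' (Measure.restrict_mono hKR le_rfl) le_rfl

theorem one_le_of_holderTriple {s r : ℝ≥0∞} (h : s.HolderTriple r 2) : 1 ≤ s := by
  have h1 : s⁻¹ ≤ 2⁻¹ := by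
    rw [← h.inv_add_inv_eq_inv]
    exact le_self_add
  exact one_le_two.trans (ENNReal.inv_le_inv.1 h1)

/-! ### Strong `L²` estimates for test vectors expressed in frames. -/

section FrameTest

variable {C : ℝ≥0} {s r : ℝ≥0∞} [s.HolderTriple r 2] {K : Set Plane} {f χ : Plane → Amb}

theorem memLp_frameTest (hmem : ∀ᵐ x, f x ∈ hypPlane) (hf : MemLp f s (volume.restrict K))
    (hχ : MemLp χ r (volume.restrict K)) (l : Fin 2) :
    MemLp (fun x => frameTest l (f x) (χ x)) 2 (volume.restrict K) := by
  refine ⟨AEStronglyMeasurable.measurable_comp₂ (measurable_frameTest l) hf.1 hχ.1, ?_⟩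
  refine lt_of_le_of_lt (eLpNorm_le_eLpNorm_mul_eLpNorm'_of_norm (p := s) (q := r) hf.1 hχ.1
    (frameTest l) 12 ((ae_restrict_of_ae hmem).mono fun x hx => norm_frameTest_le hx l _)) ?_
  exact ENNReal.mul_lt_top (ENNReal.mul_lt_top ENNReal.coe_lt_top hf.2) hχ.2

theorem eLpNorm_frameTest_sub_le {g θ : Plane → Amb} (hmem : ∀ᵐ x, f x ∈ hypPlane)
    (hmem' : ∀ᵐ x, g x ∈ hypPlane) (hf : MemLp f s (volume.restrict K))
    (hg : MemLp g s (volume.restrict K)) (hχ : MemLp χ r (volume.restrict K))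
    (hθ : MemLp θ r (volume.restrict K)) (l : Fin 2) :
    eLpNorm ((fun x => frameTest l (f x) (χ x)) - fun x => frameTest l (g x) (θ x)) 2
      (volume.restrict K) ≤
      36 * eLpNorm (f - g) s (volume.restrict K) * eLpNorm θ r (volume.restrict K) +
      12 * eLpNorm f s (volume.restrict K) * eLpNorm (χ - θ) r (volume.restrict K) := by
  have hm1 := (hf.1.sub hg.1).norm.mul hθ.1.norm
  have hm2 := hf.1.norm.mul (hχ.1.sub hθ.1).norm
  calc _ ≤ eLpNorm ((fun x => 36 * (‖(f - g) x‖ * ‖θ x‖)) + fun x => 12 * (‖f x‖ * ‖(χ - θ) x‖)) 2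
        (volume.restrict K) := by
        refine eLpNorm_mono_ae_real ?_
        filter_upwards [ae_restrict_of_ae hmem, ae_restrict_of_ae hmem'] with x h1 h2
        refine (norm_frameTest_sub_le h1 h2 l _ _).trans_eq ?_
        simp only [Pi.add_apply, Pi.sub_apply]
        ring
    _ ≤ _ := eLpNorm_add_le (hm1.const_mul 36) (hm2.const_mul 12) one_le_two
    _ ≤ _ := by
      refine add_le_add ?_ ?_
      · refine (eLpNorm_le_eLpNorm_mul_eLpNorm'_of_norm (p := s) (q := r) (hf.1.sub hg.1) hθ.1
          (fun v w => 36 * (‖v‖ * ‖w‖)) 36 (Eventually.of_forall fun x => ?_)).trans_eq (by simp)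
        simp [mul_assoc]
      · refine (eLpNorm_le_eLpNorm_mul_eLpNorm'_of_norm (p := s) (q := r) hf.1 (hχ.1.sub hθ.1)
          (fun v w => 12 * (‖v‖ * ‖w‖)) 12 (Eventually.of_forall fun x => ?_)).trans_eq (by simp)
        simp [mul_assoc]

end FrameTest

namespace IsSliceLimit

variable {C : ℝ≥0} {fs : ℕ → Plane → Amb} {f : Plane → Amb}

theorem tendsto_eLpNorm (h : IsSliceLimit C fs f) {K : Set Plane} {R : ℝ} (hK : MeasurableSet K)
    (hKR : K ⊆ Metric.ball 0 R) {s : ℝ≥0∞} (hs1 : 1 ≤ s) (hs : s ≠ ⊤) :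
    Tendsto (fun k => eLpNorm (fs k - f) s (volume.restrict K)) atTop (𝓝 0) :=
  tendsto_eLpNorm_sub_of_hasLpBounds
    (fun k => (h.slice k).smooth.continuous.aestronglyMeasurable) h.meas
    (fun k => (h.slice k).hasLpBounds) h.hasLpBounds hK hKR (h.tendsto R) hs1 hs

/-- Along a subsequence the derivatives converge weakly to a pair of tangent fields along the
limit. -/
theorem exists_fieldTendsto (h : IsSliceLimit C fs f) :
    ∃ (D : Fin 2 → Plane → Amb) (τ : ℕ → ℕ), StrictMono τ ∧ IsFieldPair C f D ∧
      ∀ l, FieldTendsto (fun k => partialDeriv l (fs (τ k))) (D l) := by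
  have : Fact ((2 : ℝ≥0∞) ≠ ⊤) := ⟨ENNReal.ofNat_ne_top⟩
  have hψ := fun k => (h.slice k).isFieldPair.memLp_frameCoeffs
  obtain ⟨y, τ, hτ, hyM, hy⟩ := exists_subseq_tendsto_inner
    (x := fun k => (hψ k).1.toLp) (M := NNReal.sqrt C) fun k => by
      rw [Lp.norm_toLp]
      exact ENNReal.toReal_le_coe_of_le_coe (hψ k).2
  have hyE : eLpNorm y 2 ≤ (NNReal.sqrt C : ℝ≥0) := by
    rw [← Lp.enorm_def, ← ofReal_norm]
    exact (ENNReal.ofReal_le_ofReal hyM).trans_eq (ENNReal.ofReal_coe_nnreal)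
  -- The limiting fields are rebuilt from the weak limit `y` of the coefficients, in the frame at
  -- the limit map `f`.
  refine ⟨_, τ, hτ, IsFieldPair.of_frameCoeffs h.meas h.mem (Lp.aestronglyMeasurable y) hyE, ?_⟩
  intro l s r hsr hs K R hK hKR χs χ hχs hχ hlim
  have hs1 := one_le_of_holderTriple hsr
  have hVt : volume K ≠ ⊤ := ((measure_mono hKR).trans_lt measure_ball_lt_top).ne
  have hfm := h.hasLpBounds.memLp h.meas hs hK hVt
  have hfsm := fun k => (h.slice (τ k)).hasLpBounds.memLp
    (h.slice (τ k)).smooth.continuous.aestronglyMeasurable hs hK hVt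
  have hT := memLp_frameTest h.mem hfm hχ l
  have hTs := fun k => memLp_frameTest (Eventually.of_forall (h.slice (τ k)).mem) (hfsm k) (hχs k) l
  have hB := (memLp_indicator_iff_restrict hK).2 hT
  have hBs := fun k => (memLp_indicator_iff_restrict hK).2 (hTs k)
  -- The pairing of `∂ₗ fₖ` with `χₖ` is the `L²` product of the coefficients with `frameTest l fₖ
  -- χₖ`. The first factor converges weakly. The second converges strongly, as `fₖ → f` in `Lˢ`, `χₖ
  -- → χ` in `Lʳ` and `1/s + 1/r = 1/2`.
  have hBlim : Tendsto (fun k => (hBs k).toLp) atTop (𝓝 hB.toLp) := by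
    rw [Lp.tendsto_Lp_iff_tendsto_eLpNorm'']
    have hb : ∀ k, eLpNorm (K.indicator (fun x => frameTest l (fs (τ k) x) (χs k x)) -
        K.indicator fun x => frameTest l (f x) (χ x)) 2 volume ≤
        36 * eLpNorm (fs (τ k) - f) s (volume.restrict K) * eLpNorm χ r (volume.restrict K) +
        12 * sliceBound C s (volume K).toNNReal * eLpNorm (χs k - χ) r (volume.restrict K) := by
      intro k
      rw [← Set.indicator_sub', eLpNorm_indicator_eq_eLpNorm_restrict hK]
      refine (eLpNorm_frameTest_sub_le (Eventually.of_forall (h.slice (τ k)).mem) h.mem (hfsm k) hfm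
        (hχs k) hχ l).trans ?_
      gcongr
      exact (h.slice (τ k)).hasLpBounds s _ K hs hK (ENNReal.coe_toNNReal hVt).ge
    refine tendsto_of_tendsto_of_tendsto_of_le_of_le tendsto_const_nhds ?_ (fun _ => zero_le) hb
    have h1 : Tendsto (fun k => 36 * eLpNorm (fs (τ k) - f) s (volume.restrict K) *
        eLpNorm χ r (volume.restrict K)) atTop (𝓝 0) := by
      have := ((h.tendsto_eLpNorm hK hKR hs1 hs).comp hτ.tendsto_atTop)
      have h2 := ENNReal.Tendsto.mul_const (ENNReal.Tendsto.const_mul (a := 36) this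
        (Or.inr (by simp))) (b := eLpNorm χ r (volume.restrict K)) (Or.inr hχ.2.ne)
      simpa using h2
    have h2 : Tendsto (fun k => 12 * (sliceBound C s (volume K).toNNReal : ℝ≥0∞) *
        eLpNorm (χs k - χ) r (volume.restrict K)) atTop (𝓝 0) := by
      have := ENNReal.Tendsto.const_mul (a := 12 * (sliceBound C s (volume K).toNNReal : ℝ≥0∞)) hlim
        (Or.inr (ENNReal.mul_ne_top (by simp) ENNReal.coe_ne_top))
      simpa using this
    simpa using h1.add h2
  have hinner := tendsto_inner_of_weak_strong (M := NNReal.sqrt C) (fun k => by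
      rw [Lp.norm_toLp]
      exact ENNReal.toReal_le_coe_of_le_coe (hψ (τ k)).2) hy hBlim
  have hpt : ∀ (g θ : Plane → Amb) (c : Plane → FrameCoeffs) x,
      inner ℝ (c x) (K.indicator (fun x => frameTest l (g x) (θ x)) x) =
        K.indicator (fun x => frameComb (g x) (fun a => c x (l, a)) ⬝ᵥ θ x) x := by
    intro g θ c x
    by_cases hx : x ∈ K
    · rw [Set.indicator_of_mem hx, Set.indicator_of_mem hx, inner_frameTest]
    · rw [Set.indicator_of_notMem hx, Set.indicator_of_notMem hx, inner_zero_right]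
  have e2 : inner ℝ y hB.toLp = ∫ x in K, frameComb (f x) (fun a => y x (l, a)) ⬝ᵥ χ x := by
    rw [L2.inner_def, ← integral_indicator hK]
    refine integral_congr_ae ?_
    filter_upwards [hB.coeFn_toLp] with x hx
    rw [hx, hpt]
  rw [← e2]
  refine hinner.congr fun k => ?_
  rw [L2.inner_def, ← integral_indicator hK]
  refine integral_congr_ae ?_
  filter_upwards [(hBs k).coeFn_toLp, (hψ (τ k)).1.coeFn_toLp] with x hx hx'
  rw [hx, hx', hpt]
  congr 1
  funext x
  congr 1
  exact frameComb_frameCoeff ((h.slice (τ k)).mem x) (lor_partialDeriv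
    ((h.slice (τ k)).smooth.differentiable (by simp)) (h.slice (τ k)).mem l x)

end IsSliceLimit

/-! ### The weak gradient of a limit -/

theorem locallyIntegrable_of_ball {E : Type*} [NormedAddCommGroup E] {f : Plane → E}
    (h : ∀ R, IntegrableOn f (Metric.ball 0 R)) : LocallyIntegrable f := by
  rw [locallyIntegrable_iff]
  intro K hK
  obtain ⟨R, hR⟩ := hK.isBounded.subset_ball 0
  exact (h R).mono_set hR

theorem IsFieldPair.exists_memLp {C : ℝ≥0} {f : Plane → Amb} {D : Fin 2 → Plane → Amb}
    {N : ℝ≥0∞ → ℝ≥0 → ℝ≥0} (h : IsFieldPair C f D) (hN : HasLpBounds N f) {p : ℝ≥0∞} (hp : p < 2)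
    {K : Set Plane} (hK : MeasurableSet K) (hV : volume K ≠ ⊤) (k : Fin 2) :
    MemLp (D k) p (volume.restrict K) := by
  obtain ⟨B, hB⟩ := IsFieldPair.exists_eLpNorm_field_le C N hp (volume K).toNNReal
  exact ⟨(h.meas_field k).restrict, (hB f D h hN K hK (ENNReal.coe_toNNReal hV).ge k).trans_lt
    ENNReal.coe_lt_top⟩

theorem IsFieldPair.locallyIntegrable {C : ℝ≥0} {f : Plane → Amb} {D : Fin 2 → Plane → Amb}
    {N : ℝ≥0∞ → ℝ≥0 → ℝ≥0} (h : IsFieldPair C f D) (hN : HasLpBounds N f) (k : Fin 2) :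
    LocallyIntegrable (D k) :=
  locallyIntegrable_of_ball fun _ => memLp_one_iff_integrable.1
    (h.exists_memLp hN (by norm_num) measurableSet_ball measure_ball_lt_top.ne k)

theorem IsFieldPair.locallyIntegrable_cross {C : ℝ≥0} {f : Plane → Amb} {D : Fin 2 → Plane → Amb}
    {N : ℝ≥0∞ → ℝ≥0 → ℝ≥0} (h : IsFieldPair C f D) (hN : HasLpBounds N f) (k : Fin 2) :
    LocallyIntegrable fun x => crossProduct (f x) (D k x) := by
  refine locallyIntegrable_of_ball fun R => memLp_one_iff_integrable.1 ?_
  obtain ⟨B, hB⟩ := IsFieldPair.exists_eLpNorm_cross_le C N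
    (volume (Metric.ball (0 : Plane) R)).toNNReal
  refine ⟨?_, (hB f D h hN _ measurableSet_ball
    (ENNReal.coe_toNNReal measure_ball_lt_top.ne).ge k).trans_lt ENNReal.coe_lt_top⟩
  exact (crossL.aestronglyMeasurable_comp₂ h.meas (h.meas_field k)).restrict

theorem HasLpBounds.locallyIntegrable {N : ℝ≥0∞ → ℝ≥0 → ℝ≥0} {f : Plane → Amb}
    (h : HasLpBounds N f) (hf : AEStronglyMeasurable f) : LocallyIntegrable f :=
  locallyIntegrable_of_ball fun _ => memLp_one_iff_integrable.1
    (h.memLp hf (by simp) measurableSet_ball measure_ball_lt_top.ne)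

theorem IsFieldPair.congr {C : ℝ≥0} {f : Plane → Amb} {D D' : Fin 2 → Plane → Amb}
    (h : IsFieldPair C f D) (hD : ∀ k, D k =ᵐ[volume] D' k) : IsFieldPair C f D' where
  meas := h.meas
  meas_field k := (h.meas_field k).congr (hD k)
  mem := h.mem
  tangent k := by
    filter_upwards [h.tangent k, hD k] with x hx e
    rwa [← e]
  energy_le := by
    refine le_trans (le_of_eq (lintegral_congr_ae ?_)) h.energy_le
    filter_upwards [hD 0, hD 1] with x h0 h1
    simp only [Fin.sum_univ_two, h0, h1]

theorem IsWeakPartial.congr {k : Fin 2} {f g g' : Plane → Amb} (h : IsWeakPartial k f g)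
    (hg : g =ᵐ[volume] g') : IsWeakPartial k f g' where
  locInt_left := h.locInt_left
  locInt_right := h.locInt_right.congr hg
  integral_eq φ hφ hc := by
    rw [h.integral_eq φ hφ hc]
    congr 1
    refine integral_congr_ae ?_
    filter_upwards [hg] with x hx
    rw [hx]

theorem FieldTendsto.congr {Ds : ℕ → Plane → Amb} {D D' : Plane → Amb} (h : FieldTendsto Ds D)
    (hD : D =ᵐ[volume] D') : FieldTendsto Ds D' := by
  intro s r hsr hs K R hK hKR χs χ hχs hχ hlim
  have e : ∫ x in K, D' x ⬝ᵥ χ x = ∫ x in K, D x ⬝ᵥ χ x := by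
    refine integral_congr_ae ?_
    filter_upwards [ae_restrict_of_ae hD] with x hx
    rw [hx]
  rw [e]
  exact h s r hsr hs K R hK hKR χs χ hχs hχ hlim

theorem IsWeakPartial.ae_eq {k : Fin 2} {f g g' : Plane → Amb} (h : IsWeakPartial k f g)
    (h' : IsWeakPartial k f g') : g =ᵐ[volume] g' := by
  have h0 := ae_eq_zero_of_integral_contDiff_smul_eq_zero
    (h.locInt_right.sub h'.locInt_right) fun φ hφ hc => by
    have e := (h.integral_eq φ hφ hc).symm.trans (h'.integral_eq φ hφ hc)
    simp only [Pi.sub_apply, smul_sub]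
    rw [integral_sub (h.locInt_right.integrable_smul_left_of_hasCompactSupport hφ.continuous hc)
      (h'.locInt_right.integrable_smul_left_of_hasCompactSupport hφ.continuous hc),
      neg_injective e, sub_self]
  filter_upwards [h0] with x hx
  exact sub_eq_zero.1 hx

theorem exists_eq_zero_off_ball {F : Type*} [Zero F] {φ : Plane → F} (hc : HasCompactSupport φ) :
    ∃ R, ∀ x ∉ Metric.ball (0 : Plane) R, φ x = 0 := by
  obtain ⟨R, hR⟩ := hc.isCompact.isBounded.subset_ball 0
  exact ⟨R, fun x hx => image_eq_zero_of_notMem_tsupport fun h => hx (hR h)⟩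

theorem integral_apply_of_integrable {α : Type*} [MeasurableSpace α] {μ : Measure α} {F : α → Amb}
    (hF : Integrable F μ) (i : Fin 3) : (∫ x, F x ∂μ) i = ∫ x, F x i ∂μ :=
  ((ContinuousLinearMap.proj (R := ℝ) (φ := fun _ : Fin 3 => ℝ) i).integral_comp_comm hF).symm

theorem memLp_smul_const {φ : Plane → ℝ} (hφ : Continuous φ) (hc : HasCompactSupport φ) (p : ℝ≥0∞)
    (μ : Measure Plane) [IsFiniteMeasureOnCompacts μ] (w : Amb) : MemLp (fun x => φ x • w) p μ :=
  (hφ.smul continuous_const).memLp_of_hasCompactSupport hc.smul_right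

/-- Component `i` is tested with `φ` times a basis vector, constant along the sequence. The
exponents `4` and `4` are just one admissible pair. -/
theorem FieldTendsto.tendsto_integral_smul {Ds : ℕ → Plane → Amb} {D : Plane → Amb}
    (h : FieldTendsto Ds D) (hDs : ∀ k, LocallyIntegrable (Ds k)) (hD : LocallyIntegrable D)
    {φ : Plane → ℝ} (hφ : Continuous φ) (hc : HasCompactSupport φ) :
    Tendsto (fun k => ∫ x, φ x • Ds k x) atTop (𝓝 (∫ x, φ x • D x)) := by
  rw [tendsto_pi_nhds]
  intro i
  obtain ⟨R, hR⟩ := exists_eq_zero_off_ball hc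
  have : (4 : ℝ≥0∞).HolderTriple 4 2 := ⟨by
    rw [← ENNReal.toReal_eq_toReal_iff' (by simp) (by simp), ENNReal.toReal_add (by simp) (by simp)]
    norm_num⟩
  have key := h 4 4 this (by simp) (Metric.ball 0 R) R measurableSet_ball subset_rfl
    (fun _ x => φ x • Pi.single i 1) (fun x => φ x • Pi.single i 1)
    (fun _ => memLp_smul_const hφ hc _ _ _) (memLp_smul_const hφ hc _ _ _) (by simp)
  have e : ∀ G : Plane → Amb, LocallyIntegrable G →
      ∫ x in Metric.ball 0 R, G x ⬝ᵥ (φ x • Pi.single i (1 : ℝ)) = (∫ x, φ x • G x) i := by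
    intro G hG
    rw [integral_apply_of_integrable (hG.integrable_smul_left_of_hasCompactSupport hφ hc)]
    rw [setIntegral_eq_integral_of_forall_compl_eq_zero fun x hx => by rw [hR x hx]; simp]
    simp [dotProduct_smul]
  rw [← e D hD]
  exact key.congr fun k => e _ (hDs k)

/-- Products of a strongly and a weakly convergent sequence. -/
theorem FieldTendsto.tendsto_integral_cross {Ds : ℕ → Plane → Amb} {D : Plane → Amb}
    (h : FieldTendsto Ds D) {fs : ℕ → Plane → Amb} {f : Plane → Amb}
    (hfs : ∀ k, LocallyIntegrable fun x => crossProduct (fs k x) (Ds k x))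
    (hf : LocallyIntegrable fun x => crossProduct (f x) (D x))
    (hfsm : ∀ R k, MemLp (fs k) 4 (volume.restrict (Metric.ball 0 R)))
    (hfm : ∀ R, MemLp f 4 (volume.restrict (Metric.ball 0 R)))
    (hlim : ∀ R, Tendsto (fun k => eLpNorm (fs k - f) 4 (volume.restrict (Metric.ball 0 R))) atTop
      (𝓝 0)) {φ : Plane → ℝ} (hφ : Continuous φ) (hc : HasCompactSupport φ) :
    Tendsto (fun k => ∫ x, φ x • crossProduct (fs k x) (Ds k x)) atTop
      (𝓝 (∫ x, φ x • crossProduct (f x) (D x))) := by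
  rw [tendsto_pi_nhds]
  intro i
  obtain ⟨R, hR⟩ := exists_eq_zero_off_ball hc
  obtain ⟨M, hM⟩ := hφ.bounded_above_of_compact_support hc
  have : (4 : ℝ≥0∞).HolderTriple 4 2 := ⟨by
    rw [← ENNReal.toReal_eq_toReal_iff' (by simp) (by simp), ENNReal.toReal_add (by simp) (by simp)]
    norm_num⟩
  have hb : ∀ (w : Amb) x, ‖crossL (φ x • Pi.single i 1) w‖ ≤ 2 * M * ‖w‖ := fun w x => by
    rw [crossL_apply]
    refine (norm_crossProduct_le _ _).trans ?_
    rw [norm_smul, Pi.norm_single, norm_one, mul_one]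
    have := hM x
    gcongr
  have hmem : ∀ g : Plane → Amb, MemLp g 4 (volume.restrict (Metric.ball 0 R)) →
      MemLp (fun x => crossL (φ x • Pi.single i 1) (g x)) 4 (volume.restrict (Metric.ball 0 R)) :=
    fun g hg => hg.of_le_mul (crossL.aestronglyMeasurable_comp₂
      (hφ.smul continuous_const).aestronglyMeasurable hg.1) (Eventually.of_forall fun x => hb _ x)
  -- By the triple product identity `φ eᵢ · (f × D) = D · (φ eᵢ × f)`, the strongly convergent map
  -- moves to the test side, where it converges in `L⁴`.
  have key := h 4 4 this (by simp) (Metric.ball 0 R) R measurableSet_ball subset_rfl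
    (fun k x => crossL (φ x • Pi.single i 1) (fs k x)) (fun x => crossL (φ x • Pi.single i 1) (f x))
    (fun k => hmem _ (hfsm R k)) (hmem _ (hfm R)) ?_
  · have e : ∀ g G : Plane → Amb, (LocallyIntegrable fun x => crossProduct (g x) (G x)) →
        ∫ x in Metric.ball 0 R, G x ⬝ᵥ crossL (φ x • Pi.single i (1 : ℝ)) (g x) =
          (∫ x, φ x • crossProduct (g x) (G x)) i := by
      intro g G hG
      rw [integral_apply_of_integrable (hG.integrable_smul_left_of_hasCompactSupport hφ hc)]
      rw [setIntegral_eq_integral_of_forall_compl_eq_zero fun x hx => by rw [hR x hx]; simp]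
      refine integral_congr_ae (Eventually.of_forall fun x => ?_)
      beta_reduce
      rw [crossL_apply, map_smul, LinearMap.smul_apply, dotProduct_smul,
        triple_product_permutation, single_one_dotProduct, Pi.smul_apply]
    rw [← e f D hf]
    exact key.congr fun k => e _ _ (hfs k)
  · have h0 : Tendsto (fun k => ENNReal.ofReal (2 * M) *
        eLpNorm (fs k - f) 4 (volume.restrict (Metric.ball 0 R))) atTop (𝓝 0) := by
      have := ENNReal.Tendsto.const_mul (a := ENNReal.ofReal (2 * M)) (hlim R)
        (Or.inr ENNReal.ofReal_ne_top)
      rwa [mul_zero] at this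
    refine tendsto_of_tendsto_of_tendsto_of_le_of_le tendsto_const_nhds h0 (fun _ => zero_le)
      fun k => ?_
    refine eLpNorm_le_mul_eLpNorm_of_ae_le_mul (Eventually.of_forall fun x => ?_) _
    simp only [Pi.sub_apply]
    rw [← map_sub]
    exact hb _ x

namespace IsSliceLimit

variable {C : ℝ≥0} {fs : ℕ → Plane → Amb} {f : Plane → Amb}

theorem tendsto_integral_smul (h : IsSliceLimit C fs f) {φ : Plane → ℝ} (hφ : Continuous φ)
    (hc : HasCompactSupport φ) :
    Tendsto (fun k => ∫ x, φ x • fs k x) atTop (𝓝 (∫ x, φ x • f x)) := by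
  obtain ⟨R, hR⟩ := exists_eq_zero_off_ball hc
  obtain ⟨M, hM⟩ := hφ.bounded_above_of_compact_support hc
  have hi := fun k => integrable_smul_of_hasCompactSupport hφ hc (μ := volume)
    (h.slice k).smooth.continuous
  have hi' := (h.hasLpBounds.locallyIntegrable h.meas).integrable_smul_left_of_hasCompactSupport hφ hc
  refine tendsto_integral_of_L1 _ hi'.1 (Eventually.of_forall hi) ?_
  have h0 : Tendsto (fun k => ENNReal.ofReal M * ∫⁻ x in Metric.ball (0 : Plane) R,
      ‖fs k x - f x‖ₑ) atTop (𝓝 0) := by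
    simpa using ENNReal.Tendsto.const_mul (h.tendsto R) (Or.inr ENNReal.ofReal_ne_top)
  refine tendsto_of_tendsto_of_tendsto_of_le_of_le tendsto_const_nhds h0 (fun _ => zero_le)
    fun k => ?_
  have hm : AEMeasurable (fun x => ‖fs k x - f x‖ₑ) (volume.restrict (Metric.ball (0 : Plane) R)) :=
    ((h.slice k).smooth.continuous.aestronglyMeasurable.sub h.meas).enorm.restrict
  rw [← lintegral_const_mul'' _ hm, ← lintegral_indicator measurableSet_ball]
  refine lintegral_mono fun x => ?_
  by_cases hx : x ∈ Metric.ball (0 : Plane) R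
  · rw [Set.indicator_of_mem hx, ← smul_sub, enorm_smul]
    gcongr
    rw [← ofReal_norm]
    exact ENNReal.ofReal_le_ofReal (hM x)
  · simp [hR x hx]

theorem isWeakPartial (h : IsSliceLimit C fs f) {D : Plane → Amb} {l : Fin 2}
    (hD : LocallyIntegrable D) (hlim : FieldTendsto (fun k => partialDeriv l (fs k)) D) :
    IsWeakPartial l f D where
  locInt_left := h.hasLpBounds.locallyIntegrable h.meas
  locInt_right := hD
  integral_eq φ hφ hc := by
    have h1 := hlim.tendsto_integral_smul
      (fun k => (continuous_partialDeriv (h.slice k).smooth l).locallyIntegrable) hD hφ.continuous hc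
    have h2 := (h.tendsto_integral_smul (continuous_partialDeriv hφ l) (hc.fderiv_apply ℝ _)).neg
    have h3 := tendsto_nhds_unique (h1.congr fun k =>
      integral_smul_partialDeriv hφ hc (h.slice k).smooth l) h2
    rw [h3, neg_neg]

/-- The limit has a weak gradient, to which the gradients converge weakly. -/
theorem exists_isWeakPartial (h : IsSliceLimit C fs f) :
    ∃ D : Fin 2 → Plane → Amb, IsFieldPair C f D ∧ ∀ l, IsWeakPartial l f (D l) ∧
      FieldTendsto (fun k => partialDeriv l (fs k)) (D l) := by
  have key : ∀ {gs : ℕ → Plane → Amb}, IsSliceLimit C gs f → ∃ (D : Fin 2 → Plane → Amb) (τ : ℕ → ℕ),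
      StrictMono τ ∧ IsFieldPair C f D ∧ (∀ l, IsWeakPartial l f (D l)) ∧
      ∀ l, FieldTendsto (fun k => partialDeriv l (gs (τ k))) (D l) := fun {gs} hg => by
    obtain ⟨D, τ, hτ, hp, hD⟩ := hg.exists_fieldTendsto
    exact ⟨D, τ, hτ, hp, fun l => (hg.comp hτ.tendsto_atTop).isWeakPartial
      (hp.locallyIntegrable h.hasLpBounds l) (hD l), hD⟩
  obtain ⟨D, -, -, hp, hw, -⟩ := key h
  refine ⟨D, hp, fun l => ⟨hw l, ?_⟩⟩
  intro s r hsr hs K R hK hKR χs χ hχs hχ hlim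
  -- Every subsequence has a further one whose gradients converge weakly to a weak gradient of `f`.
  -- That gradient is unique almost everywhere, so the whole sequence converges. This is why one
  -- subsequence can serve all times.
  refine tendsto_of_subseq_tendsto fun ns hns => ?_
  obtain ⟨D', τ, hτ, -, hw', hD'⟩ := key (h.comp hns)
  exact ⟨τ, (hD' l).congr ((hw' l).ae_eq (hw l)) s r hsr hs K R hK hKR _ χ
    (fun k => hχs (ns (τ k))) hχ (hlim.comp (hns.comp hτ.tendsto_atTop))⟩

theorem tendsto_integral_cross (h : IsSliceLimit C fs f) {D : Fin 2 → Plane → Amb}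
    (hp : IsFieldPair C f D) {l : Fin 2}
    (hD : FieldTendsto (fun k => partialDeriv l (fs k)) (D l)) {φ : Plane → ℝ} (hφ : Continuous φ)
    (hc : HasCompactSupport φ) :
    Tendsto (fun k => ∫ x, φ x • crossProduct (fs k x) (partialDeriv l (fs k) x)) atTop
      (𝓝 (∫ x, φ x • crossProduct (f x) (D l x))) :=
  hD.tendsto_integral_cross
    (fun k => (h.slice k).isFieldPair.locallyIntegrable_cross (h.slice k).hasLpBounds l)
    (hp.locallyIntegrable_cross h.hasLpBounds l)
    (fun _ k => (h.slice k).hasLpBounds.memLp (h.slice k).smooth.continuous.aestronglyMeasurable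
      (by simp) measurableSet_ball measure_ball_lt_top.ne)
    (fun _ => h.hasLpBounds.memLp h.meas (by simp) measurableSet_ball measure_ball_lt_top.ne)
    (fun _ => h.tendsto_eLpNorm measurableSet_ball subset_rfl (by norm_num) (by simp)) hφ hc

end IsSliceLimit

/-! ### Joint measurability of the weak gradient -/

theorem mollify_eq_convolution {F : Type*} [NormedAddCommGroup F] [NormedSpace ℝ F] (n : ℕ)
    (f : Plane → F) :
    mollify n f = convolution (moll n) f (ContinuousLinearMap.lsmul ℝ ℝ) volume := by
  funext x
  rw [mollify_eq]
  rfl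

theorem continuous_mollify {F : Type*} [NormedAddCommGroup F] [NormedSpace ℝ F] (n : ℕ)
    {f : Plane → F} (hf : LocallyIntegrable f) : Continuous (mollify n f) := by
  rw [mollify_eq_convolution]
  exact HasCompactSupport.continuous_convolution_left (ContinuousLinearMap.lsmul ℝ ℝ)
    (hasCompactSupport_moll n) (contDiff_moll n).continuous hf

theorem ae_tendsto_mollify {F : Type*} [NormedAddCommGroup F] [NormedSpace ℝ F] [CompleteSpace F]
    {f : Plane → F} (hf : LocallyIntegrable f) :
    ∀ᵐ x, Tendsto (fun n => mollify n f x) atTop (𝓝 (f x)) := by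
  have h0 : Tendsto (fun n => (mollBump n).rOut) atTop (𝓝 0) :=
    tendsto_one_div_add_atTop_nhds_zero_nat
  -- The ratio of outer to inner radius is always `2`, the boundedness required for Lebesgue
  -- differentiation along these bumps.
  have hK : ∀ᶠ n in atTop, (mollBump n).rOut ≤ 2 * (mollBump n).rIn :=
    Eventually.of_forall fun n => by
      have : (0 : ℝ) < n + 1 := by positivity
      simp only [mollBump]
      apply le_of_eq
      field_simp
  filter_upwards [ContDiffBump.ae_convolution_tendsto_right_of_locallyIntegrable h0 hK hf]
    with x hx
  simp only [mollify_eq_convolution]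
  exact hx

theorem stronglyMeasurable_of_continuous_slice {F : Type*} [TopologicalSpace F]
    [TopologicalSpace.PseudoMetrizableSpace F] {M : ℝ → Plane → F}
    (hM : ∀ t, Continuous (M t)) (hM' : ∀ x, StronglyMeasurable fun t => M t x) :
    StronglyMeasurable fun z : SpaceTime => M z.1 z.2 :=
  (stronglyMeasurable_uncurry_of_continuous_of_stronglyMeasurable
    (u := fun (x : Plane) (t : ℝ) => M t x) hM hM').comp_measurable measurable_swap

/-- A family of locally integrable functions depending measurably on a parameter in the sense of
distributions has a jointly measurable version. -/
theorem exists_stronglyMeasurable_version {F : Type*} [NormedAddCommGroup F] [NormedSpace ℝ F]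
    [FiniteDimensional ℝ F] {G : ℝ → Plane → F} (hG : ∀ t, LocallyIntegrable (G t))
    (hmeas : ∀ φ : Plane → ℝ, ContDiff ℝ ∞ φ → HasCompactSupport φ →
      StronglyMeasurable fun t => ∫ x, φ x • G t x) :
    ∃ g : SpaceTime → F, StronglyMeasurable g ∧ ∀ t, (fun x => g (t, x)) =ᵐ[volume] G t := by
  have : CompleteSpace F := FiniteDimensional.complete ℝ F
  -- A mollification is continuous in `x` and, being a pairing with a test function, measurable in
  -- `t`, hence jointly measurable. Lebesgue differentiation recovers `G t` almost everywhere as the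
  -- scale shrinks.
  have hV : ∀ n, StronglyMeasurable fun z : SpaceTime => mollify n (G z.1) z.2 := fun n =>
    stronglyMeasurable_of_continuous_slice (M := fun t x => mollify n (G t) x)
      (fun t => continuous_mollify n (hG t))
      fun x => hmeas _ (contDiff_moll_sub n x) (hasCompactSupport_moll_sub n x)
  refine ⟨fun z => limUnder atTop fun n => mollify n (G z.1) z.2, StronglyMeasurable.limUnder hV,
    fun t => ?_⟩
  filter_upwards [ae_tendsto_mollify (hG t)] with x hx
  exact hx.limUnder_eq

/-! ### Passage to the limit in integrals over space-time -/

section Slices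

variable {E : Type*} [NormedAddCommGroup E]

theorem integrable_prod_of_slices {μ : Measure ℝ} {ν : Measure Plane} [SFinite ν] [SFinite μ]
    {F : SpaceTime → E} (hF : AEStronglyMeasurable F (μ.prod ν)) {b : ℝ → ℝ≥0∞}
    (hb : ∫⁻ t, b t ∂μ ≠ ⊤) (hFb : ∀ᵐ t ∂μ, ∫⁻ x, ‖F (t, x)‖ₑ ∂ν ≤ b t) :
    Integrable F (μ.prod ν) := by
  refine ⟨hF, ?_⟩
  rw [hasFiniteIntegral_iff_enorm, lintegral_prod _ hF.enorm]
  exact (lintegral_mono_ae hFb).trans_lt hb.lt_top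

/-- Dominated convergence is applied in `t` alone, to the inner integrals. Weak convergence of the
slices is enough, with no pointwise convergence in `x`. -/
theorem tendsto_integral_of_slices [NormedSpace ℝ E] [CompleteSpace E] {μ : Measure ℝ}
    {ν : Measure Plane} [SFinite μ] [SFinite ν]
    {Fs : ℕ → SpaceTime → E} {F : SpaceTime → E}
    (hFs : ∀ k, AEStronglyMeasurable (Fs k) (μ.prod ν)) (hF : AEStronglyMeasurable F (μ.prod ν))
    {b : ℝ → ℝ≥0∞} (hbm : AEMeasurable b μ) (hb : ∫⁻ t, b t ∂μ ≠ ⊤)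
    (hFsb : ∀ k, ∀ᵐ t ∂μ, ∫⁻ x, ‖Fs k (t, x)‖ₑ ∂ν ≤ b t)
    (hFb : ∀ᵐ t ∂μ, ∫⁻ x, ‖F (t, x)‖ₑ ∂ν ≤ b t)
    (hlim : ∀ᵐ t ∂μ, Tendsto (fun k => ∫ x, Fs k (t, x) ∂ν) atTop (𝓝 (∫ x, F (t, x) ∂ν))) :
    Tendsto (fun k => ∫ z, Fs k z ∂(μ.prod ν)) atTop (𝓝 (∫ z, F z ∂(μ.prod ν))) := by
  rw [integral_prod _ (integrable_prod_of_slices hF hb hFb)]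
  simp_rw [fun k => integral_prod _ (integrable_prod_of_slices (hFs k) hb (hFsb k))]
  refine tendsto_integral_of_dominated_convergence (fun t => (b t).toReal)
    (fun k => (hFs k).integral_prod_right') (integrable_toReal_of_lintegral_ne_top hbm hb)
    (fun k => ?_) hlim
  filter_upwards [hFsb k, ae_lt_top' hbm hb] with t ht htop
  have h := (enorm_integral_le_lintegral_enorm (μ := ν) fun x => Fs k (t, x)).trans ht
  rw [← ofReal_norm] at h
  exact (ENNReal.ofReal_le_iff_le_toReal htop.ne).1 h

theorem exists_slab_of_hasCompactSupport {F : Type*} [Zero F] {χ : SpaceTime → F}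
    (hc : HasCompactSupport χ) : ∃ R : ℝ, ∀ t x, t ∉ Metric.ball 0 R ∨ x ∉ Metric.ball 0 R →
      χ (t, x) = 0 := by
  obtain ⟨R, hR⟩ := hc.isCompact.isBounded.subset_ball 0
  refine ⟨R, fun t x h => image_eq_zero_of_notMem_tsupport fun hz => ?_⟩
  have := hR hz
  rw [← Prod.mk_zero_zero, ← ball_prod_same] at this
  exact h.elim (fun h => h this.1) fun h => h this.2

/-- Uniform bounds in `L¹_loc` of all time slices. -/
def SliceBounded (F : SpaceTime → E) (B : ℝ → ℝ≥0) : Prop :=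
  ∀ t R, ∫⁻ x in Metric.ball (0 : Plane) R, ‖F (t, x)‖ₑ ≤ B R

theorem SliceBounded.lintegral_smul_le [NormedSpace ℝ E] {F : SpaceTime → E} {B : ℝ → ℝ≥0}
    (h : SliceBounded F B) {χ : SpaceTime → ℝ} {M R : ℝ} (hM : ∀ z, ‖χ z‖ ≤ M)
    (hR : ∀ t x, t ∉ Metric.ball 0 R ∨ x ∉ Metric.ball 0 R → χ (t, x) = 0) (t : ℝ) :
    ∫⁻ x, ‖χ (t, x) • F (t, x)‖ₑ ≤
      (Metric.ball (0 : ℝ) R).indicator (fun _ => ENNReal.ofReal M * B R) t := by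
  by_cases ht : t ∈ Metric.ball (0 : ℝ) R
  · rw [Set.indicator_of_mem ht]
    calc _ ≤ ∫⁻ x, (Metric.ball (0 : Plane) R).indicator
          (fun x => ENNReal.ofReal M * ‖F (t, x)‖ₑ) x := by
          refine lintegral_mono fun x => ?_
          by_cases hx : x ∈ Metric.ball (0 : Plane) R
          · rw [Set.indicator_of_mem hx, enorm_smul]
            gcongr
            rw [← ofReal_norm]
            exact ENNReal.ofReal_le_ofReal (hM _)
          · simp [hR t x (Or.inr hx)]
      _ = ENNReal.ofReal M * ∫⁻ x in Metric.ball (0 : Plane) R, ‖F (t, x)‖ₑ := by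
          rw [lintegral_indicator measurableSet_ball,
            lintegral_const_mul' _ _ ENNReal.ofReal_ne_top]
      _ ≤ _ := by
          gcongr
          exact h t R
  · simp [hR t _ (Or.inl ht)]

theorem lintegral_indicator_ball_ne_top (R M : ℝ) (B : ℝ≥0) :
    ∫⁻ t, (Metric.ball (0 : ℝ) R).indicator (fun _ => ENNReal.ofReal M * B) t ≠ ⊤ := by
  rw [lintegral_indicator measurableSet_ball, setLIntegral_const]
  exact ENNReal.mul_ne_top (ENNReal.mul_ne_top ENNReal.ofReal_ne_top ENNReal.coe_ne_top)
    measure_ball_lt_top.ne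

theorem SliceBounded.locallyIntegrable {F : SpaceTime → E} {B : ℝ → ℝ≥0}
    (h : SliceBounded F B) (hF : AEStronglyMeasurable F) : LocallyIntegrable F := by
  rw [locallyIntegrable_iff]
  intro K hK
  obtain ⟨R, hR⟩ := hK.isBounded.subset_ball 0
  rw [← Prod.mk_zero_zero, ← ball_prod_same] at hR
  refine IntegrableOn.mono_set ?_ hR
  rw [IntegrableOn, Measure.volume_eq_prod, ← Measure.prod_restrict]
  refine integrable_prod_of_slices (b := fun _ => B R) ?_ ?_ (Eventually.of_forall fun t => h t R)
  · rw [Measure.prod_restrict, ← Measure.volume_eq_prod]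
    exact hF.restrict
  · rw [setLIntegral_const]
    exact ENNReal.mul_ne_top ENNReal.coe_ne_top measure_ball_lt_top.ne

theorem SliceBounded.tendsto_integral_smul [NormedSpace ℝ E] [CompleteSpace E]
    {Fs : ℕ → SpaceTime → E} {F : SpaceTime → E} {B : ℝ → ℝ≥0} (hFsB : ∀ k, SliceBounded (Fs k) B)
    (hFB : SliceBounded F B) (hFs : ∀ k, AEStronglyMeasurable (Fs k)) (hF : AEStronglyMeasurable F)
    (hlim : ∀ (t : ℝ) (φ : Plane → ℝ), Continuous φ → HasCompactSupport φ →
      Tendsto (fun k => ∫ x, φ x • Fs k (t, x)) atTop (𝓝 (∫ x, φ x • F (t, x))))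
    {χ : SpaceTime → ℝ} (hχ : Continuous χ) (hc : HasCompactSupport χ) :
    Tendsto (fun k => ∫ z, χ z • Fs k z) atTop (𝓝 (∫ z, χ z • F z)) := by
  obtain ⟨M, hM⟩ := hχ.bounded_above_of_compact_support hc
  obtain ⟨R, hR⟩ := exists_slab_of_hasCompactSupport hc
  refine tendsto_integral_of_slices (fun k => hχ.aestronglyMeasurable.smul (hFs k))
    (hχ.aestronglyMeasurable.smul hF) (measurable_const.indicator measurableSet_ball).aemeasurable
    (lintegral_indicator_ball_ne_top R M (B R))
    (fun k => Eventually.of_forall fun t => (hFsB k).lintegral_smul_le hM hR t)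
    (Eventually.of_forall fun t => hFB.lintegral_smul_le hM hR t)
    (Eventually.of_forall fun t => hlim t _ (hχ.comp (by fun_prop)) ?_)
  refine HasCompactSupport.of_support_subset_isCompact (isCompact_closedBall (0 : Plane) R)
    fun x hx => ?_
  by_contra hx'
  exact hx (hR t x (Or.inr fun h => hx' (Metric.ball_subset_closedBall h)))

end Slices

/-! ### Weak-* convergence -/

theorem holderTriple_of_two_lt {r : ℝ≥0∞} (hr : 2 < r) :
    ∃ s : ℝ≥0∞, s.HolderTriple r 2 ∧ s ≠ ⊤ := by
  have h2 : r⁻¹ < (2 : ℝ≥0∞)⁻¹ := ENNReal.inv_lt_inv.2 hr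
  refine ⟨(2⁻¹ - r⁻¹)⁻¹, ⟨by rw [inv_inv, tsub_add_cancel_of_le h2.le]⟩, ?_⟩
  rw [ENNReal.inv_ne_top]
  exact (tsub_pos_of_lt h2).ne'

theorem two_lt_conjExponent {p : ℝ≥0∞} (hp : 1 ≤ p) (hp2 : p < 2) : 2 < p.conjExponent := by
  have h := (ENNReal.HolderConjugate.conjExponent hp).inv_add_inv_eq_one
  rw [← ENNReal.inv_lt_inv]
  by_contra! hle
  have h2 : (2 : ℝ≥0∞)⁻¹ < p⁻¹ := ENNReal.inv_lt_inv.2 hp2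
  have := ENNReal.add_lt_add_of_lt_of_le (by simp) h2 hle
  rw [h, ENNReal.inv_two_add_inv_two] at this
  exact lt_irrefl _ this

theorem conjExponent_lt_two {r : ℝ≥0∞} (hr : 2 < r) : r.conjExponent < 2 := by
  have h := (ENNReal.HolderConjugate.conjExponent (one_le_two.trans hr.le)).inv_add_inv_eq_one
  rw [← ENNReal.inv_lt_inv]
  by_contra! hle
  have h2 : r⁻¹ < (2 : ℝ≥0∞)⁻¹ := ENNReal.inv_lt_inv.2 hr
  have := ENNReal.add_lt_add_of_lt_of_le (ne_top_of_le_ne_top (by simp) hle) h2 hle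
  rw [h, ENNReal.inv_two_add_inv_two] at this
  exact lt_irrefl _ this

theorem lintegral_enorm_dot_le {q r : ℝ≥0∞} [q.HolderConjugate r] {μ : Measure Plane}
    {f χ : Plane → Amb} (hf : AEStronglyMeasurable f μ) (hχ : AEStronglyMeasurable χ μ) :
    ∫⁻ x, ‖f x ⬝ᵥ χ x‖ₑ ∂μ ≤ 3 * eLpNorm f q μ * eLpNorm χ r μ := by
  rw [← eLpNorm_one_eq_lintegral_enorm]
  exact eLpNorm_le_eLpNorm_mul_eLpNorm'_of_norm hf hχ (fun v w => v ⬝ᵥ w) 3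
    (Eventually.of_forall fun x => abs_dotProduct_le _ _)

theorem aemeasurable_eLpNorm_slice {μ : Measure ℝ} {ν : Measure Plane} [SFinite ν] [SFinite μ]
    {ψ : SpaceTime → Amb} (hψ : AEStronglyMeasurable ψ (μ.prod ν)) {r : ℝ≥0∞} (hr0 : r ≠ 0)
    (hr : r ≠ ⊤) : AEMeasurable (fun t => eLpNorm (fun x => ψ (t, x)) r ν) μ := by
  simp only [eLpNorm_eq_lintegral_rpow_enorm_toReal hr0 hr]
  exact (hψ.enorm.pow_const r.toReal).lintegral_prod_right'.pow_const _

/-- Weak-* convergence from weak convergence at each time. -/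
theorem tendstoWeakStarLp_of_slices {p : ℝ≥0∞} (hp : 1 ≤ p) (hp2 : p < 2)
    {fs : ℕ → SpaceTime → Amb} {f : SpaceTime → Amb} (hfs : ∀ k, AEStronglyMeasurable (fs k))
    (hf : AEStronglyMeasurable f)
    (hB : ∀ q < 2, ∀ K : Set Plane, IsCompact K → ∃ B : ℝ≥0,
      (∀ k t, eLpNorm (fun x => fs k (t, x)) q (volume.restrict K) ≤ B) ∧
      ∀ t, eLpNorm (fun x => f (t, x)) q (volume.restrict K) ≤ B)
    (hlim : ∀ t r, 2 < r → r ≠ ⊤ → ∀ K : Set Plane, IsCompact K → ∀ χ : Plane → Amb,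
      MemLp χ r (volume.restrict K) → Tendsto (fun k => ∫ x in K, fs k (t, x) ⬝ᵥ χ x) atTop
        (𝓝 (∫ x in K, f (t, x) ⬝ᵥ χ x))) : TendstoWeakStarLp p fs f := by
  intro K hK ψ hψ hψfin
  -- For `p = 1` the conjugate exponent is `⊤`. Capping at `4` keeps `r` finite and above `2`, and
  -- `ψ(t)` remains in `Lʳ(K)` because `K` has finite measure.
  set r := min p.conjExponent 4 with hr
  have hr2 : 2 < r := lt_min (two_lt_conjExponent hp hp2) (by norm_num)
  have hrt : r ≠ ⊤ := ne_top_of_le_ne_top (by simp) (min_le_right _ _)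
  have hr0 : r ≠ 0 := (pos_of_gt hr2).ne'
  have hconj : r.conjExponent.HolderConjugate r :=
    (ENNReal.HolderConjugate.conjExponent (one_le_two.trans hr2.le)).symm
  obtain ⟨B, hBs, hB⟩ := hB _ (conjExponent_lt_two hr2) K hK
  have hrestr : ∀ {G : SpaceTime → Amb}, AEStronglyMeasurable G →
      AEStronglyMeasurable G ((volume : Measure ℝ).prod (volume.restrict K)) := fun {G} hG => by
    have : (volume : Measure ℝ).prod (volume.restrict K) =
        (volume : Measure SpaceTime).restrict (Set.univ ×ˢ K) := by
      rw [Measure.volume_eq_prod, ← Measure.prod_restrict, Measure.restrict_univ]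
    rw [this]
    exact hG.restrict
  have hψ' := hrestr hψ
  have hbm := aemeasurable_eLpNorm_slice hψ' hr0 hrt
  have hV : volume K ≠ ⊤ := hK.measure_lt_top.ne
  have hbfin : ∫⁻ t, eLpNorm (fun x => ψ (t, x)) r (volume.restrict K) ≠ ⊤ := by
    have hc : (volume.restrict K) Set.univ ^ (1 / r.toReal - 1 / p.conjExponent.toReal) ≠ ⊤ := by
      rw [Measure.restrict_apply_univ]
      refine ENNReal.rpow_ne_top_of_nonneg ?_ hV
      by_cases ht : p.conjExponent = ⊤
      · simp [ht]
      · rw [sub_nonneg]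
        exact one_div_le_one_div_of_le (ENNReal.toReal_pos hr0 hrt)
          (ENNReal.toReal_mono ht (min_le_left _ _))
    refine ne_top_of_le_ne_top ?_ (lintegral_mono_ae (g := fun t =>
      eLpNorm (fun x => ψ (t, x)) p.conjExponent (volume.restrict K) *
        (volume.restrict K) Set.univ ^ (1 / r.toReal - 1 / p.conjExponent.toReal)) ?_)
    · rw [lintegral_mul_const' _ _ hc]
      exact ENNReal.mul_ne_top hψfin.ne hc
    · filter_upwards [hψ'.prodMk_left] with t ht
      exact eLpNorm_le_eLpNorm_mul_rpow_measure_univ (min_le_left _ _) ht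
  have hdot : ∀ {G : SpaceTime → Amb}, AEStronglyMeasurable G →
      AEStronglyMeasurable (fun z => G z ⬝ᵥ ψ z)
        ((volume : Measure ℝ).prod (volume.restrict K)) := fun {G} hG =>
    AEStronglyMeasurable.measurable_comp₂ measurable_dotProduct (hrestr hG) hψ'
  have hle : ∀ {G : SpaceTime → Amb}, AEStronglyMeasurable G →
      (∀ t, eLpNorm (fun x => G (t, x)) r.conjExponent (volume.restrict K) ≤ B) →
      ∀ᵐ t, ∫⁻ x in K, ‖G (t, x) ⬝ᵥ ψ (t, x)‖ₑ ≤
        3 * B * eLpNorm (fun x => ψ (t, x)) r (volume.restrict K) := fun {G} hG hGB => by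
    filter_upwards [(hrestr hG).prodMk_left, hψ'.prodMk_left] with t h1 h2
    refine (lintegral_enorm_dot_le (q := r.conjExponent) (r := r) h1 h2).trans ?_
    gcongr
    exact hGB t
  have hset : ∀ G : SpaceTime → ℝ, ∫ z in (Set.univ : Set ℝ) ×ˢ K, G z =
      ∫ z, G z ∂((volume : Measure ℝ).prod (volume.restrict K)) := fun G => by
    rw [Measure.volume_eq_prod, ← Measure.prod_restrict, Measure.restrict_univ]
  simp only [hset]
  refine tendsto_integral_of_slices (fun k => hdot (hfs k)) (hdot hf) (hbm.const_mul (3 * B)) ?_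
    (fun k => hle (hfs k) (hBs k)) (hle hf hB) ?_
  · rw [lintegral_const_mul' _ _ (ENNReal.mul_ne_top (by simp) ENNReal.coe_ne_top)]
    exact ENNReal.mul_ne_top (ENNReal.mul_ne_top (by simp) ENNReal.coe_ne_top) hbfin
  · filter_upwards [hψ'.prodMk_left, ae_lt_top' hbm hbfin] with t h1 h2
    exact hlim t r hr2 hrt K hK _ ⟨h1, h2⟩

/-! ### Limits of sequences of smooth Schrödinger maps -/

/-- `v`, with weak gradient `Dv`, is the limit at each time of the smooth Schrödinger maps `us`. -/
structure IsFlowLimit (C : ℝ≥0) (us : ℕ → SpaceTime → Amb) (v : SpaceTime → Amb)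
    (Dv : Fin 2 → SpaceTime → Amb) : Prop where
  sol : ∀ k, IsSmoothSchrodingerMap (us k)
  meas : StronglyMeasurable v
  meas_grad : ∀ l, StronglyMeasurable (Dv l)
  lim : ∀ t, IsSliceLimit C (fun k x => us k (t, x)) fun x => v (t, x)
  pair : ∀ t, IsFieldPair C (fun x => v (t, x)) fun l x => Dv l (t, x)
  weak : ∀ l t, IsWeakPartial l (fun x => v (t, x)) fun x => Dv l (t, x)
  field : ∀ l t, FieldTendsto (fun k => partialDeriv l fun x => us k (t, x)) fun x => Dv l (t, x)
  cont : ∀ t R, Tendsto (fun s => ∫⁻ x in Metric.ball (0 : Plane) R, ‖v (s, x) - v (t, x)‖ₑ)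
    (𝓝 t) (𝓝 0)

theorem exists_isFlowLimit {C : ℝ≥0} {u : ℕ → SpaceTime → Amb}
    (hsol : ∀ j, IsSmoothSchrodingerMap (u j)) (hsl : ∀ j t, IsSlice C fun x => u j (t, x)) :
    ∃ (σ : ℕ → ℕ) (v : SpaceTime → Amb) (Dv : Fin 2 → SpaceTime → Amb), StrictMono σ ∧
      IsFlowLimit C (fun j => u (σ j)) v Dv := by
  obtain ⟨σ, v, hσ, hv, hlim, hcont⟩ := exists_subseq_tendsto hsol hsl
  have hL : ∀ t, IsSliceLimit C (fun k x => u (σ k) (t, x)) fun x => v (t, x) := fun t =>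
    ⟨fun k => hsl _ t, (hv.comp_measurable measurable_prodMk_left).aestronglyMeasurable, hlim t⟩
  choose D hp hD using fun t => (hL t).exists_isWeakPartial
  -- The gradients `D t` were chosen separately at each time, with no regularity in `t`. Their
  -- pairings with test functions are measurable nevertheless, since they equal minus the pairings
  -- of `∂ₗ φ` with `v`.
  have hver : ∀ l, ∃ g : SpaceTime → Amb, StronglyMeasurable g ∧
      ∀ t, (fun x => g (t, x)) =ᵐ[volume] D t l := fun l =>
    exists_stronglyMeasurable_version (fun t => ((hD t l).1).locInt_right) fun φ hφ hc => by
      have e : (fun t => ∫ x, φ x • D t l x) = fun t => -∫ x, partialDeriv l φ x • v (t, x) := by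
        funext t
        rw [(hD t l).1.integral_eq φ hφ hc, neg_neg]
      rw [e]
      refine (StronglyMeasurable.integral_prod_right'
        (f := fun z : SpaceTime => partialDeriv l φ z.2 • v z) ?_).neg
      exact ((continuous_partialDeriv hφ l).comp continuous_snd).stronglyMeasurable.smul hv
  choose g hg hgD using hver
  exact ⟨σ, v, g, hσ, fun k => hsol _, hv, hg, hL, fun t => (hp t).congr fun l => (hgD l t).symm,
    fun l t => (hD t l).1.congr (hgD l t).symm, fun l t => (hD t l).2.congr (hgD l t).symm, hcont⟩

theorem isWeakPartial_partialDeriv {f : Plane → Amb} (hf : ContDiff ℝ ∞ f) (l : Fin 2) :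
    IsWeakPartial l f (partialDeriv l f) where
  locInt_left := hf.continuous.locallyIntegrable
  locInt_right := (continuous_partialDeriv hf l).locallyIntegrable
  integral_eq φ hφ hc := by rw [integral_smul_partialDeriv hφ hc hf, neg_neg]

namespace IsFlowLimit

variable {C : ℝ≥0} {us : ℕ → SpaceTime → Amb} {v : SpaceTime → Amb} {Dv : Fin 2 → SpaceTime → Amb}

theorem tendsto_integral_dot (h : IsFlowLimit C us v Dv) (t : ℝ) {q r : ℝ≥0∞}
    [q.HolderConjugate r] (hq : q ≠ ⊤) {K : Set Plane} (hK : IsCompact K) {χ : Plane → Amb}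
    (hχ : MemLp χ r (volume.restrict K)) :
    Tendsto (fun k => ∫ x in K, us k (t, x) ⬝ᵥ χ x) atTop (𝓝 (∫ x in K, v (t, x) ⬝ᵥ χ x)) := by
  obtain ⟨R, hR⟩ := hK.isBounded.subset_ball 0
  have hV : volume K ≠ ⊤ := hK.measure_lt_top.ne
  have hm := fun k => ((h.lim t).slice k).smooth.continuous.aestronglyMeasurable (μ := volume)
  have hint : ∀ {f : Plane → Amb}, MemLp f q (volume.restrict K) →
      Integrable (fun x => f x ⬝ᵥ χ x) (volume.restrict K) := fun {f} hf =>
    ⟨AEStronglyMeasurable.measurable_comp₂ measurable_dotProduct hf.1 hχ.1,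
      (lintegral_enorm_dot_le (q := q) (r := r) hf.1 hχ.1).trans_lt
        (ENNReal.mul_lt_top (ENNReal.mul_lt_top (by simp) hf.2) hχ.2)⟩
  have h1 := hint ((h.lim t).hasLpBounds.memLp (h.lim t).meas hq hK.measurableSet hV)
  have h2 := fun k => hint (((h.lim t).slice k).hasLpBounds.memLp (hm k) hq hK.measurableSet hV)
  refine tendsto_integral_of_L1 _ h1.1 (Eventually.of_forall h2) ?_
  have h0 := (h.lim t).tendsto_eLpNorm hK.measurableSet hR
    (ENNReal.HolderConjugate.one_le q r) hq
  have h3 : Tendsto (fun k => 3 * eLpNorm ((fun x => us k (t, x)) - fun x => v (t, x)) q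
      (volume.restrict K) * eLpNorm χ r (volume.restrict K)) atTop (𝓝 0) := by
    have := ENNReal.Tendsto.mul_const (ENNReal.Tendsto.const_mul (a := 3) h0 (Or.inr (by simp)))
      (b := eLpNorm χ r (volume.restrict K)) (Or.inr hχ.2.ne)
    simpa using this
  refine tendsto_of_tendsto_of_tendsto_of_le_of_le tendsto_const_nhds h3 (fun _ => zero_le)
    fun k => ?_
  refine le_trans (le_of_eq ?_) (lintegral_enorm_dot_le (q := q) (r := r)
    ((hm k).sub (h.lim t).meas).restrict hχ.1)
  simp only [Pi.sub_apply, sub_dotProduct]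

theorem exists_eLpNorm_le (h : IsFlowLimit C us v Dv) {q : ℝ≥0∞} (hq : q ≠ ⊤) {K : Set Plane}
    (hK : MeasurableSet K) (hV : volume K ≠ ⊤) : ∃ B : ℝ≥0,
      (∀ k t, eLpNorm (fun x => us k (t, x)) q (volume.restrict K) ≤ B) ∧
      ∀ t, eLpNorm (fun x => v (t, x)) q (volume.restrict K) ≤ B :=
  have hV' := (ENNReal.coe_toNNReal hV).ge
  ⟨sliceBound C q (volume K).toNNReal,
    fun k t => ((h.lim t).slice k).hasLpBounds q _ K hq hK hV',
    fun t => (h.lim t).hasLpBounds q _ K hq hK hV'⟩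

theorem exists_eLpNorm_grad_le (h : IsFlowLimit C us v Dv) {q : ℝ≥0∞} (hq : q < 2) {K : Set Plane}
    (hK : MeasurableSet K) (hV : volume K ≠ ⊤) : ∃ B : ℝ≥0, ∀ l,
      (∀ k t, eLpNorm (fun x => dx l (us k) (t, x)) q (volume.restrict K) ≤ B) ∧
      ∀ t, eLpNorm (fun x => Dv l (t, x)) q (volume.restrict K) ≤ B := by
  obtain ⟨B, hB⟩ := IsFieldPair.exists_eLpNorm_field_le C (sliceBound C) hq (volume K).toNNReal
  have hV' := (ENNReal.coe_toNNReal hV).ge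
  exact ⟨B, fun l => ⟨fun k t => hB _ _ ((h.lim t).slice k).isFieldPair
    ((h.lim t).slice k).hasLpBounds K hK hV' l,
    fun t => hB _ _ (h.pair t) (h.lim t).hasLpBounds K hK hV' l⟩⟩

theorem aestronglyMeasurable_dx (h : IsFlowLimit C us v Dv) (l : Fin 2) (k : ℕ) :
    AEStronglyMeasurable (dx l (us k)) :=
  (contDiff_dx (h.sol k).smooth l).continuous.aestronglyMeasurable

theorem tendstoWeakStarW1p (h : IsFlowLimit C us v Dv) {p : ℝ≥0∞} (hp : 1 ≤ p) (hp2 : p < 2) :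
    TendstoWeakStarW1p p us (fun k l => dx l (us k)) v Dv where
  mem k := by
    refine ⟨⟨(h.sol k).smooth.continuous.aestronglyMeasurable, fun K hK => ?_⟩,
      fun l => ⟨h.aestronglyMeasurable_dx l k, fun K hK => ?_⟩,
      fun l t => isWeakPartial_partialDeriv (contDiff_slice (h.sol k).smooth t) l⟩
    · obtain ⟨B, hB, -⟩ := h.exists_eLpNorm_le (ne_top_of_lt hp2) hK.measurableSet
        hK.measure_lt_top.ne
      exact ⟨B, Eventually.of_forall (hB k)⟩
    · obtain ⟨B, hB⟩ := h.exists_eLpNorm_grad_le hp2 hK.measurableSet hK.measure_lt_top.ne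
      exact ⟨B, Eventually.of_forall ((hB l).1 k)⟩
  mem_limit := by
    refine ⟨⟨h.meas.aestronglyMeasurable, fun K hK => ?_⟩,
      fun l => ⟨(h.meas_grad l).aestronglyMeasurable, fun K hK => ?_⟩, h.weak⟩
    · obtain ⟨B, -, hB⟩ := h.exists_eLpNorm_le (ne_top_of_lt hp2) hK.measurableSet
        hK.measure_lt_top.ne
      exact ⟨B, Eventually.of_forall hB⟩
    · obtain ⟨B, hB⟩ := h.exists_eLpNorm_grad_le hp2 hK.measurableSet hK.measure_lt_top.ne
      exact ⟨B, Eventually.of_forall (hB l).2⟩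
  tendsto := by
    refine tendstoWeakStarLp_of_slices hp hp2
      (fun k => (h.sol k).smooth.continuous.aestronglyMeasurable) h.meas.aestronglyMeasurable
      (fun q hq K hK => h.exists_eLpNorm_le (ne_top_of_lt hq) hK.measurableSet
        hK.measure_lt_top.ne) fun t r hr hrt K hK χ hχ => ?_
    have : r.conjExponent.HolderConjugate r :=
      (ENNReal.HolderConjugate.conjExponent (one_le_two.trans hr.le)).symm
    exact h.tendsto_integral_dot t (ne_top_of_lt (conjExponent_lt_two hr)) hK hχ
  tendsto_grad l := by
    refine tendstoWeakStarLp_of_slices hp hp2 (h.aestronglyMeasurable_dx l)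
      (h.meas_grad l).aestronglyMeasurable (fun q hq K hK => ?_)
      fun t r hr hrt K hK χ hχ => ?_
    · obtain ⟨B, hB⟩ := h.exists_eLpNorm_grad_le hq hK.measurableSet hK.measure_lt_top.ne
      exact ⟨B, hB l⟩
    · obtain ⟨s, hs, hst⟩ := holderTriple_of_two_lt hr
      obtain ⟨R, hR⟩ := hK.isBounded.subset_ball 0
      exact h.field l t s r hs hst K R hK.measurableSet hR (fun _ => χ) χ (fun _ => hχ) hχ
        (by simp)

/-- Bounds of the slices in `L¹` of discs. -/
theorem exists_sliceBounded (h : IsFlowLimit C us v Dv) :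
    ∃ B, (∀ k, SliceBounded (us k) B) ∧ SliceBounded v B := by
  choose B hBs hB using fun R => h.exists_eLpNorm_le (q := 1) (by simp)
    (measurableSet_ball (x := (0 : Plane)) (ε := R)) measure_ball_lt_top.ne
  simp only [eLpNorm_one_eq_lintegral_enorm] at hBs hB
  exact ⟨B, fun k t R => hBs R k t, fun t R => hB R t⟩

theorem exists_sliceBounded_cross (h : IsFlowLimit C us v Dv) :
    ∃ B, ∀ l, (∀ k, SliceBounded (fun z => crossProduct (us k z) (dx l (us k) z)) B) ∧
      SliceBounded (fun z => crossProduct (v z) (Dv l z)) B := by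
  choose B hB using fun R => IsFieldPair.exists_eLpNorm_cross_le C (sliceBound C)
    (volume (Metric.ball (0 : Plane) R)).toNNReal
  simp only [eLpNorm_one_eq_lintegral_enorm] at hB
  have hV' := fun R => (ENNReal.coe_toNNReal
    (measure_ball_lt_top (μ := volume) (x := (0 : Plane)) (r := R)).ne).ge
  exact ⟨B, fun l => ⟨fun k t R => hB R _ _ ((h.lim t).slice k).isFieldPair
    ((h.lim t).slice k).hasLpBounds _ measurableSet_ball (hV' R) l,
    fun t R => hB R _ _ (h.pair t) (h.lim t).hasLpBounds _ measurableSet_ball (hV' R) l⟩⟩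

theorem aestronglyMeasurable_cross (h : IsFlowLimit C us v Dv) (l : Fin 2) :
    AEStronglyMeasurable fun z => crossProduct (v z) (Dv l z) :=
  crossL.aestronglyMeasurable_comp₂ h.meas.aestronglyMeasurable (h.meas_grad l).aestronglyMeasurable

theorem locallyIntegrable_cross (h : IsFlowLimit C us v Dv) (l : Fin 2) :
    LocallyIntegrable fun z => crossProduct (v z) (Dv l z) := by
  obtain ⟨B, hB⟩ := h.exists_sliceBounded_cross
  exact (hB l).2.locallyIntegrable (h.aestronglyMeasurable_cross l)

theorem integral_sum_smul_eta {φ : SpaceTime → ℝ} (hφ : ContDiff ℝ ∞ φ) (hc : HasCompactSupport φ)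
    {F : Fin 2 → SpaceTime → Amb} (hF : ∀ l, LocallyIntegrable (F l)) :
    ∫ z, ∑ l, dx l φ z • eta (F l z) = ∑ l, eta (∫ z, dx l φ z • F l z) := by
  have hi : ∀ l, Integrable fun z => dx l φ z • F l z := fun l => by
    refine (hF l).integrable_smul_left_of_hasCompactSupport (contDiff_dx hφ l).continuous ?_
    rw [dx_eq_fderiv (hφ.differentiable (by simp))]
    exact hc.fderiv_apply ℝ _
  have e : ∀ l z, dx l φ z • eta (F l z) = etaL (dx l φ z • F l z) := fun l z => by
    rw [map_smul, etaL_apply]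
  simp only [e]
  rw [integral_finsetSum _ fun l _ => etaL.integrable_comp (hi l)]
  exact Finset.sum_congr rfl fun l _ => etaL.integral_comp_comm (hi l)

/-- Each smooth map satisfies the identity in divergence form. Both sides pass to the limit: the
left by strong convergence at each time, the right by the weak–strong products, under `L¹_loc`
bounds uniform in time. -/
theorem integral_dt_smul_eq (h : IsFlowLimit C us v Dv) {φ : SpaceTime → ℝ} (hφ : ContDiff ℝ ∞ φ)
    (hc : HasCompactSupport φ) : ∫ z, dt φ z • v z =
      ∫ z, ∑ l : Fin 2, dx l φ z • eta (crossProduct (v z) (Dv l z)) := by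
  obtain ⟨B, hBs, hB⟩ := h.exists_sliceBounded
  obtain ⟨B', hB'⟩ := h.exists_sliceBounded_cross
  have hdx : ∀ l, Continuous (dx l φ) := fun l => (contDiff_dx hφ l).continuous
  have hcx : ∀ l, HasCompactSupport (dx l φ) := fun l => by
    rw [dx_eq_fderiv (hφ.differentiable (by simp))]
    exact hc.fderiv_apply ℝ _
  have hcc : ∀ l k, Continuous fun z => crossProduct (us k z) (dx l (us k) z) := fun l k =>
    ((crossL.contDiff.comp (h.sol k).smooth).clm_apply (contDiff_dx (h.sol k).smooth l)).continuous
  have h1 : Tendsto (fun k => ∫ z, dt φ z • us k z) atTop (𝓝 (∫ z, dt φ z • v z)) := by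
    refine SliceBounded.tendsto_integral_smul hBs hB
      (fun k => (h.sol k).smooth.continuous.aestronglyMeasurable) h.meas.aestronglyMeasurable
      (fun t χ hχ hχc => (h.lim t).tendsto_integral_smul hχ hχc) (contDiff_dt hφ).continuous ?_
    rw [dt_eq_fderiv (hφ.differentiable (by simp))]
    exact hc.fderiv_apply ℝ _
  have h2 : ∀ l, Tendsto (fun k => ∫ z, dx l φ z • crossProduct (us k z) (dx l (us k) z)) atTop
      (𝓝 (∫ z, dx l φ z • crossProduct (v z) (Dv l z))) := fun l =>
    SliceBounded.tendsto_integral_smul (hB' l).1 (hB' l).2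
      (fun k => (hcc l k).aestronglyMeasurable) (h.aestronglyMeasurable_cross l)
      (fun t χ hχ hχc => (h.lim t).tendsto_integral_cross (h.pair t) (h.field l t) hχ hχc)
      (hdx l) (hcx l)
  rw [integral_sum_smul_eta hφ hc h.locallyIntegrable_cross]
  refine tendsto_nhds_unique h1 ((tendsto_finsetSum Finset.univ fun l _ =>
    (etaL.continuous.tendsto _).comp (h2 l)).congr fun k => ?_)
  rw [HypSM.integral_dt_smul_eq (h.sol k).smooth
    (fun l => IsSmoothSchrodingerMap.contDiff_flux (h.sol k).smooth l) (h.sol k).dt_eq hφ hc]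
  exact (integral_sum_smul_eta hφ hc fun l => (hcc l k).locallyIntegrable).symm

theorem continuousL2Loc (h : IsFlowLimit C us v Dv) : ContinuousL2Loc v := by
  intro K hK
  obtain ⟨R, hR⟩ := hK.isBounded.subset_ball 0
  exact ⟨fun t => (h.lim t).hasLpBounds.memLp (h.lim t).meas (by simp) hK.measurableSet
    hK.measure_lt_top.ne, fun t => tendsto_eLpNorm_sub_of_hasLpBounds (fun s => (h.lim s).meas)
    (h.lim t).meas (fun s => (h.lim s).hasLpBounds) (h.lim t).hasLpBounds hK.measurableSet hR
    (h.cont t R) one_le_two (by simp)⟩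

theorem isWeakSolution (h : IsFlowLimit C us v Dv) : IsWeakSolution v Dv where
  mem_hypPlane t := (h.lim t).mem
  weakGradient := h.weak
  continuousL2Loc := h.continuousL2Loc
  locInt := by
    obtain ⟨B, -, hB⟩ := h.exists_sliceBounded
    exact hB.locallyIntegrable h.meas.aestronglyMeasurable
  locInt_flux := h.locallyIntegrable_cross
  equation _ hφ hc := h.integral_dt_smul_eq hφ hc
  initial_energy := (h.pair 0).energy_le.trans_lt ENNReal.coe_lt_top
  initial_mass := (h.lim 0).mass_le.trans_lt ENNReal.coe_lt_top

end IsFlowLimit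

end HypSM

/-! ### Conclusion for sequences of smooth Schrödinger maps. -/

theorem proposition4p2 (C : NNReal) (u : ℕ → HypSM.SpaceTime → HypSM.Amb)
    (hsol : ∀ j, HypSM.IsSmoothSchrodingerMap (u j))
    (hbound : ∀ j, HypSM.HasBounds C (u j)) :
    ∃ (σ : ℕ → ℕ) (v : HypSM.SpaceTime → HypSM.Amb) (Dv : Fin 2 → HypSM.SpaceTime → HypSM.Amb),
      StrictMono σ ∧
      HypSM.IsWeakSolution v Dv ∧
      (∀ p : ENNReal, 1 ≤ p → p < 2 →
        HypSM.TendstoWeakStarW1p p (fun j => u (σ j)) (fun j k => HypSM.dx k (u (σ j))) v Dv) ∧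
      ∀ t : ℝ, HypSM.energy Dv t ≤ C ∧ HypSM.mass v t ≤ C := by
  obtain ⟨σ, v, Dv, hσ, h⟩ := HypSM.exists_isFlowLimit hsol fun j t => (hsol j).isSlice (hbound j) t
  exact ⟨σ, v, Dv, hσ, h.isWeakSolution, fun p hp hp2 => h.tendstoWeakStarW1p hp hp2,
    fun t => ⟨(h.pair t).energy_le, (h.lim t).mass_le⟩⟩
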